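/- \textbf{Setting.} For each $n$ let $\boldsymbol d_n=(d_{n,1},\dots,d_{n,n})$ be a sequence of non-negative integers, let $n_{n,k}=|\{i: d_{n,i}=k\}|$, and let $D_n$ be the degree distribution, $\Pr(D_n=k)=n_{n,k}/n$. Assume that there is a probability distribution $D$ on $\{0,1,2,\dots\}$ such that: (i) for every $n$, $\boldsymbol d_n$ is the degree sequence of some simple graph on $[n]$; (ii) $D_n\to D$ in distribution; (iii) $\mathbb E[D^2]<\infty$, $\mathbb E[D_n]\to\mathbb E[D]$ and $\mathbb E[D_n^2]\to\mathbb E[D^2]$; (iv) for all sufficiently large $n$, $n_{n,k}=0$ for every $k$ with $\Pr(D=k)=0$. Put $\nu=\mathbb E[D(D-1)]/\mathbb E[D]$ (with $\nu=0$ if $\mathbb E[D]=0$). The configuration model $\mathbb{CM}_n(\boldsymbol d_n)$ is the random multigraph on $[n]$ obtained by attaching $d_{n,v}$ half-edges to each vertex $v$ and choosing a uniformly random perfect matching of all half-edges, each matched pair becoming an edge (loops and multiple edges are allowed). A connected multigraph is \emph{unicyclic} if it has as many edges as vertices; a \emph{fragment} is a finite multigraph all of whose connected components are unicyclic (the empty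 multigraph included), and an \emph{unlabelled fragment} is an isomorphism class of fragments. Let $\mathrm{Frag}^*_n$ be the union of the unicyclic components of $\mathbb{CM}_n(\boldsymbol d_n)$. \textbf{Theorem.} Assume $\nu<1$. Then for every unlabelled fragment $H$ the limit \[ p^*(H)=\lim_{n\to\infty}\Pr(\mathrm{Frag}^*_n\simeq H) \] exists, and \[ \sum_H p^*(H)=1, \] where $H$ ranges over all finite unlabelled fragments. -/

import Mathlib

open Filter Topology

/-- A multigraph on the vertex set `V` (which is finite in all uses below), given by the
multiplicity of every unordered pair `s(u, v)`; the case `u = v` gives the loops at `u`. -/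
@[ext]
structure Multigraph (V : Type) where
  mult : Sym2 V → ℕ

namespace Multigraph

variable {V W U : Type}

/-- The number of edges, counted with multiplicity (`V` finite). -/
noncomputable def edgeCount (G : Multigraph V) : ℕ := ∑ᶠ e : Sym2 V, G.mult e

/-- `|E(G)| - |V(G)|`. -/
noncomputable def excess (G : Multigraph V) : ℤ := (G.edgeCount : ℤ) - (Nat.card V : ℤ)

/-- The simple graph obtained by forgetting loops and multiplicities. It has the same connected
components as the multigraph. -/
def underlying (G : Multigraph V) : SimpleGraph V :=
  SimpleGraph.fromEdgeSet {e | G.mult e ≠ 0}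

/-- The sub-multigraph induced on a set of vertices. -/
def induce (G : Multigraph V) (S : Set V) : Multigraph S where
  mult e := G.mult (e.map Subtype.val)

/-- Unicyclic: connected with as many edges as vertices. -/
def IsUnicyclic (G : Multigraph V) : Prop := G.underlying.Connected ∧ G.excess = 0

/-- The connected component `C` of `G` is unicyclic. -/
def UnicyclicComponent (G : Multigraph V) (C : G.underlying.ConnectedComponent) : Prop :=
  (G.induce C.supp).IsUnicyclic

/-- A fragment: every connected component is unicyclic. The empty multigraph is a fragment. -/
def IsFragment (G : Multigraph V) : Prop :=
  ∀ C : G.underlying.ConnectedComponent, G.UnicyclicComponent C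

/-- The vertices that lie in unicyclic components. -/
def fragVerts (G : Multigraph V) : Set V :=
  {v | G.UnicyclicComponent (G.underlying.connectedComponentMk v)}

/-- `Frag(G)`: the union of the unicyclic components of `G`. -/
def frag (G : Multigraph V) : Multigraph G.fragVerts := G.induce G.fragVerts

/-- Isomorphism of multigraphs: a bijection of the vertices that preserves all multiplicities. -/
def Isomorphic (G : Multigraph V) (H : Multigraph W) : Prop :=
  ∃ φ : V ≃ W, ∀ e : Sym2 V, H.mult (e.map φ) = G.mult e

theorem Isomorphic.refl (G : Multigraph V) : G.Isomorphic G :=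
  ⟨Equiv.refl V, fun e => by simp⟩

theorem Isomorphic.symm {G : Multigraph V} {H : Multigraph W} (h : G.Isomorphic H) :
    H.Isomorphic G := by
  obtain ⟨φ, hφ⟩ := h
  refine ⟨φ.symm, fun e => ?_⟩
  rw [← hφ, Sym2.map_map]
  simp

theorem Isomorphic.trans {G : Multigraph V} {H : Multigraph W} {K : Multigraph U}
    (h₁ : G.Isomorphic H) (h₂ : H.Isomorphic K) : G.Isomorphic K := by
  obtain ⟨φ, hφ⟩ := h₁
  obtain ⟨ψ, hψ⟩ := h₂
  refine ⟨φ.trans ψ, fun e => ?_⟩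
  rw [← hφ, ← hψ, Sym2.map_map]
  rfl

end Multigraph

/-- A finite fragment, with vertex set `{0, …, order - 1}`. -/
structure FiniteFragment where
  order : ℕ
  graph : Multigraph (Fin order)
  isFragment : graph.IsFragment

/-- Isomorphism of finite fragments. -/
instance FiniteFragment.isoSetoid : Setoid FiniteFragment where
  r F F' := F.graph.Isomorphic F'.graph
  iseqv := ⟨fun F => Multigraph.Isomorphic.refl F.graph,
    Multigraph.Isomorphic.symm, Multigraph.Isomorphic.trans⟩

/-- Finite unlabelled fragments: isomorphism classes of finite fragments. -/
def UnlabelledFragment : Type := Quotient FiniteFragment.isoSetoid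

/-- `G ≃ H` for a multigraph `G` and an unlabelled fragment `H`. -/
def Multigraph.IsCopyOf {V : Type} (G : Multigraph V) (H : UnlabelledFragment) : Prop :=
  ∃ F : FiniteFragment, Quotient.mk FiniteFragment.isoSetoid F = H ∧ G.Isomorphic F.graph

namespace ConfigurationModel

/-- The half-edges of a degree sequence: `d v` half-edges are incident to the vertex `v`. -/
abbrev HalfEdge {n : ℕ} (d : Fin n → ℕ) : Type := Σ v : Fin n, Fin (d v)

/-- The perfect matchings of the set of half-edges: sets `M` of pairs of distinct half-edges such
that every half-edge belongs to exactly one pair. -/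
def matchings {n : ℕ} (d : Fin n → ℕ) : Set (Finset (Sym2 (HalfEdge d))) :=
  {M | (∀ e ∈ M, ¬ e.IsDiag) ∧ ∀ x : HalfEdge d, ∃! e, e ∈ M ∧ x ∈ e}

/-- The underlying multigraph of a matching of the half-edges: the multiplicity of `s(u, v)` is
the number of matched pairs `s(x, y)` with `x` incident to `u` and `y` incident to `v`. -/
def toMultigraph {n : ℕ} {d : Fin n → ℕ} (M : Finset (Sym2 (HalfEdge d))) :
    Multigraph (Fin n) where
  mult e := (M.filter fun p => p.map Sigma.fst = e).card

/-- The probability that the multigraph of a uniformly random perfect matching of the half-edges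
has the property `P`. -/
noncomputable def prob {n : ℕ} (d : Fin n → ℕ) (P : Multigraph (Fin n) → Prop) : ℝ :=
  ({M | M ∈ matchings d ∧ P (toMultigraph M)}.ncard : ℝ) / ((matchings d).ncard : ℝ)

/-- The probability that the fragment of the configuration model is isomorphic to `H`. -/
noncomputable def fragProb {n : ℕ} (d : Fin n → ℕ) (H : UnlabelledFragment) : ℝ :=
  prob d fun G => G.frag.IsCopyOf H

end ConfigurationModel

/-- `d` is the degree sequence of some simple graph on `Fin n`. -/
def Feasible {n : ℕ} (d : Fin n → ℕ) : Prop :=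
  ∃ G : SimpleGraph (Fin n), ∀ v, (G.neighborSet v).ncard = d v

/-- The number of vertices of degree `k`. -/
def degreeCount {n : ℕ} (d : Fin n → ℕ) (k : ℕ) : ℕ :=
  (Finset.univ.filter fun v => d v = k).card

/-- `E[D]` for a distribution `D` on the non-negative integers. -/
noncomputable def firstMoment (D : PMF ℕ) : ℝ := ∑' k : ℕ, (k : ℝ) * (D k).toReal

/-- `E[D ^ 2]`. -/
noncomputable def secondMoment (D : PMF ℕ) : ℝ := ∑' k : ℕ, (k : ℝ) ^ 2 * (D k).toReal

/-- `E[D (D - 1)]`. -/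
noncomputable def secondFactorialMoment (D : PMF ℕ) : ℝ :=
  ∑' k : ℕ, (k : ℝ) * ((k : ℝ) - 1) * (D k).toReal

/-- `ν = E[D (D - 1)] / E[D]`. -/
noncomputable def nu (D : PMF ℕ) : ℝ := secondFactorialMoment D / firstMoment D

/-- The standing assumption on the sequence of degree sequences `d` and the limiting degree
distribution `D`. Here `D_n` is the degree of a uniformly random vertex under `d n`, so that
`P(D_n = k) = degreeCount (d n) k / n`. As `D_n` and `D` are integer valued, convergence in
distribution is convergence of the point probabilities. -/
structure RegularDegrees (d : (n : ℕ) → Fin n → ℕ) (D : PMF ℕ) : Prop where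
  feasible : ∀ n, Feasible (d n)
  tendsto_law : ∀ k,
    Tendsto (fun n => (degreeCount (d n) k : ℝ) / (n : ℝ)) atTop (𝓝 (D k).toReal)
  finite_secondMoment : Summable fun k : ℕ => (k : ℝ) ^ 2 * (D k).toReal
  tendsto_firstMoment :
    Tendsto (fun n => (∑ v, (d n v : ℝ)) / (n : ℝ)) atTop (𝓝 (firstMoment D))
  tendsto_secondMoment :
    Tendsto (fun n => (∑ v, (d n v : ℝ) ^ 2) / (n : ℝ)) atTop (𝓝 (secondMoment D))
  no_rare_degrees : ∀ᶠ n in atTop, ∀ k, D k = 0 → degreeCount (d n) k = 0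

/-! The proof is a truncated method of moments. Two uniform estimates justify it, both consequences
of `ν < 1`. Limit of the truncated moments. Let a set of `k` vertices be a union of unicyclic
components. It carries `k` edges, hence `2k` half-edges. For a fixed degree vector with sum `2k`
there are about `n ^ k ∏ P(D = δ i)` ways to place the vertices. A given matching of their
half-edges occurs with probability about `(n E[D]) ^ (-k)`. The powers of `n` cancel because edges
and vertices are equal in number, so every expected weighted count of such pieces converges
(`exists_tendsto_sum_closedRange`). From counts to the event. By Möbius inversion over subsets of
the set of unicyclic components, the indicator of `Frag ≃ H` is a sum over subsets `T` of a weight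
that depends only on the multigraph induced on `T` (`sum_signedCopies`). Grouped by the number of
vertices, this is a combination of the counts above. If only sets with at most `K` vertices are
kept, the error vanishes unless `Frag` has more than `K` vertices, and it is at most `2 * 3 ^ X`,
where `X` is the number of unicyclic components. As `2x ≤ η⁻¹ + η x ^ 2`, it remains to bound `E[9 ^
X]` uniformly and to make `P(|Frag| > K)` small. Chains. Follow matched pairs, changing half-edges
inside each visited vertex. Each further visit multiplies the expected number of chains by at most
`q < 1`, the ratio of ordered pairs of half-edges at a common vertex to half-edges
(`sum_chainSum_le`). Hence the expected number of `r`-tuples of disjoint rooted cycles is at most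
`(1 - q)⁻¹ ^ r`. It dominates the `r`-th factorial moment of `X`, so `E[9 ^ X] ≤ exp (8 / (1 - q))`.
Tightness. Every vertex of `Frag` lies on a cycle or is joined to one by a tail. At the junction
three half-edges are used, which would require a third moment. So junctions of degree above `Δ` are
excluded, at a cost that the convergence of second moments makes small; the other lollipops number
at most `Δ (1 - q)⁻¹ ^ 2` in expectation. Markov's inequality then controls `|Frag|`. Tightness also
gives total mass one, since there are only finitely many fragments with at most `K` vertices. -/

set_option linter.unusedSectionVars false

/-! ### Perfect matchings and their number -/

/-- The perfect matchings of a finite set `S`. -/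
noncomputable def perfectMatchings {α : Type} [Fintype α] [DecidableEq α] (S : Finset α) :
    Finset (Finset (Sym2 α)) :=
  open Classical in
  Finset.univ.filter fun M =>
    (∀ e ∈ M, ¬ e.IsDiag ∧ ∀ x ∈ e, x ∈ S) ∧ ∀ x ∈ S, ∃! e, e ∈ M ∧ x ∈ e

/-- The number of perfect matchings of a set with `n` elements. -/
def matchingCount : ℕ → ℕ
  | 0 => 1
  | 1 => 0
  | n + 2 => (n + 1) * matchingCount n

theorem matchingCount_of_two_le {n : ℕ} (h : 2 ≤ n) :
    matchingCount n = (n - 1) * matchingCount (n - 2) := by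
  obtain ⟨k, rfl⟩ := Nat.exists_eq_add_of_le' h
  simp [matchingCount]

theorem matchingCount_pos_of_even {n : ℕ} (h : Even n) : 0 < matchingCount n := by
  obtain ⟨k, rfl⟩ := h
  induction k with
  | zero => simp [matchingCount]
  | succ k ih =>
    rw [show k + 1 + (k + 1) = (k + k) + 2 by ring, matchingCount]
    positivity

section Matchings

variable {α : Type} [Fintype α] [DecidableEq α] {S : Finset α} {M : Finset (Sym2 α)} {a b : α}

theorem mem_perfectMatchings :
    M ∈ perfectMatchings S ↔
      (∀ e ∈ M, ¬ e.IsDiag ∧ ∀ x ∈ e, x ∈ S) ∧ ∀ x ∈ S, ∃! e, e ∈ M ∧ x ∈ e := by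
  simp [perfectMatchings]

theorem perfectMatchings.ne (hM : M ∈ perfectMatchings S) (h : s(a, b) ∈ M) : a ≠ b := by
  have := ((mem_perfectMatchings.1 hM).1 _ h).1
  simpa using this

theorem perfectMatchings.mem_left (hM : M ∈ perfectMatchings S) (h : s(a, b) ∈ M) : a ∈ S :=
  ((mem_perfectMatchings.1 hM).1 _ h).2 a (by simp)

theorem perfectMatchings.mem_right (hM : M ∈ perfectMatchings S) (h : s(a, b) ∈ M) : b ∈ S :=
  ((mem_perfectMatchings.1 hM).1 _ h).2 b (by simp)

theorem perfectMatchings.eq_of_mem (hM : M ∈ perfectMatchings S) {e f : Sym2 α} (he : e ∈ M)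
    (hf : f ∈ M) {x : α} (hxe : x ∈ e) (hxf : x ∈ f) : e = f :=
  ((mem_perfectMatchings.1 hM).2 x (((mem_perfectMatchings.1 hM).1 e he).2 x hxe)).unique
    ⟨he, hxe⟩ ⟨hf, hxf⟩

theorem perfectMatchings.partner_unique (hM : M ∈ perfectMatchings S) {c : α}
    (h : s(a, b) ∈ M) (h' : s(a, c) ∈ M) : b = c := by
  have := perfectMatchings.eq_of_mem hM h h' (Sym2.mem_mk_left a b) (Sym2.mem_mk_left a c)
  exact Sym2.congr_right.1 this

theorem perfectMatchings.exists_partner (hM : M ∈ perfectMatchings S) (ha : a ∈ S) :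
    ∃ b, s(a, b) ∈ M := by
  obtain ⟨e, ⟨he, hae⟩, -⟩ := (mem_perfectMatchings.1 hM).2 a ha
  obtain ⟨b, rfl⟩ := hae
  exact ⟨b, he⟩

theorem perfectMatchings_erase (hM : M ∈ perfectMatchings S) (h : s(a, b) ∈ M) :
    M.erase s(a, b) ∈ perfectMatchings (S \ {a, b}) := by
  rw [mem_perfectMatchings]
  constructor
  · intro e he
    rw [Finset.mem_erase] at he
    refine ⟨((mem_perfectMatchings.1 hM).1 e he.2).1, fun x hx => ?_⟩
    have hxS := ((mem_perfectMatchings.1 hM).1 e he.2).2 x hx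
    simp only [Finset.mem_sdiff, hxS, Finset.mem_insert, Finset.mem_singleton, true_and]
    rintro (rfl | rfl)
    · exact he.1 (perfectMatchings.eq_of_mem hM he.2 h hx (by simp))
    · exact he.1 (perfectMatchings.eq_of_mem hM he.2 h hx (by simp))
  · intro x hx
    simp only [Finset.mem_sdiff, Finset.mem_insert, Finset.mem_singleton, not_or] at hx
    obtain ⟨e, ⟨he, hxe⟩, hu⟩ := (mem_perfectMatchings.1 hM).2 x hx.1
    refine ⟨e, ⟨Finset.mem_erase.2 ⟨?_, he⟩, hxe⟩, fun f hf => hu f ⟨Finset.mem_of_mem_erase hf.1, hf.2⟩⟩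
    rintro rfl
    simp only [Sym2.mem_iff] at hxe
    tauto

theorem not_mem_of_mem_sdiff (hM : M ∈ perfectMatchings (S \ {a, b})) : s(a, b) ∉ M := fun h => by
  simpa using perfectMatchings.mem_left hM h

theorem perfectMatchings_insert (ha : a ∈ S) (hb : b ∈ S) (hab : a ≠ b)
    (hM : M ∈ perfectMatchings (S \ {a, b})) : insert s(a, b) M ∈ perfectMatchings S := by
  have key : ∀ e ∈ M, ∀ x ∈ e, x ∈ S ∧ x ≠ a ∧ x ≠ b := fun e he x hx => by
    have := ((mem_perfectMatchings.1 hM).1 e he).2 x hx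
    simp only [Finset.mem_sdiff, Finset.mem_insert, Finset.mem_singleton, not_or] at this
    exact this
  rw [mem_perfectMatchings]
  constructor
  · intro e he
    rw [Finset.mem_insert] at he
    rcases he with rfl | he
    · refine ⟨by simpa using hab, fun x hx => ?_⟩
      rw [Sym2.mem_iff] at hx
      rcases hx with rfl | rfl <;> assumption
    · exact ⟨((mem_perfectMatchings.1 hM).1 e he).1, fun x hx => (key e he x hx).1⟩
  · intro x hx
    by_cases hxab : x = a ∨ x = b
    · refine ⟨s(a, b), ⟨by simp, by simpa using hxab⟩, ?_⟩
      rintro f ⟨hf, hxf⟩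
      rw [Finset.mem_insert] at hf
      rcases hf with rfl | hf
      · rfl
      · have := key f hf x hxf
        tauto
    · obtain ⟨e, ⟨he, hxe⟩, hu⟩ := (mem_perfectMatchings.1 hM).2 x (by
        simp only [Finset.mem_sdiff, Finset.mem_insert, Finset.mem_singleton]; exact ⟨hx, hxab⟩)
      refine ⟨e, ⟨Finset.mem_insert_of_mem he, hxe⟩, ?_⟩
      rintro f ⟨hf, hxf⟩
      rw [Finset.mem_insert] at hf
      rcases hf with rfl | hf
      · simp only [Sym2.mem_iff] at hxf
        exact absurd hxf hxab
      · exact hu f ⟨hf, hxf⟩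

/-- Exposing one pair: deleting it is a bijection onto the matchings of the remaining points. All
later expectations are computed by repeating this step. -/
theorem sum_perfectMatchings_mem {β : Type*} [AddCommMonoid β] (ha : a ∈ S) (hb : b ∈ S)
    (hab : a ≠ b) (f : Finset (Sym2 α) → β) :
    ∑ M ∈ perfectMatchings S with s(a, b) ∈ M, f M =
      ∑ M ∈ perfectMatchings (S \ {a, b}), f (insert s(a, b) M) := by
  refine Finset.sum_bij' (fun M _ => M.erase s(a, b)) (fun M _ => insert s(a, b) M) ?_ ?_ ?_ ?_ ?_
  · intro M hM
    rw [Finset.mem_filter] at hM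
    exact perfectMatchings_erase hM.1 hM.2
  · intro M hM
    exact Finset.mem_filter.2 ⟨perfectMatchings_insert ha hb hab hM, by simp⟩
  · intro M hM
    exact Finset.insert_erase (Finset.mem_filter.1 hM).2
  · intro M hM
    exact Finset.erase_insert (not_mem_of_mem_sdiff hM)
  · intro M hM
    rw [Finset.insert_erase (Finset.mem_filter.1 hM).2]

theorem sum_partner_eq_one {β : Type*} [AddCommMonoid β] (hM : M ∈ perfectMatchings S)
    (ha : a ∈ S) (z : β) : ∑ b ∈ S.erase a with s(a, b) ∈ M, z = z := by
  obtain ⟨b, hb⟩ := perfectMatchings.exists_partner hM ha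
  have : (S.erase a).filter (fun b => s(a, b) ∈ M) = {b} := by
    ext c
    simp only [Finset.mem_filter, Finset.mem_erase, Finset.mem_singleton]
    constructor
    · rintro ⟨-, hc⟩
      exact (perfectMatchings.partner_unique hM hb hc).symm
    · rintro rfl
      exact ⟨⟨(perfectMatchings.ne hM hb).symm, perfectMatchings.mem_right hM hb⟩, hb⟩
  rw [this, Finset.sum_singleton]

/-- A fixed point `a` has `n - 1` possible partners, and each leaves a set of `n - 2` points. -/
theorem card_perfectMatchings (S : Finset α) :
    (perfectMatchings S).card = matchingCount S.card := by
  induction hn : S.card using Nat.strong_induction_on generalizing S with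
  | _ n ih =>
    rcases S.eq_empty_or_nonempty with rfl | ⟨a, ha⟩
    · have : perfectMatchings (∅ : Finset α) = {∅} := by
        ext M
        simp only [mem_perfectMatchings, Finset.notMem_empty, Finset.mem_singleton]
        constructor
        · rintro ⟨h, -⟩
          rw [Finset.eq_empty_iff_forall_notMem]
          intro e he
          induction e with
          | _ x y => exact (h _ he).2 x (by simp)
        · rintro rfl
          simp
      rw [this]
      simp at hn
      simp [← hn, matchingCount]
    · have h1 : (perfectMatchings S).card =
          ∑ M ∈ perfectMatchings S, ∑ b ∈ S.erase a with s(a, b) ∈ M, 1 := by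
        rw [Finset.card_eq_sum_ones]
        exact Finset.sum_congr rfl fun M hM => (sum_partner_eq_one hM ha 1).symm
      have h2 : ∀ b ∈ S.erase a,
          ∑ M ∈ perfectMatchings S with s(a, b) ∈ M, 1 = matchingCount (n - 2) := by
        intro b hb
        rw [Finset.mem_erase] at hb
        rw [sum_perfectMatchings_mem ha hb.2 hb.1.symm, ← Finset.card_eq_sum_ones]
        have hc : (S \ {a, b}).card = n - 2 := by
          rw [Finset.card_sdiff_of_subset, Finset.card_pair hb.1.symm, hn]
          intro x; simp only [Finset.mem_insert, Finset.mem_singleton]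
          rintro (rfl | rfl)
          · exact ha
          · exact hb.2
        have : 0 < n := hn ▸ Finset.card_pos.2 ⟨a, ha⟩
        exact ih (n - 2) (by omega) _ hc
      rw [h1]
      simp only [Finset.sum_filter]
      rw [Finset.sum_comm]
      simp only [← Finset.sum_filter]
      rw [Finset.sum_congr rfl h2, Finset.sum_const, Finset.card_erase_of_mem ha, hn, smul_eq_mul]
      have : 0 < n := hn ▸ Finset.card_pos.2 ⟨a, ha⟩
      rcases Nat.lt_or_ge n 2 with h | h
      · obtain rfl : n = 1 := by omega
        simp [matchingCount]
      · rw [matchingCount_of_two_le h]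

end Matchings

/-! ### Chains of matched pairs: one factor `q` for each vertex visited -/

section Chains

variable {H V : Type} [Fintype H] [DecidableEq H] [DecidableEq V]

/-- Ordered pairs of distinct half-edges in `U` at the same vertex. -/
def transits (vert : H → V) (U : Finset H) : Finset (H × H) :=
  U.offDiag.filter fun t => vert t.1 = vert t.2

theorem mem_transits {vert : H → V} {U : Finset H} {t : H × H} :
    t ∈ transits vert U ↔ t.1 ∈ U ∧ t.2 ∈ U ∧ t.1 ≠ t.2 ∧ vert t.1 = vert t.2 := by
  simp [transits, and_assoc]

/-- The number of transits is at most a `q`-fraction of the number of half-edges. -/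
def Subcritical (vert : H → V) (q : ℝ) (U : Finset H) : Prop :=
  ((transits vert U).card : ℝ) ≤ q * ((U.card - 1 : ℕ) : ℝ)

/-- Removing `T` destroys every transit that starts in `T`, and `R` supplies at least `|T|` of
those. The left side of the inequality thus drops by at least `|T|` and the right side by at most `q
|T| ≤ |T|`. If the truncated `U.card - 1` is less than `|T|`, no transit is left. -/
theorem Subcritical.of_sdiff {vert : H → V} {q : ℝ} (q0 : 0 ≤ q) (q1 : q ≤ 1) {U T : Finset H}
    (h : Subcritical vert q U) (hT : T ⊆ U) {R : Finset (H × H)} (hTR : T.card ≤ R.card)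
    (hR : R ⊆ transits vert U) (hRT : ∀ t ∈ R, t.1 ∈ T) : Subcritical vert q (U \ T) := by
  have h1 : (transits vert (U \ T)).card + R.card ≤ (transits vert U).card := by
    rw [← Finset.card_union_of_disjoint]
    · refine Finset.card_le_card (Finset.union_subset (fun t ht => ?_) hR)
      rw [mem_transits] at ht ⊢
      simp only [Finset.mem_sdiff] at ht
      tauto
    · rw [Finset.disjoint_left]
      intro t ht htR
      rw [mem_transits] at ht
      simp only [Finset.mem_sdiff] at ht
      exact ht.1.2 (hRT t htR)
  unfold Subcritical at *
  have h2 : (U \ T).card = U.card - T.card := Finset.card_sdiff_of_subset hT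
  have h1' : ((transits vert (U \ T)).card : ℝ) + T.card ≤ (transits vert U).card := by
    exact_mod_cast (Nat.add_le_add_left hTR _).trans h1
  rw [h2]
  rcases Nat.lt_or_ge (U.card - 1) T.card with h3 | h3
  · have : ((U.card - 1 : ℕ) : ℝ) ≤ T.card := by exact_mod_cast h3.le
    have h4 : ((transits vert (U \ T)).card : ℝ) ≤ 0 := by nlinarith
    refine h4.trans ?_
    positivity
  · have h5 : U.card - 1 = (U.card - T.card - 1) + T.card := by omega
    have h6 : ((U.card - 1 : ℕ) : ℝ) = ((U.card - T.card - 1 : ℕ) : ℝ) + T.card := by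
      exact_mod_cast h5
    rw [h6] at h
    have : (0 : ℝ) ≤ T.card := by positivity
    nlinarith

theorem Subcritical.sdiff_transit {vert : H → V} {q : ℝ} (q0 : 0 ≤ q) (q1 : q ≤ 1) {U : Finset H}
    (h : Subcritical vert q U) {t : H × H} (ht : t ∈ transits vert U) :
    Subcritical vert q (U \ {t.1, t.2}) := by
  have ht' := mem_transits.1 ht
  refine h.of_sdiff q0 q1 (R := {t, (t.2, t.1)}) ?_ ?_ ?_ ?_
  · intro x; simp only [Finset.mem_insert, Finset.mem_singleton]
    rintro (rfl | rfl)
    · exact ht'.1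
    · exact ht'.2.1
  · rw [Finset.card_pair ht'.2.2.1, Finset.card_pair]
    intro h; exact ht'.2.2.1 (congrArg Prod.fst h)
  · intro x; simp only [Finset.mem_insert, Finset.mem_singleton]
    rintro (rfl | rfl)
    · exact ht
    · exact mem_transits.2 ⟨ht'.2.1, ht'.1, ht'.2.2.1.symm, ht'.2.2.2.symm⟩
  · intro x; simp only [Finset.mem_insert, Finset.mem_singleton]
    rintro (rfl | rfl) <;> simp

/-- The sum of `K` over the ends of the chains `a - x₁, y₁ - x₂, …` of matched pairs, where the
`(xᵢ, yᵢ)` are `m` disjoint transits of `U`. -/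
noncomputable def chainSum (vert : H → V) (M : Finset (Sym2 H)) (K : H → Finset H → ℝ) :
    ℕ → H → Finset H → ℝ
  | 0, a, U => K a U
  | m + 1, a, U => ∑ t ∈ transits vert U with s(a, t.1) ∈ M,
      chainSum vert M K m t.2 (U \ {t.1, t.2})

theorem chainSum_nonneg {vert : H → V} {M : Finset (Sym2 H)} {K : H → Finset H → ℝ}
    (hK : ∀ a U, 0 ≤ K a U) (m : ℕ) (a : H) (U : Finset H) : 0 ≤ chainSum vert M K m a U := by
  induction m generalizing a U with
  | zero => exact hK a U
  | succ m ih => exact Finset.sum_nonneg fun t _ => ih _ _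

/-- `K M a U` depends only on the pairs of `M` inside `{a} ∪ U ∪ R`. -/
def IsLocal (R : Finset H) (K : Finset (Sym2 H) → H → Finset H → ℝ) : Prop :=
  ∀ (M : Finset (Sym2 H)) (a : H) (U : Finset H) (x y : H), x ∉ insert a (U ∪ R) →
    y ∉ insert a (U ∪ R) → K (insert s(x, y) M) a U = K M a U

theorem IsLocal.chainSum {vert : H → V} {R : Finset H} {K : Finset (Sym2 H) → H → Finset H → ℝ}
    (hK : IsLocal R K) (m : ℕ) : IsLocal R fun M a U => chainSum vert M (K M) m a U := by
  induction m with
  | zero => exact hK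
  | succ m ih =>
    intro M a U x y hx hy
    simp only [_root_.chainSum]
    refine Finset.sum_congr ?_ ?_
    · refine Finset.filter_congr fun t _ => ?_
      rw [Finset.mem_insert, or_iff_right]
      intro h
      have : a ∈ s(x, y) := h ▸ Sym2.mem_mk_left _ _
      rw [Sym2.mem_iff] at this
      rcases this with rfl | rfl
      · simp at hx
      · simp at hy
    · intro t ht
      have ht := mem_transits.1 (Finset.mem_filter.1 ht).1
      have hsub : insert t.2 (U \ {t.1, t.2} ∪ R) ⊆ insert a (U ∪ R) := by
        intro z
        simp only [Finset.mem_insert, Finset.mem_union, Finset.mem_sdiff]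
        rintro (rfl | h | h)
        · exact Or.inr (Or.inl ht.2.1)
        · exact Or.inr (Or.inl h.1)
        · exact Or.inr (Or.inr h)
      exact ih M _ _ x y (fun h => hx (hsub h)) (fun h => hy (hsub h))

/-- Exposing the partner of `a` leaves a matching problem of the same shape with `U` smaller by one
transit. There are at most `q (|U| - 1)` transits, and `matchingCount (|U| + ρ)` exceeds
`matchingCount (|U| - 2 + ρ)` by the factor `|U| + ρ - 1`, so each link costs at most `q`. The
parameter `ρ` records how many half-edges besides `U` are still counted by the bound at the end of
the chain. -/
theorem sum_chainSum_le {vert : H → V} {q c : ℝ} (q0 : 0 ≤ q) (q1 : q ≤ 1) (hc : 0 ≤ c)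
    {R : Finset H} (ρ : ℕ) {K : Finset (Sym2 H) → H → Finset H → ℝ} (hK : IsLocal R K)
    (hb : ∀ a U, a ∉ U → a ∉ R → Disjoint U R → Subcritical vert q U →
      ∑ M ∈ perfectMatchings (insert a (U ∪ R)), K M a U ≤ c * matchingCount (U.card + ρ))
    (m : ℕ) (a : H) (U : Finset H) (haU : a ∉ U) (haR : a ∉ R) (hUR : Disjoint U R)
    (hU : Subcritical vert q U) :
    ∑ M ∈ perfectMatchings (insert a (U ∪ R)), chainSum vert M (K M) m a U ≤
      c * q ^ m * matchingCount (U.card + ρ) := by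
  induction m generalizing a U with
  | zero => simpa [chainSum] using hb a U haU haR hUR hU
  | succ m ih =>
    simp only [chainSum]
    have h1 : ∀ t ∈ transits vert U,
        ∑ M ∈ perfectMatchings (insert a (U ∪ R)) with s(a, t.1) ∈ M,
          chainSum vert M (K M) m t.2 (U \ {t.1, t.2}) ≤
        c * q ^ m * matchingCount (U.card - 2 + ρ) := by
      intro t ht
      have ht' := mem_transits.1 ht
      have hat : a ≠ t.1 := fun h => haU (h ▸ ht'.1)
      have hat2 : a ≠ t.2 := fun h => haU (h ▸ ht'.2.1)
      have h1R : t.1 ∉ R := Finset.disjoint_left.1 hUR ht'.1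
      have h2R : t.2 ∉ R := Finset.disjoint_left.1 hUR ht'.2.1
      rw [sum_perfectMatchings_mem (by simp) (by simp [ht'.1]) hat]
      have hset : insert a (U ∪ R) \ {a, t.1} = insert t.2 (U \ {t.1, t.2} ∪ R) := by
        ext x
        simp only [Finset.mem_sdiff, Finset.mem_insert, Finset.mem_union, Finset.mem_singleton]
        by_cases hx2 : x = t.2
        · subst hx2
          simp [ht'.2.1, hat2.symm, ht'.2.2.1.symm]
        · by_cases hx1 : x = t.1
          · subst hx1
            simp [h1R, ht'.2.2.1]
          · by_cases hxa : x = a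
            · subst hxa
              simp [haU, haR, hat2]
            · simp [hx1, hx2, hxa]
      rw [hset]
      have hcard : (U \ {t.1, t.2}).card = U.card - 2 := by
        rw [Finset.card_sdiff_of_subset, Finset.card_pair ht'.2.2.1]
        intro x; simp only [Finset.mem_insert, Finset.mem_singleton]
        rintro (rfl | rfl)
        · exact ht'.1
        · exact ht'.2.1
      rw [← hcard]
      refine le_trans (le_of_eq (Finset.sum_congr rfl fun M _ => ?_))
        (ih t.2 (U \ {t.1, t.2}) (by simp) h2R (hUR.mono_left Finset.sdiff_subset)
          (hU.sdiff_transit q0 q1 ht))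
      -- The rest of the chain cannot see the exposed pair `a, t.1`, so reinserting it changes
      -- nothing.
      refine hK.chainSum m M _ _ a t.1 ?_ ?_
      · simp [hat2, haU, haR]
      · simp [ht'.2.2.1, h1R]
    simp only [Finset.sum_filter]
    rw [Finset.sum_comm]
    simp only [← Finset.sum_filter]
    refine (Finset.sum_le_sum h1).trans ?_
    rw [Finset.sum_const, nsmul_eq_mul]
    rcases Nat.lt_or_ge U.card 2 with h2 | h2
    · have : (transits vert U).card = 0 := by
        rw [Finset.card_eq_zero, Finset.eq_empty_iff_forall_notMem]
        intro t ht
        have ht' := mem_transits.1 ht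
        exact absurd h2 (by
          have := Finset.one_lt_card.2 ⟨t.1, ht'.1, t.2, ht'.2.1, ht'.2.2.1⟩
          omega)
      rw [this]
      simp only [Nat.cast_zero, zero_mul]
      positivity
    · have h3 : matchingCount (U.card + ρ) =
          (U.card + ρ - 1) * matchingCount (U.card - 2 + ρ) := by
        rw [matchingCount_of_two_le (by omega), show U.card + ρ - 2 = U.card - 2 + ρ by omega]
      have h4 : ((U.card - 1 : ℕ) : ℝ) ≤ ((U.card + ρ - 1 : ℕ) : ℝ) := by
        exact_mod_cast (by omega)
      rw [h3]
      push_cast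
      have h5 : ((transits vert U).card : ℝ) ≤ q * ((U.card + ρ - 1 : ℕ) : ℝ) :=
        hU.trans (mul_le_mul_of_nonneg_left h4 q0)
      calc ((transits vert U).card : ℝ) * (c * q ^ m * (matchingCount (U.card - 2 + ρ) : ℝ))
          ≤ (q * ((U.card + ρ - 1 : ℕ) : ℝ)) * (c * q ^ m * (matchingCount (U.card - 2 + ρ) : ℝ)) :=
            mul_le_mul_of_nonneg_right h5 (by positivity)
        _ = _ := by ring

end Chains

/-! ### Expected numbers of cycles, tuples of cycles and lollipops -/

section ChainExpectations

variable {H V : Type} [Fintype H] [DecidableEq H] [DecidableEq V]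

theorem chainSum_finset_sum {ι : Type*} (s : Finset ι) {vert : H → V} {M : Finset (Sym2 H)}
    (K : ι → H → Finset H → ℝ) (m : ℕ) (a : H) (U : Finset H) :
    ∑ i ∈ s, chainSum vert M (K i) m a U =
      chainSum vert M (fun a U => ∑ i ∈ s, K i a U) m a U := by
  induction m generalizing a U with
  | zero => rfl
  | succ m ih =>
    simp only [chainSum]
    rw [Finset.sum_comm]
    exact Finset.sum_congr rfl fun t _ => ih _ _

theorem Subcritical.card_mul_le {vert : H → V} {q : ℝ} {U : Finset H} (h : Subcritical vert q U)
    (hq : 0 ≤ q) :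
    ((transits vert U).card : ℝ) * matchingCount (U.card - 2) ≤ q * matchingCount U.card := by
  rcases Nat.lt_or_ge U.card 2 with h2 | h2
  · have h3 : ((transits vert U).card : ℝ) ≤ 0 := by
      have : U.card - 1 = 0 := by omega
      simpa [Subcritical, this] using h
    have : ((transits vert U).card : ℝ) * matchingCount (U.card - 2) ≤ 0 :=
      mul_nonpos_of_nonpos_of_nonneg h3 (by positivity)
    refine this.trans ?_
    positivity
  · rw [matchingCount_of_two_le h2]
    push_cast
    rw [← mul_assoc]
    exact mul_le_mul_of_nonneg_right h (by positivity)

theorem card_sdiff_transit {vert : H → V} {U : Finset H} {t : H × H} (ht : t ∈ transits vert U) :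
    (U \ {t.1, t.2}).card = U.card - 2 := by
  have ht' := mem_transits.1 ht
  rw [Finset.card_sdiff_of_subset, Finset.card_pair ht'.2.2.1]
  intro x; simp only [Finset.mem_insert, Finset.mem_singleton]
  rintro (rfl | rfl)
  · exact ht'.1
  · exact ht'.2.1

/-- The end of a chain at `b`, continued by `J`. -/
noncomputable def closeAt (b : H) (J : Finset (Sym2 H) → Finset H → ℝ) (M : Finset (Sym2 H))
    (a : H) (U : Finset H) : ℝ :=
  if s(a, b) ∈ M then J M U else 0

theorem closeAt_nonneg {b : H} {J : Finset (Sym2 H) → Finset H → ℝ} {M : Finset (Sym2 H)}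
    (hJ : ∀ U, 0 ≤ J M U) (a : H) (U : Finset H) : 0 ≤ closeAt b J M a U := by
  unfold closeAt
  split_ifs
  · exact hJ U
  · exact le_rfl

/-- `J M U` depends only on the pairs of `M` inside `U ∪ R`. -/
def IsLocalOn (R : Finset H) (J : Finset (Sym2 H) → Finset H → ℝ) : Prop :=
  ∀ (M : Finset (Sym2 H)) (U : Finset H) (x y : H), x ∉ U ∪ R →
    y ∉ U ∪ R → J (insert s(x, y) M) U = J M U

theorem IsLocalOn.closeAt {R : Finset H} {J : Finset (Sym2 H) → Finset H → ℝ}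
    (hJ : IsLocalOn R J) (b : H) : IsLocal (insert b R) (closeAt b J) := by
  intro M a U x y hx hy
  simp only [Finset.mem_insert, Finset.mem_union, not_or] at hx hy
  have h1 : s(a, b) ∈ insert s(x, y) M ↔ s(a, b) ∈ M := by
    rw [Finset.mem_insert, or_iff_right]
    intro h
    have : a ∈ s(x, y) := h ▸ Sym2.mem_mk_left _ _
    rw [Sym2.mem_iff] at this
    rcases this with rfl | rfl
    · exact hx.1 rfl
    · exact hy.1 rfl
  simp only [_root_.closeAt, h1]
  rw [hJ M U x y (by simp [hx]) (by simp [hy])]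

/-- The closing pair uses up both the current end and `b`, so what remains to be matched is `U ∪ R`.
The bound therefore counts matchings with two points fewer than the ambient set; for a cycle this
compensates for the sum over its root. -/
theorem sum_chainSum_closeAt_le {vert : H → V} {q c : ℝ} (q0 : 0 ≤ q) (q1 : q ≤ 1) (hc : 0 ≤ c)
    {R : Finset H} (ρ : ℕ) {J : Finset (Sym2 H) → Finset H → ℝ} (hJ : IsLocalOn R J)
    (hb : ∀ U, Disjoint U R → Subcritical vert q U →
      ∑ M ∈ perfectMatchings (U ∪ R), J M U ≤ c * matchingCount (U.card + ρ))
    (m : ℕ) (a b : H) (U : Finset H) (haU : a ∉ U) (haR : a ∉ R) (hUR : Disjoint U R)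
    (hbU : b ∉ U) (hbR : b ∉ R) (hab : a ≠ b) (hU : Subcritical vert q U) :
    ∑ M ∈ perfectMatchings (insert a (insert b (U ∪ R))), chainSum vert M (closeAt b J M) m a U ≤
      c * q ^ m * matchingCount (U.card + ρ) := by
  rw [show insert b (U ∪ R) = U ∪ insert b R by simp]
  refine sum_chainSum_le q0 q1 hc ρ (hJ.closeAt b) ?_ m a U haU (by simp [haR, hab])
    (by simp [hbU, hUR]) hU
  intro a U haU haR hUR hU
  simp only [Finset.mem_insert, not_or] at haR
  have hbU : b ∉ U := fun h => Finset.disjoint_left.1 hUR h (by simp)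
  have hUR' : Disjoint U R := hUR.mono_right (Finset.subset_insert _ _)
  simp only [closeAt]
  rw [← Finset.sum_filter, sum_perfectMatchings_mem (by simp) (by simp) haR.1]
  have hset : insert a (U ∪ insert b R) \ {a, b} = U ∪ R := by
    ext x
    simp only [Finset.mem_sdiff, Finset.mem_insert, Finset.mem_union, Finset.mem_singleton]
    by_cases hxa : x = a
    · subst hxa; simp [haU, haR.2]
    · by_cases hxb : x = b
      · subst hxb; simp [hbU, hbR]
      · simp [hxa, hxb]
  rw [hset]
  refine le_trans (le_of_eq (Finset.sum_congr rfl fun M _ => ?_)) (hb U hUR' hU)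
  exact hJ M U a b (by simp [haU, haR.2]) (by simp [hbU, hbR])

/-- The sum of `J` over the closed chains with `m + 1` transits that start with the
transit `t`. -/
noncomputable def cycleSum (vert : H → V) (J : Finset (Sym2 H) → Finset H → ℝ)
    (M : Finset (Sym2 H)) (m : ℕ) (t : H × H) (U : Finset H) : ℝ :=
  chainSum vert M (closeAt t.1 J M) m t.2 (U \ {t.1, t.2})

theorem cycleSum_nonneg {vert : H → V} {J : Finset (Sym2 H) → Finset H → ℝ}
    {M : Finset (Sym2 H)} (hJ : ∀ U, 0 ≤ J M U) (m : ℕ) (t : H × H) (U : Finset H) :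
    0 ≤ cycleSum vert J M m t U :=
  chainSum_nonneg (fun _ _ => closeAt_nonneg hJ _ _) _ _ _

theorem sum_cycleSum_le {vert : H → V} {q c : ℝ} (q0 : 0 ≤ q) (q1 : q ≤ 1) (hc : 0 ≤ c)
    {J : Finset (Sym2 H) → Finset H → ℝ} (hJ : IsLocalOn ∅ J)
    (hb : ∀ U, Subcritical vert q U →
      ∑ M ∈ perfectMatchings U, J M U ≤ c * matchingCount U.card)
    (m : ℕ) {U : Finset H} (hU : Subcritical vert q U) {t : H × H} (ht : t ∈ transits vert U) :
    ∑ M ∈ perfectMatchings U, cycleSum vert J M m t U ≤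
      c * q ^ m * matchingCount (U.card - 2) := by
  have ht' := mem_transits.1 ht
  have := sum_chainSum_closeAt_le q0 q1 hc 0 hJ (by simpa using hb) m t.2 t.1 (U \ {t.1, t.2})
    (by simp) (by simp) (by simp) (by simp) (by simp) ht'.2.2.1.symm (hU.sdiff_transit q0 q1 ht)
  rw [card_sdiff_transit ht, add_zero] at this
  have hset : insert t.2 (insert t.1 (U \ {t.1, t.2} ∪ ∅)) = U := by
    ext x
    simp only [Finset.mem_sdiff, Finset.mem_insert, Finset.union_empty, Finset.mem_singleton]
    by_cases h1 : x = t.1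
    · subst h1; simp [ht'.1]
    · by_cases h2 : x = t.2
      · subst h2; simp [ht'.2.1]
      · simp [h1, h2]
  rwa [hset] at this

theorem geom_sum_le_inv {q : ℝ} (q0 : 0 ≤ q) (q1 : q < 1) (B : ℕ) :
    ∑ m ∈ Finset.range B, q ^ m ≤ (1 - q)⁻¹ := by
  rw [← tsum_geometric_of_lt_one q0 q1]
  exact (summable_geometric_of_lt_one q0 q1).sum_le_tsum _ fun _ _ => by positivity

theorem IsLocalOn.cycleSum {vert : H → V} {J : Finset (Sym2 H) → Finset H → ℝ}
    (hJ : IsLocalOn ∅ J) {U : Finset H} {t : H × H} (ht : t ∈ transits vert U) (m : ℕ)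
    (M : Finset (Sym2 H)) {x y : H} (hx : x ∉ U) (hy : y ∉ U) :
    cycleSum vert J (insert s(x, y) M) m t U = cycleSum vert J M m t U := by
  have ht' := mem_transits.1 ht
  have hsub : insert t.2 (U \ {t.1, t.2} ∪ insert t.1 ∅) ⊆ U := by
    intro z
    simp only [Finset.mem_insert, Finset.mem_union, Finset.mem_sdiff, Finset.notMem_empty]
    rintro (rfl | h | rfl | h)
    · exact ht'.2.1
    · exact h.1
    · exact ht'.1
    · exact h.elim
  exact (hJ.closeAt t.1).chainSum m M t.2 _ x y (fun h => hx (hsub h)) fun h => hy (hsub h)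

/-- The number of `r`-tuples of disjoint rooted cycles of length at most `B` inside `U`. -/
noncomputable def cycleTuples (vert : H → V) (B : ℕ) :
    ℕ → Finset (Sym2 H) → Finset H → ℝ
  | 0, _, _ => 1
  | r + 1, M, U => ∑ m ∈ Finset.range B, ∑ t ∈ transits vert U,
      cycleSum vert (cycleTuples vert B r) M m t U

theorem cycleTuples_nonneg {vert : H → V} (B r : ℕ) (M : Finset (Sym2 H)) (U : Finset H) :
    0 ≤ cycleTuples vert B r M U := by
  induction r generalizing U with
  | zero => exact zero_le_one
  | succ r ih =>
    exact Finset.sum_nonneg fun m _ => Finset.sum_nonneg fun t _ => cycleSum_nonneg ih m t U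

theorem isLocalOn_cycleTuples {vert : H → V} (B r : ℕ) :
    IsLocalOn ∅ (cycleTuples vert B r) := by
  induction r with
  | zero => exact fun _ _ _ _ _ _ => rfl
  | succ r ih =>
    intro M U x y hx hy
    simp only [cycleTuples]
    refine Finset.sum_congr rfl fun m _ => Finset.sum_congr rfl fun t ht => ?_
    exact ih.cycleSum ht m M (by simpa using hx) (by simpa using hy)

theorem sum_cycleSum_transits_le {vert : H → V} {q c : ℝ} (q0 : 0 ≤ q) (q1 : q < 1) (hc : 0 ≤ c)
    {J : Finset (Sym2 H) → Finset H → ℝ} (hJ : IsLocalOn ∅ J)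
    (hb : ∀ U, Subcritical vert q U →
      ∑ M ∈ perfectMatchings U, J M U ≤ c * matchingCount U.card)
    {U : Finset H} (hU : Subcritical vert q U) (B : ℕ) (T : Finset (H × H))
    (hT : T ⊆ transits vert U) :
    ∑ M ∈ perfectMatchings U, ∑ m ∈ Finset.range B, ∑ t ∈ T, cycleSum vert J M m t U ≤
      c * (1 - q)⁻¹ * (T.card * matchingCount (U.card - 2)) := by
  rw [Finset.sum_comm]
  have h1 : ∀ m ∈ Finset.range B, ∑ M ∈ perfectMatchings U, ∑ t ∈ T, cycleSum vert J M m t U ≤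
      q ^ m * (c * (T.card * matchingCount (U.card - 2))) := by
    intro m _
    rw [Finset.sum_comm]
    refine (Finset.sum_le_sum fun t ht => sum_cycleSum_le q0 q1.le hc hJ hb m hU (hT ht)).trans ?_
    rw [Finset.sum_const, nsmul_eq_mul]
    apply le_of_eq
    ring
  refine (Finset.sum_le_sum h1).trans ?_
  rw [← Finset.sum_mul]
  refine (mul_le_mul_of_nonneg_right (geom_sum_le_inv q0 q1 B) (by positivity)).trans ?_
  apply le_of_eq
  ring

/-- Induction on `r`: the first cycle is continued by the count of the other `r` on the half-edges
left over, which are again subcritical. The sum over lengths gives `(1 - q)⁻¹`, and the sum over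
roots costs a factor at most `q`. -/
theorem sum_cycleTuples_le {vert : H → V} {q : ℝ} (q0 : 0 ≤ q) (q1 : q < 1) (B r : ℕ)
    {U : Finset H} (hU : Subcritical vert q U) :
    ∑ M ∈ perfectMatchings U, cycleTuples vert B r M U ≤
      (1 - q)⁻¹ ^ r * matchingCount U.card := by
  have hq : 0 ≤ (1 - q)⁻¹ := inv_nonneg.2 (by linarith)
  induction r generalizing U with
  | zero => simp [cycleTuples, card_perfectMatchings]
  | succ r ih =>
    simp only [cycleTuples]
    refine (sum_cycleSum_transits_le q0 q1 (c := (1 - q)⁻¹ ^ r) (by positivity)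
      (isLocalOn_cycleTuples B r) (fun U hU => ih hU) hU B _ subset_rfl).trans ?_
    rw [pow_succ]
    refine mul_le_mul_of_nonneg_left ?_ (by positivity)
    refine (hU.card_mul_le q0).trans ?_
    exact mul_le_of_le_one_left (by positivity) q1.le

/-- The number of half-edges in `U` at the vertex `v` that are matched to `a`. -/
noncomputable def endsAt (vert : H → V) (v : V) (M : Finset (Sym2 H)) (a : H) (U : Finset H) : ℝ :=
  ∑ b ∈ U with s(a, b) ∈ M, if vert b = v then 1 else 0

theorem endsAt_nonneg {vert : H → V} (v : V) (M : Finset (Sym2 H)) (a : H) (U : Finset H) :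
    0 ≤ endsAt vert v M a U :=
  Finset.sum_nonneg fun _ _ => by split_ifs <;> norm_num

theorem isLocal_endsAt {vert : H → V} (v : V) : IsLocal ∅ (endsAt vert v) := by
  intro M a U x y hx hy
  refine Finset.sum_congr (Finset.filter_congr fun b _ => ?_) fun _ _ => rfl
  rw [Finset.mem_insert, or_iff_right]
  intro h
  have : a ∈ s(x, y) := h ▸ Sym2.mem_mk_left _ _
  rw [Sym2.mem_iff] at this
  rcases this with rfl | rfl
  · simp at hx
  · simp at hy

theorem sum_endsAt [Fintype V] {vert : H → V} {M : Finset (Sym2 H)} {a : H} {U : Finset H}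
    (haU : a ∉ U) (hM : M ∈ perfectMatchings (insert a U)) :
    ∑ v, endsAt vert v M a U = 1 := by
  simp only [endsAt]
  rw [Finset.sum_comm]
  have := sum_partner_eq_one hM (Finset.mem_insert_self a U) (1 : ℝ)
  rw [Finset.erase_insert haU] at this
  refine Eq.trans (Finset.sum_congr rfl fun b _ => ?_) this
  simp

/-- The number of tails with `m` transits from `x` to `v`. -/
noncomputable def tailSum (vert : H → V) (v : V) (m : ℕ) (x : H) (M : Finset (Sym2 H))
    (U : Finset H) : ℝ :=
  chainSum vert M (endsAt vert v M) m x U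

theorem tailSum_nonneg {vert : H → V} (v : V) (m : ℕ) (x : H) (M : Finset (Sym2 H))
    (U : Finset H) : 0 ≤ tailSum vert v m x M U :=
  chainSum_nonneg (fun _ _ => endsAt_nonneg _ _ _ _) _ _ _

/-- The number of pairs of a cycle with `l + 1` transits, one of them `t`, and a disjoint tail
with `m` transits from `x` to `v`. -/
noncomputable def lollipopSum (vert : H → V) (v : V) (l m : ℕ) (t : H × H) (x : H)
    (M : Finset (Sym2 H)) : ℝ :=
  chainSum vert M (closeAt t.1 (tailSum vert v m x) M) l t.2 (Finset.univ \ {t.1, t.2, x})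

theorem lollipopSum_nonneg {vert : H → V} (v : V) (l m : ℕ) (t : H × H) (x : H)
    (M : Finset (Sym2 H)) : 0 ≤ lollipopSum vert v l m t x M :=
  chainSum_nonneg (fun _ _ => closeAt_nonneg (fun _ => tailSum_nonneg _ _ _ _ _) _ _) _ _ _

theorem isLocalOn_sum_tailSum [Fintype V] {vert : H → V} (m : ℕ) (x : H) :
    IsLocalOn {x} fun M U => ∑ v, tailSum vert v m x M U := by
  intro M U y z hy hz
  refine Finset.sum_congr rfl fun v _ => ?_
  have hsub : insert x (U ∪ ∅) ⊆ U ∪ {x} := by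
    intro w; simp only [Finset.mem_insert, Finset.mem_union, Finset.mem_singleton]; tauto
  exact (isLocal_endsAt v).chainSum m M x U y z (fun h => hy (hsub h)) fun h => hz (hsub h)

/-- Summed over all `v`, the end of a tail is free: every half-edge has exactly one partner. Hence
`c = 1`, and `ρ = 1` since the end of the chain itself remains to be matched. -/
theorem sum_tailSum_le [Fintype V] {vert : H → V} {q : ℝ} (q0 : 0 ≤ q) (q1 : q ≤ 1) (m : ℕ)
    {x : H} {U : Finset H} (hxU : x ∉ U) (hU : Subcritical vert q U) :
    ∑ M ∈ perfectMatchings (U ∪ {x}), ∑ v, tailSum vert v m x M U ≤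
      q ^ m * matchingCount (U.card + 1) := by
  simp only [tailSum, chainSum_finset_sum]
  have hloc : IsLocal ∅ fun M a U => ∑ v, endsAt vert v M a U := fun M a U y z hy hz =>
    Finset.sum_congr rfl fun v _ => isLocal_endsAt v M a U y z hy hz
  have := sum_chainSum_le q0 q1 zero_le_one 1 hloc ?_ m x U hxU (by simp) (by simp) hU
  · simpa [Finset.union_comm] using this
  · intro a U haU _ _ _
    rw [Finset.union_empty, one_mul, ← Finset.card_insert_of_notMem haU, ← card_perfectMatchings,
      Finset.card_eq_sum_ones, Nat.cast_sum]
    refine Finset.sum_le_sum fun M hM => ?_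
    simp [sum_endsAt haU hM]

/-- The tail plays the role of `J` in the bound for closed chains, so the geometric factors of cycle
and tail multiply. The half-edge `x` is reserved from the start, so that the cycle avoids it. -/
theorem sum_lollipopSum_le [Fintype V] {vert : H → V} {q : ℝ} (q0 : 0 ≤ q) (q1 : q ≤ 1)
    (hq : Subcritical vert q Finset.univ) (l m : ℕ) {t : H × H}
    (ht : t ∈ transits vert Finset.univ) {x : H} (hx : vert x = vert t.1) (hx1 : x ≠ t.1)
    (hx2 : x ≠ t.2) :
    ∑ M ∈ perfectMatchings (Finset.univ : Finset H), ∑ v, lollipopSum vert v l m t x M ≤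
      q ^ l * q ^ m * matchingCount (Fintype.card H - 2) := by
  have ht' := mem_transits.1 ht
  have h1 : ∀ M a U, ∑ v, closeAt t.1 (tailSum vert v m x) M a U =
      closeAt t.1 (fun M U => ∑ v, tailSum vert v m x M U) M a U := by
    intro M a U
    simp only [closeAt]
    split_ifs <;> simp
  simp only [lollipopSum, chainSum_finset_sum, h1]
  set U : Finset H := Finset.univ \ {t.1, t.2, x} with hUdef
  have h3 : ({t.1, t.2, x} : Finset H).card = 3 :=
    Finset.card_eq_three.2 ⟨_, _, _, ht'.2.2.1, hx1.symm, hx2.symm, rfl⟩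
  have hU3 : U.card = Fintype.card H - 3 := by
    rw [hUdef, Finset.card_sdiff_of_subset (Finset.subset_univ _), h3, Finset.card_univ]
  have h3le : 3 ≤ Fintype.card H := by
    rw [← h3]; exact Finset.card_le_univ _
  have hU : Subcritical vert q U := by
    -- Three half-edges at one vertex are removed, and three transits with different first entries
    -- vanish with them.
    refine hq.of_sdiff q0 q1 (Finset.subset_univ _) (R := {(t.1, t.2), (t.2, t.1), (x, t.1)}) ?_ ?_ ?_
    · rw [h3]
      refine (Finset.card_eq_three.2 ⟨_, _, _, ?_, ?_, ?_, rfl⟩).ge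
      · intro h; exact ht'.2.2.1 (congrArg Prod.fst h)
      · intro h; exact hx1.symm (congrArg Prod.fst h)
      · intro h; exact hx2.symm (congrArg Prod.fst h)
    · intro y
      simp only [Finset.mem_insert, Finset.mem_singleton]
      rintro (rfl | rfl | rfl)
      · exact ht
      · exact mem_transits.2 ⟨by simp, by simp, ht'.2.2.1.symm, ht'.2.2.2.symm⟩
      · exact mem_transits.2 ⟨by simp, by simp, hx1, hx⟩
    · intro y
      simp only [Finset.mem_insert, Finset.mem_singleton]
      rintro (rfl | rfl | rfl) <;> simp
  have := sum_chainSum_closeAt_le q0 q1 (c := q ^ m) (by positivity) 1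
    (isLocalOn_sum_tailSum (vert := vert) m x) (fun W hW hWs => sum_tailSum_le q0 q1 m (by simpa using hW) hWs)
    l t.2 t.1 U (by simp [hUdef]) (by simpa using hx2.symm) (by simp [hUdef]) (by simp [hUdef])
    (by simpa using hx1.symm) ht'.2.2.1.symm hU
  have hset : insert t.2 (insert t.1 (U ∪ {x})) = Finset.univ := by
    ext y
    simp only [hUdef, Finset.mem_sdiff, Finset.mem_insert, Finset.mem_singleton, Finset.mem_union,
      Finset.mem_univ, iff_true, true_and]
    tauto
  rw [hset, hU3, show Fintype.card H - 3 + 1 = Fintype.card H - 2 by omega] at this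
  refine this.trans (le_of_eq ?_)
  ring

end ChainExpectations

/-! ### Unions of components as closed induced pieces -/

namespace Multigraph

variable {V W : Type}

/-- The multigraph on `W` obtained by restricting `G` along `φ`. -/
def pullback (G : Multigraph V) (φ : W → V) : Multigraph W where
  mult e := G.mult (e.map φ)

/-- No edge joins a vertex in the range of `φ` to a vertex outside. -/
def ClosedRange (G : Multigraph V) (φ : W → V) : Prop :=
  ∀ i, ∀ v ∉ Set.range φ, G.mult s(φ i, v) = 0

theorem induce_eq_pullback (G : Multigraph V) (S : Set V) :
    G.induce S = G.pullback (Subtype.val : S → V) := rfl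

theorem underlying_adj (G : Multigraph V) {u v : V} :
    G.underlying.Adj u v ↔ G.mult s(u, v) ≠ 0 ∧ u ≠ v := by
  simp [underlying]

theorem isomorphic_iff_pullback {G : Multigraph V} {H : Multigraph W} :
    G.Isomorphic H ↔ ∃ φ : V ≃ W, G = H.pullback φ := by
  refine exists_congr fun φ => ⟨fun h => ?_, fun h e => ?_⟩
  · ext e; exact (h e).symm
  · rw [h]; rfl

theorem closedRange_of_surjective (G : Multigraph V) {φ : W → V} (h : Function.Surjective φ) :
    G.ClosedRange φ := fun _ v hv => absurd (h v) hv

theorem pullback_adj {G : Multigraph V} {φ : W → V} (hφ : Function.Injective φ) {i j : W} :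
    (G.pullback φ).underlying.Adj i j ↔ G.underlying.Adj (φ i) (φ j) := by
  rw [underlying_adj, underlying_adj, hφ.ne_iff]
  rfl

theorem ClosedRange.mem_of_reachable {G : Multigraph V} {φ : W → V} (hc : G.ClosedRange φ)
    {u v : V} (h : G.underlying.Reachable u v) (hu : u ∈ Set.range φ) : v ∈ Set.range φ := by
  obtain ⟨p⟩ := h
  induction p with
  | nil => exact hu
  | cons hadj _ ih =>
    refine ih ?_
    obtain ⟨i, rfl⟩ := hu
    by_contra hv
    exact (G.underlying_adj.1 hadj).1 (hc i _ hv)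

theorem ClosedRange.reachable_iff {G : Multigraph V} {φ : W → V} (hc : G.ClosedRange φ)
    (hφ : Function.Injective φ) {i j : W} :
    (G.pullback φ).underlying.Reachable i j ↔ G.underlying.Reachable (φ i) (φ j) := by
  constructor
  · rintro ⟨p⟩
    induction p with
    | nil => rfl
    | cons h _ ih => exact ((pullback_adj hφ).1 h).reachable.trans ih
  · rintro ⟨p⟩
    suffices ∀ u v (_ : G.underlying.Walk u v), ∀ i j, φ i = u → φ j = v →
        (G.pullback φ).underlying.Reachable i j from this _ _ p i j rfl rfl
    intro u v p
    induction p with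
    | nil =>
      rintro i j rfl h
      rw [hφ h]
    | @cons u w v hadj _ ih =>
      rintro i j rfl hj
      obtain ⟨k, rfl⟩ : w ∈ Set.range φ := by
        by_contra hv
        exact (G.underlying_adj.1 hadj).1 (hc i _ hv)
      exact ((pullback_adj hφ).2 hadj).reachable.trans (ih k j rfl hj)

/-- The component of `G` containing the image of a component of a restriction of `G`. -/
def componentMap {G : Multigraph V} {φ : W → V} (hφ : Function.Injective φ)
    (hc : G.ClosedRange φ) :
    (G.pullback φ).underlying.ConnectedComponent → G.underlying.ConnectedComponent :=
  Quot.map φ fun _ _ h => (hc.reachable_iff hφ).1 h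

theorem componentMap_mk {G : Multigraph V} {φ : W → V} (hφ : Function.Injective φ)
    (hc : G.ClosedRange φ) (i : W) :
    componentMap hφ hc ((G.pullback φ).underlying.connectedComponentMk i) =
      G.underlying.connectedComponentMk (φ i) := rfl

theorem componentMap_injective {G : Multigraph V} {φ : W → V} (hφ : Function.Injective φ)
    (hc : G.ClosedRange φ) : Function.Injective (componentMap hφ hc) := by
  intro C C' h
  induction C using SimpleGraph.ConnectedComponent.ind with | _ i
  induction C' using SimpleGraph.ConnectedComponent.ind with | _ j
  rw [componentMap_mk, componentMap_mk, SimpleGraph.ConnectedComponent.eq] at h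
  exact SimpleGraph.ConnectedComponent.eq.2 ((hc.reachable_iff hφ).2 h)

/-- The vertices of a set of components. -/
def verts (G : Multigraph V) (T : Finset G.underlying.ConnectedComponent) : Set V :=
  {v | G.underlying.connectedComponentMk v ∈ T}

theorem closedRange_val {G : Multigraph V} {S : Set V}
    (h : ∀ u ∈ S, ∀ v, G.underlying.Reachable u v → v ∈ S) :
    G.ClosedRange (Subtype.val : S → V) := by
  rintro ⟨u, hu⟩ v hv
  by_contra hm
  rw [Subtype.range_coe] at hv
  refine hv (h u hu v ?_)
  have : u ≠ v := by rintro rfl; exact hv hu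
  exact (G.underlying_adj.2 ⟨hm, this⟩).reachable

theorem closedRange_verts (G : Multigraph V) (T : Finset G.underlying.ConnectedComponent) :
    G.ClosedRange (Subtype.val : G.verts T → V) := by
  refine closedRange_val fun u hu v h => ?_
  have : G.underlying.connectedComponentMk v = G.underlying.connectedComponentMk u :=
    SimpleGraph.ConnectedComponent.eq.2 h.symm
  simpa [verts, this] using hu

theorem isomorphic_of_equiv_induce {G : Multigraph V} {φ : W → V} (hφ : Function.Injective φ)
    {S : Set W} {S' : Set V} (h : S' = φ '' S) :
    ((G.pullback φ).induce S).Isomorphic (G.induce S') := by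
  subst h
  refine ⟨Equiv.Set.image φ S hφ, fun e => ?_⟩
  simp only [induce, pullback, Sym2.map_map]
  rfl

theorem verts_image_componentMap [DecidableEq V] {G : Multigraph V} {φ : W → V}
    (hφ : Function.Injective φ) (hc : G.ClosedRange φ) [DecidableEq G.underlying.ConnectedComponent]
    (T : Finset (G.pullback φ).underlying.ConnectedComponent) :
    G.verts (T.image (componentMap hφ hc)) = φ '' (G.pullback φ).verts T := by
  ext v
  simp only [verts, Finset.mem_image, Set.mem_ofPred_eq, Set.mem_image]
  constructor
  · rintro ⟨C, hC, h⟩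
    induction C using SimpleGraph.ConnectedComponent.ind with | _ i
    rw [componentMap_mk, SimpleGraph.ConnectedComponent.eq] at h
    obtain ⟨j, rfl⟩ := hc.mem_of_reachable h ⟨i, rfl⟩
    refine ⟨j, ?_, rfl⟩
    rw [SimpleGraph.ConnectedComponent.eq.2 ((hc.reachable_iff hφ).2 h.symm)]
    exact hC
  · rintro ⟨i, hi, rfl⟩
    exact ⟨_, hi, rfl⟩

theorem edgeCount_pullback_equiv {G : Multigraph V} (φ : W ≃ V) :
    (G.pullback φ).edgeCount = G.edgeCount := by
  unfold edgeCount
  refine finsum_eq_of_bijective (Sym2.map φ) ⟨Sym2.map.injective φ.injective, fun e => ?_⟩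
    fun _ => rfl
  exact ⟨e.map φ.symm, by rw [Sym2.map_map]; simp⟩

theorem Isomorphic.edgeCount_eq {G : Multigraph V} {H : Multigraph W} (h : G.Isomorphic H) :
    G.edgeCount = H.edgeCount := by
  obtain ⟨φ, rfl⟩ := isomorphic_iff_pullback.1 h
  exact edgeCount_pullback_equiv φ

theorem IsUnicyclic.of_isomorphic {G : Multigraph V} {H : Multigraph W} (h : G.Isomorphic H)
    (hH : H.IsUnicyclic) : G.IsUnicyclic := by
  have he := h.edgeCount_eq
  obtain ⟨φ, rfl⟩ := isomorphic_iff_pullback.1 h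
  obtain ⟨h1, h2⟩ := hH
  refine ⟨?_, ?_⟩
  · have hc := H.closedRange_of_surjective φ.surjective
    have := h1.nonempty
    have hne := φ.nonempty
    refine @SimpleGraph.Connected.mk _ _ (fun i j => ?_) hne
    exact (hc.reachable_iff φ.injective).2 (h1.preconnected _ _)
  · rw [excess, he, Nat.card_congr φ]
    exact h2

theorem Isomorphic.isUnicyclic_iff {G : Multigraph V} {H : Multigraph W} (h : G.Isomorphic H) :
    G.IsUnicyclic ↔ H.IsUnicyclic :=
  ⟨IsUnicyclic.of_isomorphic h.symm, IsUnicyclic.of_isomorphic h⟩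

theorem supp_eq_verts (G : Multigraph V) (C : G.underlying.ConnectedComponent) :
    C.supp = G.verts {C} := by
  ext v; simp [verts]

/-- A component of a closed piece is a component of the whole multigraph, with the same induced
multigraph. -/
theorem unicyclicComponent_componentMap {G : Multigraph V} {φ : W → V}
    (hφ : Function.Injective φ) (hc : G.ClosedRange φ)
    (C : (G.pullback φ).underlying.ConnectedComponent) :
    G.UnicyclicComponent (componentMap hφ hc C) ↔ (G.pullback φ).UnicyclicComponent C := by
  classical
  refine (isomorphic_of_equiv_induce hφ ?_).isUnicyclic_iff.symm
  rw [supp_eq_verts, supp_eq_verts, ← verts_image_componentMap hφ hc, Finset.image_singleton]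

theorem Isomorphic.isCopyOf_iff {G : Multigraph V} {G' : Multigraph W} (h : G.Isomorphic G')
    (H : UnlabelledFragment) : G.IsCopyOf H ↔ G'.IsCopyOf H :=
  exists_congr fun _ => and_congr_right fun _ => ⟨h.symm.trans, h.trans⟩

theorem IsCopyOf.unique {G : Multigraph V} {H H' : UnlabelledFragment} (h : G.IsCopyOf H)
    (h' : G.IsCopyOf H') : H = H' := by
  obtain ⟨F, rfl, hF⟩ := h
  obtain ⟨F', rfl, hF'⟩ := h'
  exact Quotient.sound (hF.symm.trans hF')

section Finite

variable [Fintype V] [Fintype W]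

noncomputable instance (G : Multigraph V) : Fintype G.underlying.ConnectedComponent :=
  Fintype.ofFinite _

open Classical in
/-- The unicyclic components. -/
noncomputable def unicyclicComponents (G : Multigraph V) :
    Finset G.underlying.ConnectedComponent :=
  Finset.univ.filter G.UnicyclicComponent

theorem mem_unicyclicComponents {G : Multigraph V} {C : G.underlying.ConnectedComponent} :
    C ∈ G.unicyclicComponents ↔ G.UnicyclicComponent C := by
  simp [unicyclicComponents]

theorem fragVerts_eq (G : Multigraph V) : G.fragVerts = G.verts G.unicyclicComponents := by
  ext v; simp [fragVerts, verts, mem_unicyclicComponents]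

theorem isFragment_frag (G : Multigraph V) : G.frag.IsFragment := by
  intro C
  have hc : G.ClosedRange (Subtype.val : G.fragVerts → V) := by
    rw [fragVerts_eq]; exact G.closedRange_verts _
  refine (unicyclicComponent_componentMap Subtype.val_injective hc C).1 ?_
  induction C using SimpleGraph.ConnectedComponent.ind with | _ i
  exact i.2

open Classical in
/-- The alternating sum, over the subsets of a set of components, of the indicators of being a
copy of `H`. -/
noncomputable def signedCopies (G : Multigraph V) (H : UnlabelledFragment)
    (T : Finset G.underlying.ConnectedComponent) : ℝ :=
  ∑ T' ∈ T.powerset, if (G.induce (G.verts T')).IsCopyOf H then (-1) ^ (T.card + T'.card) else 0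

theorem abs_signedCopies_le (G : Multigraph V) (H : UnlabelledFragment)
    (T : Finset G.underlying.ConnectedComponent) : |G.signedCopies H T| ≤ 2 ^ T.card := by
  classical
  refine (Finset.abs_sum_le_sum_abs _ _).trans ?_
  have : ((2 : ℝ) ^ T.card) = ∑ T' ∈ T.powerset, 1 := by
    simp
  rw [this]
  refine Finset.sum_le_sum fun T' _ => ?_
  split_ifs <;> simp

end Finite

end Multigraph

/-! ### Möbius inversion over sets of unicyclic components -/

theorem Finset.sum_powerset_neg_one_pow_of_subset {ι : Type*} [DecidableEq ι] (s t : Finset ι)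
    (h : t ⊆ s) : ∑ u ∈ s.powerset with t ⊆ u, (-1 : ℝ) ^ (u.card + t.card) =
      if t = s then 1 else 0 := by
  have h1 : ∑ u ∈ s.powerset with t ⊆ u, (-1 : ℝ) ^ (u.card + t.card) =
      ∑ u ∈ (s \ t).powerset, (-1 : ℝ) ^ u.card := by
    refine Finset.sum_bij' (fun u _ => u \ t) (fun u _ => u ∪ t) ?_ ?_ ?_ ?_ ?_
    · intro u hu
      simp only [Finset.mem_filter, Finset.mem_powerset] at hu ⊢
      exact Finset.sdiff_subset_sdiff hu.1 subset_rfl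
    · intro u hu
      simp only [Finset.mem_filter, Finset.mem_powerset] at hu ⊢
      exact ⟨Finset.union_subset (hu.trans Finset.sdiff_subset) h, Finset.subset_union_right⟩
    · intro u hu
      simp only [Finset.mem_filter, Finset.mem_powerset] at hu
      exact Finset.sdiff_union_of_subset hu.2
    · intro u hu
      simp only [Finset.mem_powerset] at hu
      rw [Finset.union_sdiff_right]
      exact Finset.sdiff_eq_self_of_disjoint (Finset.disjoint_of_subset_left hu Finset.sdiff_disjoint)
    · intro u hu
      simp only [Finset.mem_filter, Finset.mem_powerset] at hu
      have : u.card = (u \ t).card + t.card := by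
        rw [Finset.card_sdiff_of_subset hu.2]
        have := Finset.card_le_card hu.2
        omega
      rw [this, add_assoc, ← two_mul, pow_add, pow_mul]
      norm_num
  rw [h1]
  have := Finset.sum_powerset_neg_one_pow_card (x := s \ t)
  have h2 : ∑ u ∈ (s \ t).powerset, (-1 : ℝ) ^ u.card = ((if s \ t = ∅ then 1 else 0 : ℤ) : ℝ) := by
    rw [← this]; push_cast; rfl
  rw [h2]
  by_cases hst : t = s
  · subst hst; simp
  · have : s \ t ≠ ∅ := fun h' => hst (subset_antisymm h (Finset.sdiff_eq_empty_iff_subset.1 h'))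
    simp [hst, this]

namespace Multigraph

variable {V W : Type} [Fintype V] [Fintype W]

open Classical in
-- Möbius inversion on the Boolean lattice. It expresses an event about all unicyclic components
-- through weights of pieces, none of which refers to the rest of the multigraph.
theorem sum_signedCopies (G : Multigraph V) (H : UnlabelledFragment) :
    ∑ T ∈ G.unicyclicComponents.powerset, G.signedCopies H T =
      if G.frag.IsCopyOf H then 1 else 0 := by
  have h1 : (G.frag.IsCopyOf H) ↔ (G.induce (G.verts G.unicyclicComponents)).IsCopyOf H := by
    rw [frag, fragVerts_eq]
  have h2 : ∀ T ∈ G.unicyclicComponents.powerset, G.signedCopies H T =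
      ∑ T' ∈ G.unicyclicComponents.powerset, if T' ⊆ T then
        (if (G.induce (G.verts T')).IsCopyOf H then (-1 : ℝ) ^ (T.card + T'.card) else 0) else 0 := by
    intro T hT
    rw [← Finset.sum_filter, signedCopies]
    refine Finset.sum_congr ?_ fun _ _ => rfl
    ext T'
    simp only [Finset.mem_powerset, Finset.mem_filter] at hT ⊢
    exact ⟨fun h => ⟨h.trans hT, h⟩, fun h => h.2⟩
  rw [Finset.sum_congr rfl h2, Finset.sum_comm]
  -- For a fixed `T'` the alternating sum over its supersets vanishes unless `T'` is the set of all
  -- unicyclic components.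
  have h3 : ∀ T' ∈ G.unicyclicComponents.powerset,
      (∑ T ∈ G.unicyclicComponents.powerset, if T' ⊆ T then
        (if (G.induce (G.verts T')).IsCopyOf H then (-1 : ℝ) ^ (T.card + T'.card) else 0) else 0) =
      if T' = G.unicyclicComponents then
        (if (G.induce (G.verts T')).IsCopyOf H then 1 else 0) else 0 := by
    intro T' hT'
    by_cases hcopy : (G.induce (G.verts T')).IsCopyOf H
    · simp only [hcopy, if_true]
      rw [← Finset.sum_filter,
        Finset.sum_powerset_neg_one_pow_of_subset _ _ (Finset.mem_powerset.1 hT')]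
    · simp [hcopy]
  rw [Finset.sum_congr rfl h3, Finset.sum_ite_eq' ]
  simp [h1]

open Classical in
/-- `signedCopies` of all components of a fragment. -/
noncomputable def signedWeight (H : UnlabelledFragment) (G : Multigraph V) : ℝ :=
  if G.IsFragment then G.signedCopies H Finset.univ else 0

open Classical in
-- The weight of a closed piece can be computed inside the piece; this makes its expectation
-- accessible by exposing only the half-edges of the piece.
theorem signedWeight_pullback {G : Multigraph V} {φ : W → V}
    (hφ : Function.Injective φ) (hc : G.ClosedRange φ) (H : UnlabelledFragment) :
    signedWeight H (G.pullback φ) =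
      if Finset.univ.image (componentMap hφ hc) ⊆ G.unicyclicComponents then
        G.signedCopies H (Finset.univ.image (componentMap hφ hc)) else 0 := by
  unfold signedWeight
  have h1 : (G.pullback φ).IsFragment ↔
      Finset.univ.image (componentMap hφ hc) ⊆ G.unicyclicComponents := by
    rw [Finset.image_subset_iff]
    refine forall_congr' fun C => ?_
    simp [mem_unicyclicComponents, unicyclicComponent_componentMap]
  simp only [h1]
  congr 1
  unfold signedCopies
  symm
  rw [Finset.powerset_image, Finset.sum_image
    (Finset.image_injective (componentMap_injective hφ hc)).injOn]
  refine Finset.sum_congr rfl fun T _ => ?_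
  rw [Finset.card_image_of_injective _ (componentMap_injective hφ hc),
    Finset.card_image_of_injective _ (componentMap_injective hφ hc)]
  have := (isomorphic_of_equiv_induce (G := G) hφ (verts_image_componentMap hφ hc T)).isCopyOf_iff H
  simp only [this]

open Classical in
theorem verts_image_univ {G : Multigraph V} {φ : W → V}
    (hφ : Function.Injective φ) (hc : G.ClosedRange φ) :
    G.verts (Finset.univ.image (componentMap hφ hc)) = Set.range φ := by
  rw [verts_image_componentMap hφ hc, ← Set.image_univ]
  congr 1
  ext; simp [verts]

theorem verts_injective (G : Multigraph V) : Function.Injective G.verts := by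
  intro T T' h
  ext C
  induction C using SimpleGraph.ConnectedComponent.ind with | _ v
  exact Set.ext_iff.1 h v

theorem card_embedding_range_eq {k : ℕ} (S : Set V) (hS : S.ncard = k) :
    Nat.card {φ : Fin k ↪ V // Set.range φ = S} = k.factorial := by
  classical
  have e : {φ : Fin k ↪ V // Set.range φ = S} ≃ (Fin k ≃ S) :=
    { toFun := fun φ => (Equiv.ofInjective φ.1 φ.1.injective).trans (Equiv.setCongr φ.2)
      invFun := fun ψ => ⟨ψ.toEmbedding.trans (Function.Embedding.subtype _), by
        ext v
        simp only [Set.mem_range, Function.Embedding.trans_apply, Equiv.coe_toEmbedding,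
          Function.Embedding.subtype_apply]
        constructor
        · rintro ⟨i, rfl⟩; exact (ψ i).2
        · intro hv; exact ⟨ψ.symm ⟨v, hv⟩, by simp⟩⟩
      left_inv := fun φ => by ext i; rfl
      right_inv := fun ψ => by ext i; rfl }
  have hf : Nat.card S = k := hS
  have e2 : Fin k ≃ S := (finCongr hf.symm).trans (Finite.equivFin S).symm
  rw [Nat.card_congr e, Nat.card_congr (Equiv.equivCongr (Equiv.refl _) e2.symm), Nat.card_perm]
  simp

open Classical in
-- The closed ranges whose pullback is a fragment are the vertex sets of sets of unicyclic
-- components, and each set of `k` vertices is the range of `k!` embeddings.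
theorem sum_signedWeight_embedding (G : Multigraph V) (H : UnlabelledFragment) (k : ℕ) :
    ∑ φ : Fin k ↪ V, (if G.ClosedRange φ then signedWeight H (G.pullback φ) else 0) =
      k.factorial * ∑ T ∈ G.unicyclicComponents.powerset with (G.verts T).ncard = k,
        G.signedCopies H T := by
  have h1 : ∀ φ : Fin k ↪ V, (if G.ClosedRange φ then signedWeight H (G.pullback φ) else 0) =
      ∑ T ∈ G.unicyclicComponents.powerset with (G.verts T).ncard = k,
        if Set.range φ = G.verts T then G.signedCopies H T else 0 := by
    intro φ
    by_cases hc : G.ClosedRange φ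
    · rw [if_pos hc, signedWeight_pullback φ.injective hc]
      set T₀ := Finset.univ.image (componentMap φ.injective hc) with hT₀
      have hv : G.verts T₀ = Set.range φ := verts_image_univ φ.injective hc
      have hcard : (G.verts T₀).ncard = k := by
        rw [hv, ← Set.image_univ, Set.ncard_image_of_injective _ φ.injective, Set.ncard_univ]
        simp
      have h2 : ∀ T, Set.range φ = G.verts T ↔ T = T₀ := fun T => by
        rw [← hv, G.verts_injective.eq_iff, eq_comm]
      simp only [h2, Finset.sum_ite_eq', Finset.mem_filter, Finset.mem_powerset, hcard, and_true]
    · rw [if_neg hc, Finset.sum_eq_zero]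
      intro T _
      rw [if_neg]
      intro h
      apply hc
      intro i v hv
      have := G.closedRange_verts T ⟨φ i, h ▸ ⟨i, rfl⟩⟩ v (by rwa [Subtype.range_coe, ← h])
      exact this
  simp only [h1]
  rw [Finset.sum_comm, Finset.mul_sum]
  refine Finset.sum_congr rfl fun T hT => ?_
  rw [Finset.mem_filter] at hT
  rw [← Finset.sum_filter, Finset.sum_const, nsmul_eq_mul, ← card_embedding_range_eq _ hT.2,
    Nat.card_eq_fintype_card, Fintype.card_subtype]

open Classical in
theorem sum_signedWeight_truncated (G : Multigraph V) (H : UnlabelledFragment) (K : ℕ) :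
    ∑ k ∈ Finset.range (K + 1), ((k.factorial : ℝ))⁻¹ *
      ∑ φ : Fin k ↪ V, (if G.ClosedRange φ then signedWeight H (G.pullback φ) else 0) =
      ∑ T ∈ G.unicyclicComponents.powerset with (G.verts T).ncard ≤ K, G.signedCopies H T := by
  have h1 : ∀ k : ℕ, ((k.factorial : ℝ))⁻¹ * (k.factorial * ∑ T ∈ G.unicyclicComponents.powerset with
      (G.verts T).ncard = k, G.signedCopies H T) = ∑ T ∈ G.unicyclicComponents.powerset with
      (G.verts T).ncard = k, G.signedCopies H T := fun k => by
    rw [← mul_assoc, inv_mul_cancel₀ (by positivity), one_mul]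
  simp only [sum_signedWeight_embedding, h1]
  simp only [Finset.sum_filter]
  rw [Finset.sum_comm]
  refine Finset.sum_congr rfl fun T _ => ?_
  simp

open Classical in
-- If `Frag` has at most `K` vertices, the truncation drops no term. Otherwise the sum is at most `∑
-- 2 ^ |T| = 3 ^ X` in absolute value and the indicator adds at most `1 ≤ 3 ^ X`.
theorem abs_sum_signedWeight_truncated_le (G : Multigraph V) (H : UnlabelledFragment) (K : ℕ) :
    |(∑ k ∈ Finset.range (K + 1), ((k.factorial : ℝ))⁻¹ *
      ∑ φ : Fin k ↪ V, (if G.ClosedRange φ then signedWeight H (G.pullback φ) else 0)) -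
      (if G.frag.IsCopyOf H then 1 else 0)| ≤
      if K < G.fragVerts.ncard then 2 * 3 ^ G.unicyclicComponents.card else 0 := by
  have h3 : ∑ T ∈ G.unicyclicComponents.powerset, (2 : ℝ) ^ T.card =
      3 ^ G.unicyclicComponents.card := by
    have := Finset.sum_pow_mul_eq_add_pow (2 : ℝ) 1 G.unicyclicComponents
    simp only [one_pow, mul_one] at this
    rw [this]; norm_num
  rw [sum_signedWeight_truncated]
  by_cases hK : K < G.fragVerts.ncard
  · rw [if_pos hK]
    have hb : |∑ T ∈ G.unicyclicComponents.powerset with (G.verts T).ncard ≤ K,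
        G.signedCopies H T| ≤ 3 ^ G.unicyclicComponents.card := by
      refine (Finset.abs_sum_le_sum_abs _ _).trans ?_
      rw [← h3]
      refine (Finset.sum_le_sum fun T _ => G.abs_signedCopies_le H T).trans ?_
      exact Finset.sum_le_sum_of_subset_of_nonneg (Finset.filter_subset _ _) fun _ _ _ => by
        positivity
    have h1 : (1 : ℝ) ≤ 3 ^ G.unicyclicComponents.card := one_le_pow₀ (by norm_num)
    have h2 : |(if G.frag.IsCopyOf H then (1 : ℝ) else 0)| ≤ 1 := by split_ifs <;> simp
    refine (abs_sub _ _).trans ?_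
    linarith
  · have hall : (G.unicyclicComponents.powerset.filter fun T => (G.verts T).ncard ≤ K) =
        G.unicyclicComponents.powerset := by
      refine Finset.filter_true_of_mem fun T hT => ?_
      refine (Set.ncard_le_ncard ?_ (Set.toFinite _)).trans (not_lt.1 hK)
      rw [fragVerts_eq]
      intro v hv
      exact Finset.mem_powerset.1 hT hv
    rw [hall, sum_signedCopies]
    simp [hK]

/-- Every edge lies inside a single component, so the equality of edges and vertices adds up over
the components. -/
theorem IsFragment.edgeCount_eq {G : Multigraph V} (h : G.IsFragment) :
    G.edgeCount = Nat.card V := by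
  classical
  have h1 : ∀ C : G.underlying.ConnectedComponent,
      ∑ e : Sym2 C.supp, G.mult (e.map Subtype.val) = Fintype.card C.supp := by
    intro C
    have := (h C).2
    rw [excess, edgeCount, finsum_eq_sum_of_fintype, Nat.card_eq_fintype_card] at this
    have h2 : ∑ e : Sym2 C.supp, (G.induce C.supp).mult e = Fintype.card C.supp := by omega
    exact h2
  have h2 : G.edgeCount =
      ∑ p : Σ C : G.underlying.ConnectedComponent, Sym2 C.supp, G.mult (p.2.map Subtype.val) := by
    rw [edgeCount, finsum_eq_sum_of_fintype]
    symm
    refine Fintype.sum_of_injective (fun p => p.2.map Subtype.val) ?_ _ _ ?_ fun _ => rfl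
    · rintro ⟨C, e⟩ ⟨C', e'⟩ hee
      dsimp only at hee
      have hCC : C = C' := by
        induction e with | _ x y
        have hx : x.1 ∈ e'.map Subtype.val := by
          rw [← hee]; simp
        obtain ⟨z, hz, hzx⟩ := Sym2.mem_map.1 hx
        have hz2 := z.2
        have hx2 := x.2
        rw [SimpleGraph.ConnectedComponent.mem_supp_iff] at hz2 hx2
        rw [← hz2, ← hx2, hzx]
      subst hCC
      rw [Sym2.map.injective Subtype.val_injective hee]
    · intro e he
      by_contra hm
      apply he
      induction e with | _ x y
      have hxy : G.underlying.connectedComponentMk y = G.underlying.connectedComponentMk x := by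
        rw [SimpleGraph.ConnectedComponent.eq]
        by_cases hxy : x = y
        · rw [hxy]
        · exact (G.underlying_adj.2 ⟨hm, hxy⟩).reachable.symm
      exact ⟨⟨G.underlying.connectedComponentMk x, s(⟨x, rfl⟩, ⟨y, hxy⟩)⟩, rfl⟩
  rw [h2, Fintype.sum_sigma, Finset.sum_congr rfl fun C _ => h1 C, ← Fintype.card_sigma,
    ← Nat.card_eq_fintype_card]
  exact Nat.card_congr (Equiv.sigmaFiberEquiv G.underlying.connectedComponentMk)

theorem edgeCount_eq_of_signedWeight_ne_zero {G : Multigraph V} {H : UnlabelledFragment}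
    (h : signedWeight H G ≠ 0) : G.edgeCount = Nat.card V := by
  unfold signedWeight at h
  exact IsFragment.edgeCount_eq (by by_contra hf; exact h (if_neg hf))

end Multigraph

/-! ### Finding a cycle and a tail in a unicyclic component -/

section Linked

variable {H V : Type} [Fintype H] [DecidableEq H] [DecidableEq V]

/-- `a - x₁, y₁ - x₂, …, yₘ - b` are pairs of `M`, where the `(xᵢ, yᵢ)` are the entries of the
list. -/
def Linked (M : Finset (Sym2 H)) : H → List (H × H) → H → Prop
  | a, [], b => s(a, b) ∈ M
  | a, t :: L, b => s(a, t.1) ∈ M ∧ Linked M t.2 L b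

/-- A list of pairs of distinct half-edges at distinct vertices. -/
structure IsProper (vert : H → V) (L : List (H × H)) : Prop where
  ne : ∀ t ∈ L, t.1 ≠ t.2
  vert_eq : ∀ t ∈ L, vert t.1 = vert t.2
  nodup : (L.map fun t => vert t.1).Nodup

theorem IsProper.nil {vert : H → V} : IsProper vert [] := ⟨by simp, by simp, by simp⟩

theorem IsProper.cons {vert : H → V} {L : List (H × H)} (h : IsProper vert L) {t : H × H}
    (h1 : t.1 ≠ t.2) (h2 : vert t.1 = vert t.2) (h3 : ∀ s ∈ L, vert s.1 ≠ vert t.1) :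
    IsProper vert (t :: L) := by
  refine ⟨?_, ?_, ?_⟩
  · intro s hs
    rcases List.mem_cons.1 hs with rfl | hs
    · exact h1
    · exact h.ne s hs
  · intro s hs
    rcases List.mem_cons.1 hs with rfl | hs
    · exact h2
    · exact h.vert_eq s hs
  · rw [List.map_cons, List.nodup_cons]
    refine ⟨fun hm => ?_, h.nodup⟩
    obtain ⟨s, hs, hst⟩ := List.mem_map.1 hm
    exact h3 s hs hst

theorem IsProper.concat {vert : H → V} {L : List (H × H)} (h : IsProper vert L) {t : H × H}
    (h1 : t.1 ≠ t.2) (h2 : vert t.1 = vert t.2) (h3 : ∀ s ∈ L, vert s.1 ≠ vert t.1) :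
    IsProper vert (L ++ [t]) := by
  have hp : (t :: L).Perm (L ++ [t]) := (List.perm_append_singleton t L).symm
  have h' := h.cons h1 h2 h3
  refine ⟨fun s hs => h'.ne s (hp.mem_iff.2 hs), fun s hs => h'.vert_eq s (hp.mem_iff.2 hs), ?_⟩
  exact (hp.map _).nodup_iff.1 h'.nodup

theorem IsProper.length_le [Fintype V] {vert : H → V} {L : List (H × H)} (h : IsProper vert L) :
    L.length ≤ Fintype.card V := by
  have := h.nodup.length_le_card
  simpa using this

theorem IsProper.of_cons {vert : H → V} {L : List (H × H)} {t : H × H}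
    (h : IsProper vert (t :: L)) : IsProper vert L ∧ ∀ s ∈ L, vert s.1 ≠ vert t.1 := by
  have h3 := h.nodup
  rw [List.map_cons, List.nodup_cons] at h3
  refine ⟨⟨fun s hs => h.ne s (List.mem_cons_of_mem _ hs),
    fun s hs => h.vert_eq s (List.mem_cons_of_mem _ hs), h3.2⟩, fun s hs he => h3.1 ?_⟩
  exact List.mem_map.2 ⟨s, hs, he⟩

theorem Linked.concat {M : Finset (Sym2 H)} {a b : H} {L : List (H × H)} (h : Linked M a L b)
    {c z : H} (hc : s(c, z) ∈ M) : Linked M a (L ++ [(b, c)]) z := by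
  induction L generalizing a with
  | nil => exact ⟨h, hc⟩
  | cons t L ih => exact ⟨h.1, ih h.2⟩

theorem Linked.last {M : Finset (Sym2 H)} {a b : H} {L : List (H × H)} (h : Linked M a L b)
    (hL : L ≠ []) : ∃ t ∈ L, s(t.2, b) ∈ M := by
  induction L generalizing a with
  | nil => exact absurd rfl hL
  | cons t L ih =>
    rcases L with _ | ⟨t', L⟩
    · exact ⟨t, by simp, h.2⟩
    · obtain ⟨u, hu, hub⟩ := ih h.2 (by simp)
      exact ⟨u, List.mem_cons_of_mem _ hu, hub⟩

/-- If the ends were the same half-edge, its unique partner would be both the first entry of the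
first transit and the second entry of the last one. Distinct vertices force these transits to
coincide, which gives a transit with equal entries. -/
theorem Linked.ne {vert : H → V} {S : Finset H} {M : Finset (Sym2 H)}
    (hM : M ∈ perfectMatchings S) {a b : H} {L : List (H × H)} (h : Linked M a L b)
    (hL : IsProper vert L) : a ≠ b := by
  rcases L with _ | ⟨t, L⟩
  · exact perfectMatchings.ne hM h
  · rintro rfl
    obtain ⟨u, hu, hub⟩ := h.last (by simp)
    have h1 := h.1
    rw [Sym2.eq_swap] at hub
    have h2 : t.1 = u.2 := perfectMatchings.partner_unique hM h1 hub
    have h3 : vert u.1 = vert t.1 := by rw [hL.vert_eq u hu, h2]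
    have h4 : u = t := by
      by_contra hne
      rcases List.mem_cons.1 hu with rfl | hu'
      · exact hne rfl
      · exact hL.of_cons.2 u hu' h3
    subst h4
    exact hL.ne u (by simp) h2

/-- The list itself is one of the nonnegative summands. The surviving set `U'` still contains the
half-edges of `U` at vertices off the list, so that further cycles or tails can be found there. -/
theorem Linked.exists_le_chainSum {vert : H → V} {M : Finset (Sym2 H)}
    {K : H → Finset H → ℝ} (hK : ∀ a U, 0 ≤ K a U) {a b : H} {L : List (H × H)}
    (h : Linked M a L b) (hL : IsProper vert L) {U : Finset H}
    (hU : ∀ t ∈ L, t.1 ∈ U ∧ t.2 ∈ U) :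
    ∃ a' U', s(a', b) ∈ M ∧ (∀ x ∈ U, (∀ t ∈ L, vert x ≠ vert t.1) → x ∈ U') ∧
      K a' U' ≤ chainSum vert M K L.length a U := by
  induction L generalizing a U with
  | nil => exact ⟨a, U, h, fun x hx _ => hx, le_rfl⟩
  | cons t L ih =>
    obtain ⟨hL', hne⟩ := hL.of_cons
    have hv := hL.vert_eq t (by simp)
    obtain ⟨a', U', h1, h2, h3⟩ := ih (U := U \ {t.1, t.2}) h.2 hL' (by
      intro s hs
      have hsU := hU s (List.mem_cons_of_mem _ hs)
      have hsv := hne s hs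
      have hs2 := hL'.vert_eq s hs
      simp only [Finset.mem_sdiff, Finset.mem_insert, Finset.mem_singleton, hsU, true_and]
      constructor
      · rintro (h | h)
        · exact hsv (by rw [h])
        · exact hsv (by rw [h, hv])
      · rintro (h | h)
        · exact hsv (by rw [hs2, h])
        · exact hsv (by rw [hs2, h, hv]))
    refine ⟨a', U', h1, fun x hx hxt => h2 x ?_ fun s hs => hxt s (List.mem_cons_of_mem _ hs), ?_⟩
    · have := hxt t (by simp)
      simp only [Finset.mem_sdiff, hx, Finset.mem_insert, Finset.mem_singleton, true_and]
      rintro (rfl | rfl)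
      · exact this rfl
      · exact this hv.symm
    · refine h3.trans ?_
      rw [List.length_cons, chainSum]
      refine Finset.single_le_sum (f := fun t : H × H => chainSum vert M K L.length t.2 (U \ {t.1, t.2}))
        (fun t _ => chainSum_nonneg hK _ _ _) ?_
      rw [Finset.mem_filter, mem_transits]
      exact ⟨⟨(hU t (by simp)).1, (hU t (by simp)).2, hL.ne t (by simp), hv⟩, h.1⟩

/-- The multigraph of a set of pairs of half-edges. -/
def matchingGraph (vert : H → V) (M : Finset (Sym2 H)) : Multigraph V where
  mult e := (M.filter fun p => p.map vert = e).card

theorem edgeCount_pullback_matchingGraph {W : Type} [Fintype W] (vert : H → V)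
    (M : Finset (Sym2 H)) {φ : W → V} (hφ : Function.Injective φ) [DecidablePred (· ∈ Set.range φ)] :
    ((matchingGraph vert M).pullback φ).edgeCount =
      (M.filter fun p => ∀ x ∈ p, vert x ∈ Set.range φ).card := by
  classical
  rw [Multigraph.edgeCount, finsum_eq_sum_of_fintype]
  simp only [Multigraph.pullback, matchingGraph, Finset.card_filter]
  rw [Finset.sum_comm]
  refine Finset.sum_congr rfl fun p _ => ?_
  induction p with | _ a b
  by_cases h : ∀ x ∈ s(a, b), vert x ∈ Set.range φ
  · rw [if_pos h]
    obtain ⟨i, hi⟩ := h a (by simp)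
    obtain ⟨j, hj⟩ := h b (by simp)
    have : ∀ e : Sym2 W, Sym2.map vert s(a, b) = e.map φ ↔ e = s(i, j) := by
      intro e
      rw [Sym2.map_mk, ← hi, ← hj, ← Sym2.map_mk, (Sym2.map.injective hφ).eq_iff, eq_comm]
    simp only [this, Finset.sum_ite_eq', Finset.mem_univ, if_true]
  · rw [if_neg h, Finset.sum_eq_zero]
    intro e _
    rw [if_neg]
    intro he
    apply h
    intro x hx
    have : vert x ∈ e.map φ := he ▸ Sym2.mem_map.2 ⟨x, hx, rfl⟩
    obtain ⟨i, -, hi⟩ := Sym2.mem_map.1 this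
    exact ⟨i, hi⟩

/-- The first edge of a shortest walk from `u` to `v`. -/
theorem exists_parent [Fintype V] (vert : H → V) (M : Finset (Sym2 H)) {v u : V}
    (h : (matchingGraph vert M).underlying.Reachable v u) (huv : u ≠ v) :
    ∃ α β, s(α, β) ∈ M ∧ vert α = u ∧
      (matchingGraph vert M).underlying.Reachable v (vert β) ∧
      (matchingGraph vert M).underlying.dist v u =
        (matchingGraph vert M).underlying.dist v (vert β) + 1 := by
  set G := (matchingGraph vert M) with hG
  obtain ⟨p, hp⟩ := h.symm.exists_walk_length_eq_dist
  cases p with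
  | nil => exact absurd rfl huv
  | @cons _ w _ hadj p =>
    have hm := (G.underlying_adj.1 hadj).1
    have : ((M.filter fun q => q.map vert = s(u, w))).card ≠ 0 := hm
    rw [Finset.card_ne_zero] at this
    obtain ⟨q, hq⟩ := this
    rw [Finset.mem_filter] at hq
    obtain ⟨hqM, hq⟩ := hq
    obtain ⟨α, hα, hαu⟩ := Sym2.mem_map.1 (hq ▸ Sym2.mem_mk_left u w : u ∈ q.map vert)
    obtain ⟨β, rfl⟩ := hα
    rw [Sym2.map_mk, hαu] at hq
    have hβ : vert β = w := Sym2.congr_right.1 hq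
    have hreach : G.underlying.Reachable v w := p.reachable.symm
    refine ⟨α, β, hqM, hαu, hβ ▸ hreach, ?_⟩
    rw [hβ]
    rw [SimpleGraph.Walk.length_cons, SimpleGraph.dist_comm] at hp
    have h1 : G.underlying.dist v w ≤ p.length := by
      rw [SimpleGraph.dist_comm]; exact SimpleGraph.dist_le p
    have h2 : G.underlying.dist v u ≤ G.underlying.dist v w + 1 := by
      obtain ⟨p', hp'⟩ := hreach.exists_walk_length_eq_dist
      rw [← hp']
      have := SimpleGraph.dist_le (p'.concat hadj.symm)
      rwa [SimpleGraph.Walk.length_concat] at this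
    omega

/-- A function `r` on a set `C` of vertices, and for every vertex of `C` other than `v` a matched
pair that leads to a vertex of smaller rank. -/
structure IsParent (vert : H → V) (M : Finset (Sym2 H)) (C : Set V) (v : V) (r : V → ℕ)
    (α β : V → H) : Prop where
  mem : ∀ u ∈ C, u ≠ v → s(α u, β u) ∈ M
  vert_fst : ∀ u ∈ C, u ≠ v → vert (α u) = u
  vert_snd : ∀ u ∈ C, u ≠ v → vert (β u) ∈ C
  rank : ∀ u ∈ C, u ≠ v → r u = r (vert (β u)) + 1
  rank_root : r v = 0
  eq_root : ∀ u ∈ C, r u = 0 → u = v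

variable {vert : H → V} {M : Finset (Sym2 H)} {C : Set V} {v : V} {r : V → ℕ} {α β : V → H}
  {S : Finset H}

/-- Otherwise one pair would lead both from `u` to its parent and from the parent back to `u`, and
the rank would drop twice along a closed walk. -/
theorem IsParent.snd_ne (h : IsParent vert M C v r α β) (hM : M ∈ perfectMatchings S) {u : V}
    (hu : u ∈ C) (huv : u ≠ v) (hpv : vert (β u) ≠ v) : β u ≠ α (vert (β u)) := by
  intro he
  have hp := h.vert_snd u hu huv
  have h1 := h.mem u hu huv
  have h2 := h.mem _ hp hpv
  rw [← he] at h2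
  rw [Sym2.eq_swap] at h1
  have h3 := perfectMatchings.partner_unique hM h1 h2
  have h4 := h.rank u hu huv
  have h5 := h.rank _ hp hpv
  rw [← h3, h.vert_fst u hu huv] at h5
  omega

/-- Follow parents down to the root. Ranks strictly decrease, so no vertex is repeated. -/
theorem IsParent.exists_tail (h : IsParent vert M C v r α β) (hM : M ∈ perfectMatchings S) {t : V}
    (ht : t ∈ C) (htv : t ≠ v) :
    ∃ L b, Linked M (α t) L b ∧ IsProper vert L ∧ vert b = v ∧
      ∀ l ∈ L, r (vert l.1) < r t ∧ vert l.1 ≠ v := by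
  induction hn : r t using Nat.strong_induction_on generalizing t with
  | _ n ih =>
    have hr := h.rank t ht htv
    by_cases hp : vert (β t) = v
    · exact ⟨[], β t, h.mem t ht htv, IsProper.nil, hp, by simp⟩
    · have hpC := h.vert_snd t ht htv
      obtain ⟨L, b, h1, h2, h3, h4⟩ := ih (r (vert (β t))) (by omega) hpC hp rfl
      refine ⟨(β t, α (vert (β t))) :: L, b, ⟨h.mem t ht htv, h1⟩, h2.cons ?_ ?_ ?_, h3, ?_⟩
      · exact h.snd_ne hM ht htv hp
      · exact (h.vert_fst _ hpC hp).symm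
      · intro s hs he
        have := (h4 s hs).1
        dsimp only at he
        rw [he] at this
        exact lt_irrefl _ this
      · intro l hl
        rcases List.mem_cons.1 hl with rfl | hl
        · exact ⟨by dsimp only; omega, hp⟩
        · exact ⟨by have := (h4 l hl).1; omega, (h4 l hl).2⟩

/-- A non-parent pair closes a cycle with the tree of parents: both ends climb towards the root
until they meet. The invariant is that no vertex of the list has smaller rank than either end.
Neither end is the parent half-edge of its vertex, so the next transit has distinct entries and,
when the ends meet away from the root, the parent half-edge is free to start a tail. -/
theorem IsParent.exists_cycle (h : IsParent vert M C v r α β) (hM : M ∈ perfectMatchings S)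
    (L : List (H × H)) (y z : H) (hy : vert y ∈ C) (hz : vert z ∈ C) (hL : Linked M y L z)
    (hP : IsProper vert L)
    (hLC : ∀ l ∈ L, vert l.1 ∈ C ∧ r (vert y) ≤ r (vert l.1) ∧ r (vert z) ≤ r (vert l.1))
    (hyL : ∀ l ∈ L, vert l.1 ≠ vert y) (hzL : ∀ l ∈ L, vert l.1 ≠ vert z)
    (hyα : vert y ≠ v → y ≠ α (vert y)) (hzα : vert z ≠ v → z ≠ α (vert z)) :
    ∃ (L : List (H × H)) (y z : H), vert y ∈ C ∧ vert z = vert y ∧ Linked M y L z ∧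
      IsProper vert L ∧ (∀ l ∈ L, vert l.1 ∈ C ∧ r (vert y) ≤ r (vert l.1) ∧ vert l.1 ≠ vert y) ∧
      (vert y ≠ v → y ≠ α (vert y) ∧ z ≠ α (vert y)) := by
  induction hn : r (vert y) + r (vert z) using Nat.strong_induction_on generalizing L y z with
  | _ n ih =>
    by_cases hyz : vert y = vert z
    · refine ⟨L, y, z, hy, hyz.symm, hL, hP, fun l hl => ⟨(hLC l hl).1, (hLC l hl).2.1, hyL l hl⟩,
        fun hv => ⟨hyα hv, hyz ▸ hzα (hyz ▸ hv)⟩⟩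
    -- The end of larger rank moves, and `y` moves in a tie. The moving end is not at the root, as
    -- only the root has rank zero and the two ends are at different vertices.
    · rcases le_or_gt (r (vert z)) (r (vert y)) with hr | hr
      · have hyv : vert y ≠ v := fun hv => hyz (hv.trans (h.eq_root _ hz (by
          rw [hv, h.rank_root] at hr; omega)).symm)
        have hrank := h.rank _ hy hyv
        have hp := h.vert_snd _ hy hyv
        have hf := h.vert_fst _ hy hyv
        have hm := h.mem _ hy hyv
        refine ih _ ?_ ((α (vert y), y) :: L) (β (vert y)) z hp hz
          ⟨by rw [Sym2.eq_swap]; exact hm, hL⟩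
          (hP.cons (hyα hyv).symm hf (by simpa only [hf] using hyL)) ?_ ?_ ?_
          (fun hpv => h.snd_ne hM hy hyv hpv) hzα rfl
        · omega
        · intro l hl
          rcases List.mem_cons.1 hl with rfl | hl
          · simp only [hf]
            exact ⟨hy, by omega, hr⟩
          · have := hLC l hl
            exact ⟨this.1, by omega, this.2.2⟩
        · intro l hl he
          rcases List.mem_cons.1 hl with rfl | hl
          · simp only [hf] at he
            rw [← he] at hrank
            omega
          · have := (hLC l hl).2.1
            rw [he] at this
            omega
        · intro l hl
          rcases List.mem_cons.1 hl with rfl | hl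
          · simpa only [hf] using hyz
          · exact hzL l hl
      · have hzv : vert z ≠ v := fun hv => by rw [hv, h.rank_root] at hr; omega
        have hrank := h.rank _ hz hzv
        have hp := h.vert_snd _ hz hzv
        have hf := h.vert_fst _ hz hzv
        have hm := h.mem _ hz hzv
        refine ih _ ?_ (L ++ [(z, α (vert z))]) y (β (vert z)) hy hp
          (hL.concat hm)
          (hP.concat (hzα hzv) hf.symm hzL) ?_ ?_ ?_
          hyα (fun hpv => h.snd_ne hM hz hzv hpv) rfl
        · omega
        · intro l hl
          rcases List.mem_append.1 hl with hl | hl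
          · have := hLC l hl
            exact ⟨this.1, this.2.1, by omega⟩
          · rw [List.mem_singleton.1 hl]
            exact ⟨hz, hr.le, by dsimp only; omega⟩
        · intro l hl
          rcases List.mem_append.1 hl with hl | hl
          · exact hyL l hl
          · rw [List.mem_singleton.1 hl]
            exact Ne.symm hyz
        · intro l hl he
          rcases List.mem_append.1 hl with hl | hl
          · have := (hLC l hl).2.2
            rw [he] at this
            omega
          · rw [List.mem_singleton.1 hl] at he
            dsimp only at he
            rw [← he] at hrank
            omega

theorem card_filter_component [Fintype V] {G : Multigraph V} (hG : G = matchingGraph vert M)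
    {C : G.underlying.ConnectedComponent} [DecidablePred (· ∈ C.supp)]
    (hC : G.UnicyclicComponent C) :
    (M.filter fun p => ∀ x ∈ p, vert x ∈ C.supp).card = Nat.card C.supp := by
  classical
  have h1 := edgeCount_pullback_matchingGraph vert M (φ := (Subtype.val : C.supp → V))
    Subtype.val_injective
  have h2 := hC.2
  rw [Multigraph.excess, Multigraph.induce_eq_pullback] at h2
  rw [← hG] at h1
  simp only [Subtype.range_coe] at h1
  have : (G.pullback (Subtype.val : C.supp → V)).edgeCount = Nat.card C.supp := by omega
  rw [← this, h1]

/-- A vertex of a unicyclic component lies on a cycle, or is joined to a cycle by a tail. -/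
theorem exists_cycle_of_unicyclicComponent [Fintype V] (vert : H → V)
    (hM : M ∈ perfectMatchings (Finset.univ : Finset H)) (v : V)
    (hv : (matchingGraph vert M).UnicyclicComponent
      ((matchingGraph vert M).underlying.connectedComponentMk v)) :
    ∃ (L : List (H × H)) (y z : H), y ≠ z ∧ vert z = vert y ∧ Linked M y L z ∧ IsProper vert L ∧
      (matchingGraph vert M).underlying.Reachable v (vert y) ∧
      (∀ l ∈ L, (matchingGraph vert M).underlying.Reachable v (vert l.1) ∧ vert l.1 ≠ vert y) ∧
      (vert y = v ∨ ∃ (x : H) (L' : List (H × H)) (b : H), vert x = vert y ∧ x ≠ y ∧ x ≠ z ∧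
        Linked M x L' b ∧ IsProper vert L' ∧ vert b = v ∧ v ≠ vert y ∧ (∀ l ∈ L, vert l.1 ≠ v) ∧
        ∀ l ∈ L', vert l.1 ≠ v ∧ vert l.1 ≠ vert y ∧ ∀ l' ∈ L, vert l.1 ≠ vert l'.1) := by
  classical
  set G := matchingGraph vert M with hG
  set C := G.underlying.connectedComponentMk v with hCdef
  have hmem : ∀ u, u ∈ C.supp ↔ G.underlying.Reachable v u := fun u => by
    rw [SimpleGraph.ConnectedComponent.mem_supp_iff, hCdef, SimpleGraph.ConnectedComponent.eq]
    exact ⟨fun h => h.symm, fun h => h.symm⟩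
  have hpar : ∀ u, ∃ α β, u ∈ C.supp → u ≠ v → s(α, β) ∈ M ∧ vert α = u ∧
      G.underlying.Reachable v (vert β) ∧
      G.underlying.dist v u = G.underlying.dist v (vert β) + 1 := by
    intro u
    by_cases hu : u ∈ C.supp ∧ u ≠ v
    · obtain ⟨α, β, h⟩ := exists_parent vert M ((hmem u).1 hu.1) hu.2
      exact ⟨α, β, fun _ _ => h⟩
    -- The values at `v` and outside the component are irrelevant; the component has at least one
    -- pair, which supplies some half-edges.
    · have hc := card_filter_component hG hv
      have : (M.filter fun p => ∀ x ∈ p, vert x ∈ C.supp).card ≠ 0 := by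
        rw [hc]
        have : Nonempty C.supp := ⟨⟨v, rfl⟩⟩
        exact Nat.card_pos.ne'
      obtain ⟨p, hp⟩ := Finset.card_ne_zero.1 this
      induction p with | _ a b
      exact ⟨a, b, fun h1 h2 => absurd ⟨h1, h2⟩ hu⟩
  choose α β hαβ using hpar
  have hP : IsParent vert M C.supp v (G.underlying.dist v) α β :=
    { mem := fun u h1 h2 => (hαβ u h1 h2).1
      vert_fst := fun u h1 h2 => (hαβ u h1 h2).2.1
      vert_snd := fun u h1 h2 => (hmem _).2 (hαβ u h1 h2).2.2.1
      rank := fun u h1 h2 => (hαβ u h1 h2).2.2.2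
      rank_root := SimpleGraph.dist_self
      eq_root := fun u h1 h2 => ((((hmem u).1 h1).dist_eq_zero_iff).1 h2).symm }
  -- The component has as many pairs as vertices, and there is at most one parent pair for each
  -- vertex other than `v`; so some pair is not a parent pair.
  have hex : ∃ p ∈ M, (∀ x ∈ p, vert x ∈ C.supp) ∧
      ∀ u ∈ C.supp, u ≠ v → p ≠ s(α u, β u) := by
    by_contra! hcon
    have hc := card_filter_component hG hv
    have hsub : (M.filter fun p => ∀ x ∈ p, vert x ∈ C.supp) ⊆
        (C.supp.toFinset.erase v).image fun u => s(α u, β u) := by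
      intro p hp
      rw [Finset.mem_filter] at hp
      obtain ⟨u, hu, huv, rfl⟩ := hcon p hp.1 hp.2
      exact Finset.mem_image.2 ⟨u, by simp [huv, hu], rfl⟩
    have h1 := (Finset.card_le_card hsub).trans Finset.card_image_le
    have hvC : v ∈ C.supp.toFinset := by simp [hmem]
    rw [Finset.card_erase_of_mem hvC, hc, Set.toFinset_card, Nat.card_eq_fintype_card] at h1
    have : 0 < Fintype.card C.supp := Fintype.card_pos_iff.2 ⟨⟨v, rfl⟩⟩
    omega
  obtain ⟨p, hpM, hpC, hpne⟩ := hex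
  induction p with | _ a b
  have haC : vert a ∈ C.supp := hpC a (by simp)
  have hbC : vert b ∈ C.supp := hpC b (by simp)
  have haα : vert a ≠ v → a ≠ α (vert a) := fun h he => by
    have h1 := hP.mem _ haC h
    rw [← he] at h1
    refine hpne _ haC h ?_
    rw [← he, perfectMatchings.partner_unique hM hpM h1]
  have hbα : vert b ≠ v → b ≠ α (vert b) := fun h he => by
    have h1 := hP.mem _ hbC h
    rw [← he] at h1
    refine hpne _ hbC h ?_
    rw [Sym2.eq_swap] at hpM
    rw [← he, ← perfectMatchings.partner_unique hM hpM h1, Sym2.eq_swap]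
  obtain ⟨L, y, z, hy, hzy, hL, hLP, hLC, hyz⟩ := hP.exists_cycle hM [] a b haC hbC hpM IsProper.nil
    (by simp) (by simp) (by simp) haα hbα
  refine ⟨L, y, z, hL.ne hM hLP, hzy, hL, hLP, (hmem _).1 hy,
    fun l hl => ⟨(hmem _).1 (hLC l hl).1, (hLC l hl).2.2⟩, ?_⟩
  by_cases hyv : vert y = v
  · exact Or.inl hyv
  -- The vertex of `y` has least rank on the cycle, and the tail leaves it by its parent half-edge.
  -- Every further vertex of the tail has smaller rank, hence is off the cycle; so is `v`, which has
  -- rank zero.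
  · obtain ⟨L', b', h1, h2, h3, h4⟩ := hP.exists_tail hM hy hyv
    refine Or.inr ⟨α (vert y), L', b', hP.vert_fst _ hy hyv, (hyz hyv).1.symm, (hyz hyv).2.symm, h1,
      h2, h3, Ne.symm hyv, ?_, ?_⟩
    · intro l hl he
      have := (hLC l hl).2.1
      have h0 := hP.rank _ hy hyv
      rw [he, hP.rank_root] at this
      omega
    · intro l hl
      have := h4 l hl
      refine ⟨this.2, fun he => by rw [he] at this; exact lt_irrefl _ this.1, fun l' hl' he => ?_⟩
      have h5 := (hLC l' hl').2.1
      rw [he] at this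
      omega

end Linked

/-! ### Unicyclic components and their vertices bounded by cycles and lollipops -/

section Counts

variable {H V : Type} [Fintype H] [DecidableEq H] [DecidableEq V] [Fintype V]
  {vert : H → V} {M : Finset (Sym2 H)}

theorem Linked.exists_le_cycleSum {J : Finset (Sym2 H) → Finset H → ℝ} (hJ : ∀ U, 0 ≤ J M U)
    {y z : H} {L : List (H × H)} (h : Linked M y L z) (hL : IsProper vert L)
    (hzy : vert z = vert y) (hLy : ∀ l ∈ L, vert l.1 ≠ vert y) {U : Finset H}
    (hU : ∀ l ∈ L, l.1 ∈ U ∧ l.2 ∈ U) :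
    ∃ U', (∀ x ∈ U, vert x ≠ vert y → (∀ l ∈ L, vert x ≠ vert l.1) → x ∈ U') ∧
      J M U' ≤ cycleSum vert J M L.length (z, y) U := by
  obtain ⟨a', U', h1, h2, h3⟩ := h.exists_le_chainSum (K := closeAt z J M)
    (fun a U => closeAt_nonneg hJ a U) hL (U := U \ {z, y}) (by
      intro l hl
      have := hLy l hl
      have h2 := hL.vert_eq l hl
      simp only [Finset.mem_sdiff, hU l hl, Finset.mem_insert, Finset.mem_singleton, true_and]
      constructor
      · rintro (h | h)
        · exact this (by rw [h, hzy])
        · exact this (by rw [h])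
      · rintro (h | h)
        · exact this (by rw [h2, h, hzy])
        · exact this (by rw [h2, h]))
  refine ⟨U', fun x hx hxy hxL => h2 x ?_ hxL, ?_⟩
  · simp only [Finset.mem_sdiff, hx, Finset.mem_insert, Finset.mem_singleton, true_and]
    rintro (rfl | rfl)
    · exact hxy hzy
    · exact hxy rfl
  · rw [closeAt, if_pos h1] at h3
    exact h3

/-- Choose an ordered `r`-tuple of distinct components and a cycle in each. Roots in different
components differ, and a cycle uses no half-edge of another component. Cycles visit distinct
vertices, so the bound `|V| + 1` on the lengths loses nothing. -/
theorem descFactorial_le_cycleTuples (hM : M ∈ perfectMatchings (Finset.univ : Finset H))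
    {G : Multigraph V} (hG : G = matchingGraph vert M) (r : ℕ)
    (𝒟 : Finset G.underlying.ConnectedComponent) (h𝒟 : 𝒟 ⊆ G.unicyclicComponents) (U : Finset H)
    (hU : ∀ x, G.underlying.connectedComponentMk (vert x) ∈ 𝒟 → x ∈ U) :
    (𝒟.card.descFactorial r : ℝ) ≤ cycleTuples vert (Fintype.card V + 1) r M U := by
  classical
  induction r generalizing 𝒟 U with
  | zero => simp [cycleTuples]
  | succ r ih =>
    have hcyc : ∀ C ∈ 𝒟, ∃ p : ℕ × H × H,
        p ∈ Finset.range (Fintype.card V + 1) ×ˢ transits vert U ∧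
        G.underlying.connectedComponentMk (vert p.2.1) = C ∧
        ((𝒟.card - 1).descFactorial r : ℝ) ≤
          cycleSum vert (cycleTuples vert (Fintype.card V + 1) r) M p.1 p.2 U := by
      intro C hC
      induction C using SimpleGraph.ConnectedComponent.ind with | _ v
      obtain ⟨L, y, z, hyz, hzy, hL, hLP, hvy, hvL, -⟩ :=
        exists_cycle_of_unicyclicComponent vert hM v
          (hG ▸ Multigraph.mem_unicyclicComponents.1 (h𝒟 hC))
      rw [← hG] at hvy hvL
      have hcomp : ∀ u, G.underlying.Reachable v u → G.underlying.connectedComponentMk u =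
          G.underlying.connectedComponentMk v := fun u h =>
        SimpleGraph.ConnectedComponent.eq.2 h.symm
      have hmemU : ∀ x, G.underlying.Reachable v (vert x) → x ∈ U := fun x hx =>
        hU x (by rw [hcomp _ hx]; exact hC)
      obtain ⟨U', hU', hle⟩ := hL.exists_le_cycleSum
        (J := cycleTuples vert (Fintype.card V + 1) r)
        (fun U => cycleTuples_nonneg _ _ _ _) hLP hzy (fun l hl => (hvL l hl).2) (U := U)
        (fun l hl => ⟨hmemU _ (hvL l hl).1, hmemU _ (hLP.vert_eq l hl ▸ (hvL l hl).1)⟩)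
      refine ⟨(L.length, z, y), ?_, ?_, ?_⟩
      · rw [Finset.mem_product, Finset.mem_range, mem_transits]
        exact ⟨Nat.lt_succ_of_le hLP.length_le, hmemU z (hzy ▸ hvy), hmemU y hvy, hyz.symm, hzy⟩
      · exact hcomp _ (hzy ▸ hvy)
      · refine le_trans ?_ hle
        rw [← Finset.card_erase_of_mem hC]
        refine ih _ ((Finset.erase_subset _ _).trans h𝒟) U' fun x hx => ?_
        rw [Finset.mem_erase] at hx
        refine hU' x (hU x hx.2) (fun he => hx.1 ?_) fun l hl he => hx.1 ?_
        · rw [he]; exact hcomp _ hvy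
        · rw [he]; exact hcomp _ (hvL l hl).1
    rcases 𝒟.eq_empty_or_nonempty with rfl | hne
    · rw [Finset.card_empty, Nat.zero_descFactorial_succ, Nat.cast_zero]
      exact cycleTuples_nonneg _ _ _ _
    · have : Nonempty H := ⟨(hcyc _ hne.choose_spec).choose.2.1⟩
      choose! p hp using hcyc
      have hinj : Set.InjOn p 𝒟 := fun C hC C' hC' h => by
        rw [← (hp C hC).2.1, ← (hp C' hC').2.1, h]
      have hc : 𝒟.card = (𝒟.card - 1) + 1 := (Nat.sub_add_cancel (Finset.card_pos.2 hne)).symm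
      have h1 : (𝒟.card.descFactorial (r + 1) : ℝ) =
          ∑ C ∈ 𝒟, ((𝒟.card - 1).descFactorial r : ℝ) := by
        rw [Finset.sum_const, nsmul_eq_mul]
        conv_lhs => rw [hc, Nat.succ_descFactorial_succ, ← hc]
        push_cast
        rfl
      rw [h1, cycleTuples, ← Finset.sum_product']
      refine (Finset.sum_le_sum fun C hC => (hp C hC).2.2).trans ?_
      rw [← Finset.sum_image (f := fun p : ℕ × H × H =>
        cycleSum vert (cycleTuples vert (Fintype.card V + 1) r) M p.1 p.2 U) hinj]
      refine Finset.sum_le_sum_of_subset_of_nonneg ?_ fun _ _ _ =>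
        cycleSum_nonneg (fun U => cycleTuples_nonneg _ _ _ _) _ _ _
      intro q hq
      obtain ⟨C, hC, rfl⟩ := Finset.mem_image.1 hq
      exact (hp C hC).1

theorem Finset.le_sum_four {ι κ τ ξ : Type*} (s₁ : Finset ι) (s₂ : Finset κ) (s₃ : Finset τ)
    (s₄ : τ → Finset ξ) (f : ι → κ → τ → ξ → ℝ) (hf : ∀ i k t x, 0 ≤ f i k t x) {i : ι} {k : κ}
    {t : τ} {x : ξ} (hi : i ∈ s₁) (hk : k ∈ s₂) (ht : t ∈ s₃) (hx : x ∈ s₄ t) :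
    f i k t x ≤ ∑ i ∈ s₁, ∑ k ∈ s₂, ∑ t ∈ s₃, ∑ x ∈ s₄ t, f i k t x := by
  have h4 : ∀ i k t, 0 ≤ ∑ x ∈ s₄ t, f i k t x := fun i k t => Finset.sum_nonneg fun _ _ => hf _ _ _ _
  have h3 : ∀ i k, 0 ≤ ∑ t ∈ s₃, ∑ x ∈ s₄ t, f i k t x := fun i k =>
    Finset.sum_nonneg fun _ _ => h4 _ _ _
  have h2 : ∀ i, 0 ≤ ∑ k ∈ s₂, ∑ t ∈ s₃, ∑ x ∈ s₄ t, f i k t x := fun i =>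
    Finset.sum_nonneg fun _ _ => h3 _ _
  calc f i k t x ≤ ∑ x ∈ s₄ t, f i k t x := Finset.single_le_sum (fun x _ => hf i k t x) hx
    _ ≤ ∑ t ∈ s₃, ∑ x ∈ s₄ t, f i k t x :=
      Finset.single_le_sum (f := fun t => ∑ x ∈ s₄ t, f i k t x) (fun t _ => h4 i k t) ht
    _ ≤ ∑ k ∈ s₂, ∑ t ∈ s₃, ∑ x ∈ s₄ t, f i k t x :=
      Finset.single_le_sum (f := fun k => ∑ t ∈ s₃, ∑ x ∈ s₄ t, f i k t x) (fun k _ => h3 i k) hk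
    _ ≤ _ := Finset.single_le_sum (f := fun i => ∑ k ∈ s₂, ∑ t ∈ s₃, ∑ x ∈ s₄ t, f i k t x)
      (fun i _ => h2 i) hi

/-- The number of half-edges at a vertex. -/
def halfEdgeCount (vert : H → V) (v : V) : ℕ := (Finset.univ.filter fun x => vert x = v).card

/-- The number of rooted cycles with root at a vertex in `A`. -/
noncomputable def cyclesThrough (vert : H → V) (A : V → Prop) [DecidablePred A]
    (M : Finset (Sym2 H)) : ℝ :=
  ∑ m ∈ Finset.range (Fintype.card V + 1), ∑ t ∈ transits vert Finset.univ with A (vert t.1),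
    cycleSum vert (fun _ _ => 1) M m t Finset.univ

/-- The number of lollipops whose tail ends at `v` and whose junction has at most `Δ`
half-edges. -/
noncomputable def lollipopsTo (vert : H → V) (Δ : ℕ) (M : Finset (Sym2 H)) (v : V) : ℝ :=
  ∑ l ∈ Finset.range (Fintype.card V + 1), ∑ m ∈ Finset.range (Fintype.card V + 1),
    ∑ t ∈ transits vert Finset.univ, ∑ x ∈ Finset.univ with
      (vert x = vert t.1 ∧ x ≠ t.1 ∧ x ≠ t.2) ∧ halfEdgeCount vert (vert t.1) ≤ Δ,
      lollipopSum vert v l m t x M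

theorem cyclesThrough_nonneg (A : V → Prop) [DecidablePred A] : 0 ≤ cyclesThrough vert A M :=
  Finset.sum_nonneg fun _ _ => Finset.sum_nonneg fun _ _ => cycleSum_nonneg (fun _ => zero_le_one) _ _ _

theorem lollipopsTo_nonneg (Δ : ℕ) (v : V) : 0 ≤ lollipopsTo vert Δ M v :=
  Finset.sum_nonneg fun _ _ => Finset.sum_nonneg fun _ _ => Finset.sum_nonneg fun _ _ =>
    Finset.sum_nonneg fun _ _ => lollipopSum_nonneg _ _ _ _ _ _

theorem Linked.one_le_cyclesThrough {y z : H} {L : List (H × H)} (h : Linked M y L z)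
    (hL : IsProper vert L) (hyz : y ≠ z)
    (hzy : vert z = vert y) (hLy : ∀ l ∈ L, vert l.1 ≠ vert y) (A : V → Prop) [DecidablePred A]
    (hA : A (vert y)) : 1 ≤ cyclesThrough vert A M := by
  obtain ⟨U', -, hle⟩ := h.exists_le_cycleSum (J := fun _ _ => 1) (fun U => zero_le_one) hL hzy hLy
    (U := Finset.univ) (by simp)
  refine hle.trans ?_
  have hnn : ∀ m t, 0 ≤ cycleSum vert (fun _ _ => 1) M m t Finset.univ :=
    fun m t => cycleSum_nonneg (fun _ => zero_le_one) _ _ _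
  refine le_trans ?_ (Finset.single_le_sum (f := fun m => ∑ t ∈ transits vert Finset.univ with A (vert t.1),
    cycleSum vert (fun _ _ => 1) M m t Finset.univ) (fun m _ => Finset.sum_nonneg fun t _ => hnn m t)
    (Finset.mem_range.2 (Nat.lt_succ_of_le hL.length_le)))
  refine Finset.single_le_sum (f := fun t => cycleSum vert (fun _ _ => 1) M L.length t Finset.univ)
    (fun t _ => hnn _ t) ?_
  rw [Finset.mem_filter, mem_transits]
  exact ⟨⟨by simp, by simp, hyz.symm, hzy⟩, hzy ▸ hA⟩

/-- The vertex of the cycle nearest to `v` is taken as the root. If it has more than `Δ` half-edges,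
a cycle rooted there is already a rare event; otherwise the cycle through `v`, or the lollipop
ending at `v`, is counted. -/
theorem one_le_of_mem_fragVerts (hM : M ∈ perfectMatchings (Finset.univ : Finset H)) (Δ : ℕ)
    {v : V} (hv : v ∈ (matchingGraph vert M).fragVerts) :
    1 ≤ cyclesThrough vert (fun w => Δ < halfEdgeCount vert w) M ∨
      1 ≤ cyclesThrough vert (fun w => w = v) M + lollipopsTo vert Δ M v := by
  obtain ⟨L, y, z, hyz, hzy, hL, hLP, hvy, hvL, hcase⟩ :=
    exists_cycle_of_unicyclicComponent vert hM v hv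
  have hLy : ∀ l ∈ L, vert l.1 ≠ vert y := fun l hl => (hvL l hl).2
  rcases lt_or_ge Δ (halfEdgeCount vert (vert y)) with hd | hd
  · exact Or.inl (hL.one_le_cyclesThrough hLP hyz hzy hLy _ hd)
  right
  rcases hcase with rfl | ⟨x, L', b, hxy, hxy', hxz, hL', hLP', hb, hvy', hvL', hvL2⟩
  · have := hL.one_le_cyclesThrough hLP hyz hzy hLy (fun w => w = vert y) rfl
    linarith [lollipopsTo_nonneg (vert := vert) (M := M) Δ (vert y)]
  · suffices 1 ≤ lollipopsTo vert Δ M v by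
      linarith [cyclesThrough_nonneg (vert := vert) (M := M) (fun w => w = v)]
    have h1 : 1 ≤ lollipopSum vert v L.length L'.length (z, y) x M := by
      obtain ⟨a', U', h1, h2, h3⟩ := hL.exists_le_chainSum
        (K := closeAt z (tailSum vert v L'.length x) M)
        (fun a U => closeAt_nonneg (fun U => tailSum_nonneg _ _ _ _ _) a U) hLP
        (U := Finset.univ \ {z, y, x}) (by
        intro l hl
        have := hLy l hl
        have h2 := hLP.vert_eq l hl
        simp only [Finset.mem_sdiff, Finset.mem_univ, Finset.mem_insert, Finset.mem_singleton,
          true_and]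
        constructor
        · rintro (h | h | h)
          · exact this (by rw [h, hzy])
          · exact this (by rw [h])
          · exact this (by rw [h, hxy])
        · rintro (h | h | h)
          · exact this (by rw [h2, h, hzy])
          · exact this (by rw [h2, h])
          · exact this (by rw [h2, h, hxy]))
      rw [closeAt, if_pos h1] at h3
      refine le_trans ?_ h3
      have hU' : ∀ w, vert w ≠ vert y → (∀ l ∈ L, vert w ≠ vert l.1) → w ∈ U' := by
        intro w hw hwL
        refine h2 w ?_ hwL
        simp only [Finset.mem_sdiff, Finset.mem_univ, Finset.mem_insert, Finset.mem_singleton,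
          true_and]
        rintro (rfl | rfl | rfl)
        · exact hw hzy
        · exact hw rfl
        · exact hw hxy
      obtain ⟨a'', U'', h4, h5, h6⟩ := hL'.exists_le_chainSum
        (K := endsAt vert v M) (fun a U => endsAt_nonneg _ _ a U) hLP' (U := U') (by
          intro l hl
          have h7 := hvL2 l hl
          exact ⟨hU' _ h7.2.1 h7.2.2, hU' _ (hLP'.vert_eq l hl ▸ h7.2.1)
            (hLP'.vert_eq l hl ▸ h7.2.2)⟩)
      refine le_trans ?_ h6
      have hbU : b ∈ U'' := by
        refine h5 b (hU' b (hb ▸ hvy') fun l hl => hb ▸ (hvL' l hl).symm) fun l hl => ?_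
        exact hb ▸ (hvL2 l hl).1.symm
      refine le_trans ?_ (Finset.single_le_sum (f := fun b => if vert b = v then (1 : ℝ) else 0)
        (fun b _ => by split_ifs <;> norm_num) (Finset.mem_filter.2 ⟨hbU, h4⟩))
      simp [hb]
    refine h1.trans ?_
    refine Finset.le_sum_four _ _ _ _ (fun l m t x => lollipopSum vert v l m t x M)
      (fun l m t x => lollipopSum_nonneg v l m t x M)
      (Finset.mem_range.2 (Nat.lt_succ_of_le hLP.length_le))
      (Finset.mem_range.2 (Nat.lt_succ_of_le hLP'.length_le))
      (mem_transits.2 ⟨by simp, by simp, hyz.symm, hzy⟩) ?_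
    rw [Finset.mem_filter]
    exact ⟨by simp, ⟨hxy.trans hzy.symm, hxz, hxy'⟩, by rw [hzy]; exact hd⟩

theorem ncard_fragVerts_le (hM : M ∈ perfectMatchings (Finset.univ : Finset H)) (Δ : ℕ) :
    1 ≤ cyclesThrough vert (fun w => Δ < halfEdgeCount vert w) M ∨
      ((matchingGraph vert M).fragVerts.ncard : ℝ) ≤
        cyclesThrough vert (fun _ => True) M + ∑ v, lollipopsTo vert Δ M v := by
  classical
  by_cases h : 1 ≤ cyclesThrough vert (fun w => Δ < halfEdgeCount vert w) M
  · exact Or.inl h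
  right
  have h1 : cyclesThrough vert (fun _ => True) M = ∑ v, cyclesThrough vert (fun w => w = v) M := by
    simp only [cyclesThrough]
    symm
    rw [Finset.sum_comm]
    refine Finset.sum_congr rfl fun m _ => ?_
    simp only [Finset.sum_filter]
    rw [Finset.sum_comm]
    refine Finset.sum_congr rfl fun t _ => ?_
    simp
  rw [h1, ← Finset.sum_add_distrib, Set.ncard_eq_toFinset_card', Finset.card_eq_sum_ones,
    Nat.cast_sum]
  refine le_trans (Finset.sum_le_sum fun v hv => ?_)
    (Finset.sum_le_sum_of_subset_of_nonneg (Finset.subset_univ _) fun v _ _ =>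
      add_nonneg (cyclesThrough_nonneg _) (lollipopsTo_nonneg _ _))
  have := (one_le_of_mem_fragVerts hM Δ (Set.mem_toFinset.1 hv)).resolve_left h
  simpa using this

end Counts

/-! ### Uniform bounds for the size of the fragment and the number of its components -/

section Bounds

variable {H V : Type} [Fintype H] [DecidableEq H] [DecidableEq V] [Fintype V] {vert : H → V}
  {q : ℝ}

theorem sum_cyclesThrough_le (q0 : 0 ≤ q) (q1 : q < 1)
    (hq : Subcritical vert q Finset.univ) (A : V → Prop) [DecidablePred A] :
    ∑ M ∈ perfectMatchings (Finset.univ : Finset H), cyclesThrough vert A M ≤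
      (1 - q)⁻¹ * (((transits vert Finset.univ).filter fun t => A (vert t.1)).card *
        matchingCount (Fintype.card H - 2)) := by
  have := sum_cycleSum_transits_le q0 q1 zero_le_one (J := fun _ _ => 1) (fun _ _ _ _ _ _ => rfl)
    (fun U _ => by simp [card_perfectMatchings]) hq (Fintype.card V + 1) _
    (Finset.filter_subset (fun t => A (vert t.1)) _)
  simpa [cyclesThrough] using this

/-- Given the root transit there are at most `Δ` choices of the third half-edge `x`. Cycle length
and tail length each contribute a geometric series. -/
theorem sum_lollipopsTo_le (q0 : 0 ≤ q) (q1 : q < 1)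
    (hq : Subcritical vert q Finset.univ) (Δ : ℕ) :
    ∑ M ∈ perfectMatchings (Finset.univ : Finset H), ∑ v, lollipopsTo vert Δ M v ≤
      Δ * (1 - q)⁻¹ ^ 2 * matchingCount (Fintype.card H) := by
  have hq' : 0 ≤ (1 - q)⁻¹ := inv_nonneg.2 (by linarith)
  have h1 : ∀ M : Finset (Sym2 H), ∑ v, lollipopsTo vert Δ M v =
      ∑ l ∈ Finset.range (Fintype.card V + 1), ∑ m ∈ Finset.range (Fintype.card V + 1),
    ∑ t ∈ transits vert Finset.univ, ∑ x ∈ Finset.univ with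
      (vert x = vert t.1 ∧ x ≠ t.1 ∧ x ≠ t.2) ∧ halfEdgeCount vert (vert t.1) ≤ Δ,
      ∑ v, lollipopSum vert v l m t x M := by
    intro M
    simp only [lollipopsTo]
    rw [Finset.sum_comm]
    refine Finset.sum_congr rfl fun l _ => ?_
    rw [Finset.sum_comm]
    refine Finset.sum_congr rfl fun m _ => ?_
    rw [Finset.sum_comm]
    refine Finset.sum_congr rfl fun t _ => ?_
    rw [Finset.sum_comm]
  have h2 : ∀ l m, ∑ M ∈ perfectMatchings (Finset.univ : Finset H),
      ∑ t ∈ transits vert Finset.univ, ∑ x ∈ Finset.univ with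
      (vert x = vert t.1 ∧ x ≠ t.1 ∧ x ≠ t.2) ∧ halfEdgeCount vert (vert t.1) ≤ Δ,
      ∑ v, lollipopSum vert v l m t x M ≤ q ^ l * (q ^ m * (Δ * matchingCount (Fintype.card H))) := by
    intro l m
    rw [Finset.sum_comm]
    have h3 : ∀ t ∈ transits vert (Finset.univ : Finset H),
        ∑ M ∈ perfectMatchings (Finset.univ : Finset H), ∑ x ∈ Finset.univ with
          (vert x = vert t.1 ∧ x ≠ t.1 ∧ x ≠ t.2) ∧ halfEdgeCount vert (vert t.1) ≤ Δ,
          ∑ v, lollipopSum vert v l m t x M ≤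
          Δ * (q ^ l * q ^ m * matchingCount (Fintype.card H - 2)) := by
      intro t ht
      rw [Finset.sum_comm]
      refine (Finset.sum_le_sum fun x hx => sum_lollipopSum_le q0 q1.le hq l m ht
        (Finset.mem_filter.1 hx).2.1.1 (Finset.mem_filter.1 hx).2.1.2.1
        (Finset.mem_filter.1 hx).2.1.2.2).trans ?_
      rw [Finset.sum_const, nsmul_eq_mul]
      refine mul_le_mul_of_nonneg_right ?_ (by positivity)
      rw [Nat.cast_le]
      by_cases hd : halfEdgeCount vert (vert t.1) ≤ Δ
      · refine (Finset.card_le_card fun x hx => ?_).trans hd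
        rw [Finset.mem_filter] at hx ⊢
        exact ⟨hx.1, hx.2.1.1⟩
      · simp [hd]
    refine (Finset.sum_le_sum h3).trans ?_
    rw [Finset.sum_const, nsmul_eq_mul]
    have h4 := hq.card_mul_le q0
    rw [Finset.card_univ] at h4
    have h5 : q * (matchingCount (Fintype.card H) : ℝ) ≤ matchingCount (Fintype.card H) :=
      mul_le_of_le_one_left (by positivity) q1.le
    calc ((transits vert (Finset.univ : Finset H)).card : ℝ) *
          (Δ * (q ^ l * q ^ m * matchingCount (Fintype.card H - 2)))
        = (q ^ l * q ^ m * Δ) * (((transits vert (Finset.univ : Finset H)).card : ℝ) *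
          matchingCount (Fintype.card H - 2)) := by ring
      _ ≤ (q ^ l * q ^ m * Δ) * matchingCount (Fintype.card H) :=
          mul_le_mul_of_nonneg_left (h4.trans h5) (by positivity)
      _ = _ := by ring
  simp only [h1]
  rw [Finset.sum_comm]
  have h6 : ∀ l, ∑ M ∈ perfectMatchings (Finset.univ : Finset H),
      ∑ m ∈ Finset.range (Fintype.card V + 1),
      ∑ t ∈ transits vert Finset.univ, ∑ x ∈ Finset.univ with
      (vert x = vert t.1 ∧ x ≠ t.1 ∧ x ≠ t.2) ∧ halfEdgeCount vert (vert t.1) ≤ Δ,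
      ∑ v, lollipopSum vert v l m t x M ≤
        q ^ l * ((1 - q)⁻¹ * (Δ * matchingCount (Fintype.card H))) := by
    intro l
    rw [Finset.sum_comm]
    refine (Finset.sum_le_sum fun m _ => h2 l m).trans ?_
    rw [← Finset.mul_sum, ← Finset.sum_mul]
    exact mul_le_mul_of_nonneg_left (mul_le_mul_of_nonneg_right (geom_sum_le_inv q0 q1 _)
      (by positivity)) (by positivity)
  refine (Finset.sum_le_sum fun l _ => h6 l).trans ?_
  rw [← Finset.sum_mul]
  refine (mul_le_mul_of_nonneg_right (geom_sum_le_inv q0 q1 _) (by positivity)).trans ?_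
  apply le_of_eq
  ring

open Classical in
-- Markov's inequality, applied to the cycles rooted at vertices of degree above `Δ` and, with
-- threshold `K`, to the cycles and lollipops that cover the fragment when there are no such cycles.
theorem card_lt_ncard_fragVerts_le (q0 : 0 ≤ q) (q1 : q < 1)
    (hq : Subcritical vert q Finset.univ) (Δ K : ℕ) (hK : 0 < K) :
    (((perfectMatchings (Finset.univ : Finset H)).filter fun M =>
      K < (matchingGraph vert M).fragVerts.ncard).card : ℝ) ≤
      (1 - q)⁻¹ * (((transits vert Finset.univ).filter
        fun t => Δ < halfEdgeCount vert (vert t.1)).card * matchingCount (Fintype.card H - 2)) +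
      ((1 - q)⁻¹ + Δ * (1 - q)⁻¹ ^ 2) / K * matchingCount (Fintype.card H) := by
  have hK' : (0 : ℝ) < K := by exact_mod_cast hK
  have h1 : ∀ M ∈ perfectMatchings (Finset.univ : Finset H),
      (if K < (matchingGraph vert M).fragVerts.ncard then (1 : ℝ) else 0) ≤
        cyclesThrough vert (fun w => Δ < halfEdgeCount vert w) M +
        (cyclesThrough vert (fun _ => True) M + ∑ v, lollipopsTo vert Δ M v) / K := by
    intro M hM
    have n1 := cyclesThrough_nonneg (vert := vert) (M := M) (fun w => Δ < halfEdgeCount vert w)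
    have n2 : 0 ≤ (cyclesThrough vert (fun _ => True) M + ∑ v, lollipopsTo vert Δ M v) / K :=
      div_nonneg (add_nonneg (cyclesThrough_nonneg _)
        (Finset.sum_nonneg fun v _ => lollipopsTo_nonneg _ _)) hK'.le
    split_ifs with hlt
    · rcases ncard_fragVerts_le (vert := vert) hM Δ with h | h
      · linarith
      · have h2 : (K : ℝ) ≤ ((matchingGraph vert M).fragVerts.ncard : ℝ) := by exact_mod_cast hlt.le
        have := (one_le_div hK').2 (h2.trans h)
        linarith
    · linarith
  rw [Finset.card_filter, Nat.cast_sum]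
  push_cast
  refine (Finset.sum_le_sum h1).trans ?_
  rw [Finset.sum_add_distrib, ← Finset.sum_div, Finset.sum_add_distrib]
  refine add_le_add (sum_cyclesThrough_le q0 q1 hq _) ?_
  rw [div_mul_eq_mul_div]
  refine div_le_div_of_nonneg_right ?_ hK'.le
  rw [add_mul]
  refine add_le_add ?_ (sum_lollipopsTo_le q0 q1 hq Δ)
  refine (sum_cyclesThrough_le q0 q1 hq _).trans ?_
  refine mul_le_mul_of_nonneg_left ?_ (inv_nonneg.2 (by linarith))
  rw [Finset.filter_true]
  have h4 := hq.card_mul_le q0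
  rw [Finset.card_univ] at h4
  exact h4.trans (mul_le_of_le_one_left (by positivity) q1.le)

/-- The base is the square of the `3` in the truncation error. Expanding `(8 + 1) ^ X` gives the
factorial moments with coefficients `8 ^ r / r!`; each moment is at most `(1 - q)⁻¹ ^ r`, and the
exponential series bounds the sum. -/
theorem sum_nine_pow_le (q0 : 0 ≤ q) (q1 : q < 1) (hq : Subcritical vert q Finset.univ) :
    ∑ M ∈ perfectMatchings (Finset.univ : Finset H),
      (9 : ℝ) ^ (matchingGraph vert M).unicyclicComponents.card ≤
      Real.exp (8 * (1 - q)⁻¹) * matchingCount (Fintype.card H) := by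
  have hq' : 0 ≤ (1 - q)⁻¹ := inv_nonneg.2 (by linarith)
  have h1 : ∀ M ∈ perfectMatchings (Finset.univ : Finset H),
      (9 : ℝ) ^ (matchingGraph vert M).unicyclicComponents.card ≤
      ∑ r ∈ Finset.range (Fintype.card V + 1), 8 ^ r / (r.factorial : ℝ) *
        cycleTuples vert (Fintype.card V + 1) r M Finset.univ := by
    intro M hM
    have hX : (matchingGraph vert M).unicyclicComponents.card ≤ Fintype.card V := by
      refine (Finset.card_le_univ _).trans ?_
      exact Fintype.card_le_of_surjective (matchingGraph vert M).underlying.connectedComponentMk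
        Quot.mk_surjective
    set X := (matchingGraph vert M).unicyclicComponents.card with hXdef
    have h9 : (9 : ℝ) ^ X = ∑ r ∈ Finset.range (X + 1), 8 ^ r / (r.factorial : ℝ) *
        (X.descFactorial r : ℝ) := by
      rw [show (9 : ℝ) = 8 + 1 by norm_num, add_pow]
      refine Finset.sum_congr rfl fun r _ => ?_
      rw [Nat.descFactorial_eq_factorial_mul_choose]
      push_cast
      have : (r.factorial : ℝ) ≠ 0 := by positivity
      field_simp
      ring
    rw [h9]
    refine (Finset.sum_le_sum_of_subset_of_nonneg (Finset.range_subset_range.2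
      (Nat.add_le_add_right hX 1)) fun _ _ _ => by positivity).trans ?_
    refine Finset.sum_le_sum fun r _ => mul_le_mul_of_nonneg_left ?_ (by positivity)
    exact descFactorial_le_cycleTuples hM rfl r _ subset_rfl Finset.univ (by simp)
  refine (Finset.sum_le_sum h1).trans ?_
  rw [Finset.sum_comm]
  have h2 : ∀ r, ∑ M ∈ perfectMatchings (Finset.univ : Finset H), 8 ^ r / (r.factorial : ℝ) *
        cycleTuples vert (Fintype.card V + 1) r M Finset.univ ≤
      (8 * (1 - q)⁻¹) ^ r / r.factorial * matchingCount (Fintype.card H) := by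
    intro r
    rw [← Finset.mul_sum]
    refine (mul_le_mul_of_nonneg_left (sum_cycleTuples_le q0 q1 _ r hq) (by positivity)).trans ?_
    rw [Finset.card_univ, mul_pow]
    apply le_of_eq
    ring
  refine (Finset.sum_le_sum fun r _ => h2 r).trans ?_
  rw [← Finset.sum_mul]
  refine mul_le_mul_of_nonneg_right (Real.sum_le_exp_of_nonneg (by positivity) _) (by positivity)

end Bounds

/-! ### Matchings that contain a prescribed matching of a part -/

section Restrict

variable {α : Type} [Fintype α] [DecidableEq α]

theorem two_mul_card_of_mem_perfectMatchings {S : Finset α} {M : Finset (Sym2 α)}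
    (hM : M ∈ perfectMatchings S) : 2 * M.card = S.card := by
  induction hn : M.card generalizing S M with
  | zero =>
    rw [Finset.card_eq_zero] at hn
    subst hn
    rw [mul_zero, eq_comm, Finset.card_eq_zero, Finset.eq_empty_iff_forall_notMem]
    intro x hx
    obtain ⟨b, hb⟩ := perfectMatchings.exists_partner hM hx
    simp at hb
  | succ m ih =>
    obtain ⟨p, hp⟩ : M.Nonempty := Finset.card_pos.1 (by omega)
    induction p with | _ a b
    have h1 := ih (perfectMatchings_erase hM hp) (by rw [Finset.card_erase_of_mem hp, hn]; rfl)
    have hab := perfectMatchings.ne hM hp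
    have hsub : ({a, b} : Finset α) ⊆ S := by
      intro x; simp only [Finset.mem_insert, Finset.mem_singleton]
      rintro (rfl | rfl)
      · exact perfectMatchings.mem_left hM hp
      · exact perfectMatchings.mem_right hM hp
    have h2 := Finset.card_le_card hsub
    rw [Finset.card_sdiff_of_subset hsub, Finset.card_pair hab] at h1
    rw [Finset.card_pair hab] at h2
    omega

theorem exists_mem_sym2 {β : Type} (e : Sym2 β) : ∃ x, x ∈ e := by
  induction e with | _ a b
  exact ⟨a, by simp⟩

theorem perfectMatchings_sdiff {S S' : Finset α} {M P : Finset (Sym2 α)}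
    (hP : P ∈ perfectMatchings S') (hM : M ∈ perfectMatchings S) (hPM : P ⊆ M) :
    M \ P ∈ perfectMatchings (S \ S') := by
  rw [mem_perfectMatchings]
  constructor
  · intro e he
    rw [Finset.mem_sdiff] at he
    refine ⟨((mem_perfectMatchings.1 hM).1 e he.1).1, fun x hx => ?_⟩
    rw [Finset.mem_sdiff]
    refine ⟨((mem_perfectMatchings.1 hM).1 e he.1).2 x hx, fun hxS => ?_⟩
    obtain ⟨b, hb⟩ := perfectMatchings.exists_partner hP hxS
    have := perfectMatchings.eq_of_mem hM he.1 (hPM hb) hx (by simp)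
    exact he.2 (this ▸ hb)
  · intro x hx
    rw [Finset.mem_sdiff] at hx
    obtain ⟨e, ⟨he, hxe⟩, hu⟩ := (mem_perfectMatchings.1 hM).2 x hx.1
    refine ⟨e, ⟨Finset.mem_sdiff.2 ⟨he, fun heP => hx.2 ?_⟩, hxe⟩, fun f hf =>
      hu f ⟨(Finset.mem_sdiff.1 hf.1).1, hf.2⟩⟩
    exact ((mem_perfectMatchings.1 hP).1 e heP).2 x hxe

theorem perfectMatchings_union {S S' : Finset α} {M P : Finset (Sym2 α)} (hS : S' ⊆ S)
    (hP : P ∈ perfectMatchings S') (hM : M ∈ perfectMatchings (S \ S')) :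
    M ∪ P ∈ perfectMatchings S ∧ Disjoint M P := by
  have key : ∀ e ∈ M, ∀ f ∈ P, ∀ x ∈ e, x ∉ f := fun e he f hf x hxe hxf => by
    have h1 := ((mem_perfectMatchings.1 hM).1 e he).2 x hxe
    have h2 := ((mem_perfectMatchings.1 hP).1 f hf).2 x hxf
    rw [Finset.mem_sdiff] at h1
    exact h1.2 h2
  constructor
  · rw [mem_perfectMatchings]
    constructor
    · intro e he
      rcases Finset.mem_union.1 he with he | he
      · have := (mem_perfectMatchings.1 hM).1 e he
        exact ⟨this.1, fun x hx => (Finset.mem_sdiff.1 (this.2 x hx)).1⟩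
      · have := (mem_perfectMatchings.1 hP).1 e he
        exact ⟨this.1, fun x hx => hS (this.2 x hx)⟩
    · intro x hx
      by_cases hxS : x ∈ S'
      · obtain ⟨e, ⟨he, hxe⟩, hu⟩ := (mem_perfectMatchings.1 hP).2 x hxS
        refine ⟨e, ⟨Finset.mem_union_right _ he, hxe⟩, ?_⟩
        rintro f ⟨hf, hxf⟩
        rcases Finset.mem_union.1 hf with hf | hf
        · exact absurd hxe (key f hf e he x hxf)
        · exact hu f ⟨hf, hxf⟩
      · obtain ⟨e, ⟨he, hxe⟩, hu⟩ := (mem_perfectMatchings.1 hM).2 x (Finset.mem_sdiff.2 ⟨hx, hxS⟩)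
        refine ⟨e, ⟨Finset.mem_union_left _ he, hxe⟩, ?_⟩
        rintro f ⟨hf, hxf⟩
        rcases Finset.mem_union.1 hf with hf | hf
        · exact hu f ⟨hf, hxf⟩
        · exact absurd hxf (key e he f hf x hxe)
  · rw [Finset.disjoint_left]
    intro e he heP
    obtain ⟨x, hx⟩ := exists_mem_sym2 e
    exact key e he e heP x hx hx

theorem card_perfectMatchings_superset {S S' : Finset α} {P : Finset (Sym2 α)} (hS : S' ⊆ S)
    (hP : P ∈ perfectMatchings S') :
    ((perfectMatchings S).filter fun M => P ⊆ M).card = matchingCount (S.card - S'.card) := by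
  rw [← Finset.card_sdiff_of_subset hS, ← card_perfectMatchings]
  refine Finset.card_bij' (fun M _ => M \ P) (fun M _ => M ∪ P) ?_ ?_ ?_ ?_
  · intro M hM
    rw [Finset.mem_filter] at hM
    exact perfectMatchings_sdiff hP hM.1 hM.2
  · intro M hM
    exact Finset.mem_filter.2 ⟨(perfectMatchings_union hS hP hM).1, Finset.subset_union_right⟩
  · intro M hM
    exact Finset.sdiff_union_of_subset (Finset.mem_filter.1 hM).2
  · intro M hM
    exact Finset.union_sdiff_cancel_right (perfectMatchings_union hS hP hM).2

variable {β : Type} [Fintype β] [DecidableEq β]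

theorem perfectMatchings_image (ι : β ↪ α) {M : Finset (Sym2 β)}
    (hM : M ∈ perfectMatchings (Finset.univ : Finset β)) :
    M.image (Sym2.map ι) ∈ perfectMatchings (Finset.univ.map ι) := by
  rw [mem_perfectMatchings]
  constructor
  · intro e he
    obtain ⟨f, hf, rfl⟩ := Finset.mem_image.1 he
    have := (mem_perfectMatchings.1 hM).1 f hf
    refine ⟨by rw [Sym2.isDiag_map ι.injective]; exact this.1, fun x hx => ?_⟩
    obtain ⟨y, -, rfl⟩ := Sym2.mem_map.1 hx
    simp
  · intro x hx
    obtain ⟨y, -, rfl⟩ := Finset.mem_map.1 hx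
    obtain ⟨e, ⟨he, hye⟩, hu⟩ := (mem_perfectMatchings.1 hM).2 y (Finset.mem_univ y)
    refine ⟨e.map ι, ⟨Finset.mem_image_of_mem _ he, Sym2.mem_map.2 ⟨y, hye, rfl⟩⟩, ?_⟩
    rintro f ⟨hf, hyf⟩
    obtain ⟨g, hg, rfl⟩ := Finset.mem_image.1 hf
    obtain ⟨z, hz, hzy⟩ := Sym2.mem_map.1 hyf
    rw [ι.injective hzy] at hz
    rw [hu g ⟨hg, hz⟩]

variable {V W : Type} [Fintype V] [Fintype W] [DecidableEq V] [DecidableEq W]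

/-- The pairs of `M` that come from pairs of `β`. -/
def restrictMatching (ι : β ↪ α) (M : Finset (Sym2 α)) : Finset (Sym2 β) :=
  Finset.univ.filter fun p => p.map ι ∈ M

theorem mult_matchingGraph_ne_zero {vert : α → V} {M : Finset (Sym2 α)} {e : Sym2 V} :
    (matchingGraph vert M).mult e ≠ 0 ↔ ∃ p ∈ M, p.map vert = e := by
  simp only [matchingGraph, Finset.card_ne_zero, Finset.Nonempty, Finset.mem_filter]

theorem closedRange_matchingGraph_iff {vert : α → V} {M : Finset (Sym2 α)} {φ : W → V} :
    (matchingGraph vert M).ClosedRange φ ↔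
      ∀ x y, s(x, y) ∈ M → vert x ∈ Set.range φ → vert y ∈ Set.range φ := by
  constructor
  · rintro h x y hxy ⟨i, hi⟩
    by_contra hy
    refine mult_matchingGraph_ne_zero.2 ⟨s(x, y), hxy, ?_⟩ (h i _ hy)
    rw [Sym2.map_mk, hi]
  · intro h i v hv
    by_contra hm
    obtain ⟨p, hp, hpe⟩ := mult_matchingGraph_ne_zero.1 hm
    have h1 : φ i ∈ p.map vert := by rw [hpe]; simp
    obtain ⟨x, hx, hxi⟩ := Sym2.mem_map.1 h1
    obtain ⟨y, rfl⟩ := hx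
    rw [Sym2.map_mk, hxi] at hpe
    have : vert y = v := Sym2.congr_right.1 hpe
    exact hv (this ▸ h x y hp ⟨i, hxi.symm⟩)

variable {vert : α → V} {vert' : β → W} {ι : β ↪ α} {φ : W ↪ V}

theorem restrictMatching_mem {M : Finset (Sym2 α)}
    (hι : ∀ x, vert (ι x) = φ (vert' x)) (hr : ∀ x, vert x ∈ Set.range φ → x ∈ Set.range ι)
    (hM : M ∈ perfectMatchings (Finset.univ : Finset α))
    (hc : (matchingGraph vert M).ClosedRange φ) :
    restrictMatching ι M ∈ perfectMatchings (Finset.univ : Finset β) := by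
  rw [closedRange_matchingGraph_iff] at hc
  rw [mem_perfectMatchings]
  constructor
  · intro e he
    refine ⟨fun hd => ?_, fun x _ => Finset.mem_univ x⟩
    have := ((mem_perfectMatchings.1 hM).1 _ (Finset.mem_filter.1 he).2).1
    rw [Sym2.isDiag_map ι.injective] at this
    exact this hd
  · intro x _
    obtain ⟨b, hb⟩ := perfectMatchings.exists_partner hM (Finset.mem_univ (ι x))
    obtain ⟨y, rfl⟩ := hr b (hc _ _ hb ⟨vert' x, (hι x).symm⟩)
    refine ⟨s(x, y), ⟨Finset.mem_filter.2 ⟨Finset.mem_univ _, by rwa [Sym2.map_mk]⟩, by simp⟩, ?_⟩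
    rintro f ⟨hf, hxf⟩
    have hf' := (Finset.mem_filter.1 hf).2
    apply Sym2.map.injective ι.injective
    exact perfectMatchings.eq_of_mem hM hf' hb (Sym2.mem_map.2 ⟨x, hxf, rfl⟩) (by simp)

theorem pullback_matchingGraph {M : Finset (Sym2 α)}
    (hι : ∀ x, vert (ι x) = φ (vert' x)) (hr : ∀ x, vert x ∈ Set.range φ → x ∈ Set.range ι) :
    (matchingGraph vert M).pullback φ = matchingGraph vert' (restrictMatching ι M) := by
  have hmap : ∀ p : Sym2 β, (p.map ι).map vert = (p.map vert').map φ := fun p => by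
    rw [Sym2.map_map, Sym2.map_map]
    congr 1
    ext x
    exact hι x
  ext e
  simp only [Multigraph.pullback, matchingGraph]
  symm
  refine Finset.card_bij (fun p _ => p.map ι) ?_ ?_ ?_
  · intro p hp
    rw [Finset.mem_filter, restrictMatching, Finset.mem_filter] at hp
    rw [Finset.mem_filter, hmap, hp.2]
    exact ⟨hp.1.2, rfl⟩
  · intro p _ p' _ h
    exact Sym2.map.injective ι.injective h
  · intro p hp
    rw [Finset.mem_filter] at hp
    have : ∀ x ∈ p, x ∈ Set.range ι := fun x hx => hr x (by
      have h1 : vert x ∈ e.map φ := hp.2 ▸ Sym2.mem_map.2 ⟨x, hx, rfl⟩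
      obtain ⟨i, -, hi⟩ := Sym2.mem_map.1 h1
      exact ⟨i, hi⟩)
    obtain ⟨p', rfl⟩ : ∃ p' : Sym2 β, p'.map ι = p := by
      induction p with | _ a b
      obtain ⟨a', rfl⟩ := this a (by simp)
      obtain ⟨b', rfl⟩ := this b (by simp)
      exact ⟨s(a', b'), rfl⟩
    refine ⟨p', ?_, rfl⟩
    rw [Finset.mem_filter, restrictMatching, Finset.mem_filter]
    refine ⟨⟨Finset.mem_univ _, hp.1⟩, ?_⟩
    rw [hmap] at hp
    exact Sym2.map.injective φ.injective hp.2

/-- A perfect matching of the half-edges at the range of `φ` uses them all, so containing it leaves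
no edge out of the range and determines the restriction. -/
theorem image_subset_iff_restrictMatching {M : Finset (Sym2 α)} {M' : Finset (Sym2 β)}
    (hι : ∀ x, vert (ι x) = φ (vert' x)) (hr : ∀ x, vert x ∈ Set.range φ → x ∈ Set.range ι)
    (hM : M ∈ perfectMatchings (Finset.univ : Finset α))
    (hM' : M' ∈ perfectMatchings (Finset.univ : Finset β)) :
    M'.image (Sym2.map ι) ⊆ M ↔
      (matchingGraph vert M).ClosedRange φ ∧ restrictMatching ι M = M' := by
  constructor
  · intro h
    refine ⟨closedRange_matchingGraph_iff.2 fun x y hxy hx => ?_, ?_⟩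
    · obtain ⟨x, rfl⟩ := hr x hx
      obtain ⟨z, hz⟩ := perfectMatchings.exists_partner hM' (Finset.mem_univ x)
      have h1 : s(ι x, ι z) ∈ M := h (Finset.mem_image.2 ⟨_, hz, rfl⟩)
      rw [perfectMatchings.partner_unique hM hxy h1, hι]
      exact ⟨_, rfl⟩
    · ext p
      rw [restrictMatching, Finset.mem_filter]
      constructor
      · rintro ⟨-, hp⟩
        obtain ⟨x, hx⟩ := exists_mem_sym2 p
        obtain ⟨z, hz⟩ := perfectMatchings.exists_partner hM' (Finset.mem_univ x)
        have h1 : Sym2.map ι s(x, z) ∈ M := h (Finset.mem_image.2 ⟨_, hz, rfl⟩)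
        have h2 := perfectMatchings.eq_of_mem hM hp h1 (Sym2.mem_map.2 ⟨x, hx, rfl⟩)
          (Sym2.mem_map.2 ⟨x, by simp, rfl⟩)
        rw [Sym2.map.injective ι.injective h2]
        exact hz
      · exact fun hp => ⟨Finset.mem_univ _, h (Finset.mem_image_of_mem _ hp)⟩
  · rintro ⟨-, rfl⟩ e he
    obtain ⟨p, hp, rfl⟩ := Finset.mem_image.1 he
    exact (Finset.mem_filter.1 hp).2

open Classical in
-- Given that the range is closed, the matching splits into a matching of the half-edges at the
-- range and an arbitrary matching of the others, and the summand depends only on the first.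
theorem sum_closedRange (hι : ∀ x, vert (ι x) = φ (vert' x))
    (hr : ∀ x, vert x ∈ Set.range φ → x ∈ Set.range ι) (h : Multigraph W → ℝ) :
    ∑ M ∈ perfectMatchings (Finset.univ : Finset α),
      (if (matchingGraph vert M).ClosedRange φ then h ((matchingGraph vert M).pullback φ) else 0) =
      (∑ M' ∈ perfectMatchings (Finset.univ : Finset β), h (matchingGraph vert' M')) *
        matchingCount (Fintype.card α - Fintype.card β) := by
  have h1 : ∀ M ∈ perfectMatchings (Finset.univ : Finset α),
      (if (matchingGraph vert M).ClosedRange φ then h ((matchingGraph vert M).pullback φ) else 0) =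
      ∑ M' ∈ perfectMatchings (Finset.univ : Finset β),
        if M'.image (Sym2.map ι) ⊆ M then h (matchingGraph vert' M') else 0 := by
    intro M hM
    have h2 : ∀ M' ∈ perfectMatchings (Finset.univ : Finset β),
        (if M'.image (Sym2.map ι) ⊆ M then h (matchingGraph vert' M') else 0) =
        if restrictMatching ι M = M' then
          (if (matchingGraph vert M).ClosedRange φ then h (matchingGraph vert' M') else 0)
          else 0 := by
      intro M' hM'
      simp only [image_subset_iff_restrictMatching hι hr hM hM']
      by_cases h1 : (matchingGraph vert M).ClosedRange φ <;>
        by_cases h2 : restrictMatching ι M = M' <;> simp [h1, h2]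
    rw [Finset.sum_congr rfl h2, Finset.sum_ite_eq]
    by_cases hc : (matchingGraph vert M).ClosedRange φ
    · rw [if_pos hc, if_pos (restrictMatching_mem hι hr hM hc), if_pos hc,
        pullback_matchingGraph hι hr]
    · simp [hc]
  rw [Finset.sum_congr rfl h1, Finset.sum_comm, Finset.sum_mul]
  refine Finset.sum_congr rfl fun M' hM' => ?_
  have h3 := card_perfectMatchings_superset (Finset.subset_univ _) (perfectMatchings_image ι hM')
  rw [Finset.card_map, Finset.card_univ, Finset.card_univ] at h3
  rw [← h3, ← Finset.sum_filter, Finset.sum_const, nsmul_eq_mul, mul_comm]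

theorem edgeCount_matchingGraph (vert : α → V) (M : Finset (Sym2 α)) :
    (matchingGraph vert M).edgeCount = M.card := by
  have := edgeCount_pullback_matchingGraph vert M (φ := (id : V → V)) Function.injective_id
  have h2 : (matchingGraph vert M).pullback (id : V → V) = matchingGraph vert M := by
    ext e; simp [Multigraph.pullback]
  rw [h2] at this
  rw [this]
  congr 1
  exact Finset.filter_true_of_mem fun p _ x _ => by simp

end Restrict

/-! ### Exact expectations in the configuration model -/

namespace ConfigurationModel

section Finite

variable {n : ℕ} (d : Fin n → ℕ)

theorem coe_perfectMatchings_univ :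
    ((perfectMatchings (Finset.univ : Finset (HalfEdge d)) : Finset _) : Set _) = matchings d := by
  ext M
  rw [Finset.mem_coe, mem_perfectMatchings]
  simp [matchings]

theorem card_halfEdge : Fintype.card (HalfEdge d) = ∑ v, d v := by
  simp [HalfEdge]

open Classical in
theorem prob_eq (P : Multigraph (Fin n) → Prop) :
    prob d P = (∑ M ∈ perfectMatchings (Finset.univ : Finset (HalfEdge d)),
      if P (matchingGraph Sigma.fst M) then (1 : ℝ) else 0) / matchingCount (∑ v, d v) := by
  unfold prob
  congr 1
  · have : {M | M ∈ matchings d ∧ P (toMultigraph M)} =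
        (((perfectMatchings (Finset.univ : Finset (HalfEdge d))).filter fun M =>
          P (matchingGraph Sigma.fst M) : Finset _) : Set _) := by
      ext M
      rw [Finset.coe_filter, ← coe_perfectMatchings_univ]
      rfl
    rw [this, Set.ncard_coe_finset, Finset.card_filter]
    push_cast
    rfl
  · rw [← coe_perfectMatchings_univ, Set.ncard_coe_finset, card_perfectMatchings, Finset.card_univ,
      card_halfEdge]

theorem halfEdgeCount_fst (v : Fin n) :
    halfEdgeCount (Sigma.fst : HalfEdge d → Fin n) v = d v := by
  unfold halfEdgeCount
  have : (Finset.univ.filter fun x : HalfEdge d => x.1 = v) =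
      Finset.univ.map ⟨Sigma.mk v, sigma_mk_injective⟩ := by
    ext ⟨w, j⟩
    simp only [Finset.mem_filter, Finset.mem_univ, true_and, Finset.mem_map,
      Function.Embedding.coeFn_mk]
    constructor
    · rintro rfl
      exact ⟨j, rfl⟩
    · rintro ⟨i, hi⟩
      exact (congrArg Sigma.fst hi).symm
  rw [this, Finset.card_map, Finset.card_univ, Fintype.card_fin]

theorem card_transits_filter (A : Fin n → Prop) [DecidablePred A] :
    ((transits (Sigma.fst : HalfEdge d → Fin n) Finset.univ).filter fun t => A t.1.1).card =
      ∑ v with A v, d v * (d v - 1) := by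
  rw [Finset.card_eq_sum_card_fiberwise (f := fun t => t.1.1) (t := Finset.univ.filter A)
    (by intro t ht; simpa using (Finset.mem_filter.1 ht).2)]
  refine Finset.sum_congr rfl fun v hv => ?_
  have : (((transits (Sigma.fst : HalfEdge d → Fin n) Finset.univ).filter fun t => A t.1.1).filter
      fun t => t.1.1 = v) = (Finset.univ.filter fun x : HalfEdge d => x.1 = v).offDiag := by
    ext t
    rw [Finset.mem_filter, Finset.mem_filter, mem_transits, Finset.mem_offDiag]
    simp only [Finset.mem_filter, Finset.mem_univ, true_and] at hv ⊢
    constructor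
    · rintro ⟨⟨⟨h1, h2⟩, h3⟩, h4⟩
      exact ⟨h4, h2 ▸ h4, h1⟩
    · rintro ⟨h1, h2, h3⟩
      exact ⟨⟨⟨h3, h1.trans h2.symm⟩, h1 ▸ hv⟩, h1⟩
  rw [this, Finset.offDiag_card]
  have h := halfEdgeCount_fst d v
  unfold halfEdgeCount at h
  rw [h, Nat.mul_sub, mul_one]

theorem even_sum_of_feasible (h : Feasible d) : Even (∑ v, d v) := by
  classical
  obtain ⟨G, hG⟩ := h
  have : ∑ v, d v = ∑ v, G.degree v := by
    refine Finset.sum_congr rfl fun v _ => ?_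
    rw [← hG v, Set.ncard_eq_toFinset_card']
    rfl
  rw [this, G.sum_degrees_eq_twice_card_edges]
  exact even_two_mul _

/-- The embeddings of `Fin k` along which the degrees are `δ`. -/
noncomputable def embeddingsOfDegrees {k : ℕ} (δ : Fin k → ℕ) : Finset (Fin k ↪ Fin n) :=
  Finset.univ.filter fun φ => d ∘ φ = δ

/-- The sum of `h` over the multigraphs of the perfect matchings. -/
noncomputable def matchingSum {k : ℕ} (h : Multigraph (Fin k) → ℝ) (δ : Fin k → ℕ) : ℝ :=
  ∑ M ∈ perfectMatchings (Finset.univ : Finset (HalfEdge δ)), h (matchingGraph Sigma.fst M)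

/-- A matching with `k` pairs uses `2k` half-edges. This restricts the sum over degree vectors to a
finite set that does not depend on `n`. -/
theorem matchingSum_eq_zero {k : ℕ} {h : Multigraph (Fin k) → ℝ}
    (hh : ∀ G, h G ≠ 0 → G.edgeCount = k) {δ : Fin k → ℕ} (hδ : ∑ i, δ i ≠ 2 * k) :
    matchingSum h δ = 0 := by
  refine Finset.sum_eq_zero fun M hM => ?_
  by_contra hne
  have h1 := hh _ hne
  rw [edgeCount_matchingGraph] at h1
  have h2 := two_mul_card_of_mem_perfectMatchings hM
  rw [Finset.card_univ, card_halfEdge, h1] at h2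
  exact hδ h2.symm

open Classical in
-- For each embedding the contribution depends only on the degrees along it, so embeddings are
-- grouped by their degree vector. All of the dependence on `d` is then in the number of embeddings
-- and in one matching count.
theorem sum_closedRange_eq {k : ℕ} {h : Multigraph (Fin k) → ℝ}
    (hh : ∀ G, h G ≠ 0 → G.edgeCount = k) :
    ∑ M ∈ perfectMatchings (Finset.univ : Finset (HalfEdge d)), ∑ φ : Fin k ↪ Fin n,
      (if (matchingGraph Sigma.fst M).ClosedRange φ then
        h ((matchingGraph Sigma.fst M).pullback φ) else 0) =
      ∑ δ ∈ (Fintype.piFinset fun _ : Fin k => Finset.range (2 * k + 1)) with ∑ i, δ i = 2 * k,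
        matchingSum h δ * ((embeddingsOfDegrees d δ).card *
          matchingCount (∑ v, d v - 2 * k)) := by
  rw [Finset.sum_comm]
  have h1 : ∀ φ : Fin k ↪ Fin n, ∑ M ∈ perfectMatchings (Finset.univ : Finset (HalfEdge d)),
      (if (matchingGraph Sigma.fst M).ClosedRange φ then
        h ((matchingGraph Sigma.fst M).pullback φ) else 0) =
      matchingSum h (d ∘ φ) * matchingCount (∑ v, d v - 2 * k) := by
    intro φ
    let ι : HalfEdge (d ∘ φ) ↪ HalfEdge d :=
      ⟨Sigma.map φ fun _ => id, φ.injective.sigma_map fun _ => Function.injective_id⟩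
    rw [sum_closedRange (ι := ι) (vert' := Sigma.fst) (fun x => rfl) (by
      rintro ⟨v, j⟩ ⟨i, hi⟩
      dsimp only at hi
      subst hi
      exact ⟨⟨i, j⟩, rfl⟩) h, card_halfEdge, card_halfEdge]
    -- When the sum of degrees is not `2k` the two matching counts may differ, but both sides have a
    -- vanishing factor.
    by_cases hs : ∑ i, (d ∘ φ) i = 2 * k
    · rw [hs]; rfl
    · have : matchingSum h (d ∘ φ) = 0 := matchingSum_eq_zero hh hs
      rw [this, zero_mul]
      unfold matchingSum at this
      rw [this, zero_mul]
  simp only [h1]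
  have h2 : ∀ φ : Fin k ↪ Fin n, matchingSum h (d ∘ φ) * (matchingCount (∑ v, d v - 2 * k) : ℝ) =
      ∑ δ ∈ (Fintype.piFinset fun _ : Fin k => Finset.range (2 * k + 1)) with ∑ i, δ i = 2 * k,
        if d ∘ φ = δ then matchingSum h δ * (matchingCount (∑ v, d v - 2 * k) : ℝ) else 0 := by
    intro φ
    rw [Finset.sum_ite_eq]
    split_ifs with hmem
    · rfl
    · rw [matchingSum_eq_zero hh, zero_mul]
      intro hs
      apply hmem
      rw [Finset.mem_filter, Fintype.mem_piFinset]
      refine ⟨fun i => ?_, hs⟩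
      rw [Finset.mem_range, Nat.lt_succ_iff, ← hs]
      exact Finset.single_le_sum (f := d ∘ φ) (fun _ _ => Nat.zero_le _) (Finset.mem_univ i)
  simp only [h2]
  rw [Finset.sum_comm]
  refine Finset.sum_congr rfl fun δ _ => ?_
  rw [← Finset.sum_filter, Finset.sum_const, nsmul_eq_mul, embeddingsOfDegrees]
  ring

theorem card_embeddingsOfDegrees_le {k : ℕ} (δ : Fin k → ℕ) :
    (embeddingsOfDegrees d δ).card ≤ ∏ i, degreeCount d (δ i) := by
  unfold degreeCount
  rw [← Fintype.card_piFinset]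
  refine Finset.card_le_card_of_injOn (fun φ => φ) ?_ ?_
  · intro φ hφ
    have := (Finset.mem_filter.1 (Finset.mem_coe.1 hφ)).2
    rw [Finset.mem_coe, Fintype.mem_piFinset]
    intro i
    simp [← this]
  · exact fun φ _ ψ _ h => DFunLike.coe_injective h

/-- `|A| + |I| = |A ∪ I| + |A ∩ I|` for the tuples with degrees `δ` and the injective tuples.
Injectivity thus excludes at most `n ^ k - n.descFactorial k` tuples, which is negligible against `n
^ k`. -/
theorem prod_degreeCount_le {k : ℕ} (δ : Fin k → ℕ) :
    ∏ i, degreeCount d (δ i) + n.descFactorial k ≤ (embeddingsOfDegrees d δ).card + n ^ k := by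
  classical
  unfold degreeCount
  rw [← Fintype.card_piFinset]
  set A := Fintype.piFinset fun i => Finset.univ.filter fun v => d v = δ i with hA
  let e : (Fin k ↪ Fin n) ↪ (Fin k → Fin n) :=
    ⟨fun φ => ⇑φ, fun _ _ h => DFunLike.coe_injective h⟩
  set I : Finset (Fin k → Fin n) := (Finset.univ : Finset (Fin k ↪ Fin n)).map e with hI
  have h1 : I.card = n.descFactorial k := by
    rw [hI, Finset.card_map, Finset.card_univ, Fintype.card_embedding_eq]
    simp
  have h2 : (A ∩ I).card ≤ (embeddingsOfDegrees d δ).card := by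
    rw [← Finset.card_map e]
    refine Finset.card_le_card fun f hf => ?_
    rw [Finset.mem_inter, hI, Finset.mem_map] at hf
    obtain ⟨hfA, φ, -, rfl⟩ := hf
    refine Finset.mem_map.2 ⟨φ, ?_, rfl⟩
    rw [embeddingsOfDegrees, Finset.mem_filter]
    refine ⟨Finset.mem_univ _, funext fun i => ?_⟩
    exact (Finset.mem_filter.1 (Fintype.mem_piFinset.1 hfA i)).2
  have h3 : (A ∪ I).card ≤ n ^ k := by
    refine (Finset.card_le_univ _).trans ?_
    simp
  have h4 := Finset.card_union_add_card_inter A I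
  rw [← h1]
  omega

end Finite

end ConfigurationModel

/-! ### Asymptotics under the regularity assumption -/

namespace RegularDegrees

open ConfigurationModel

variable {d : (n : ℕ) → Fin n → ℕ} {D : PMF ℕ}

theorem summable_firstMoment (hd : RegularDegrees d D) :
    Summable fun k : ℕ => (k : ℝ) * (D k).toReal := by
  refine Summable.of_nonneg_of_le (fun k => by positivity) (fun k => ?_) hd.finite_secondMoment
  refine mul_le_mul_of_nonneg_right ?_ ENNReal.toReal_nonneg
  have : k ≤ k ^ 2 := Nat.le_self_pow (by norm_num) k
  exact_mod_cast this

theorem hasSum_secondFactorialMoment (hd : RegularDegrees d D) :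
    HasSum (fun k : ℕ => (k : ℝ) * ((k : ℝ) - 1) * (D k).toReal)
      (secondMoment D - firstMoment D) := by
  have h1 : HasSum (fun k : ℕ => (k : ℝ) ^ 2 * (D k).toReal) (secondMoment D) :=
    hd.finite_secondMoment.hasSum
  have h2 : HasSum (fun k : ℕ => (k : ℝ) * (D k).toReal) (firstMoment D) :=
    hd.summable_firstMoment.hasSum
  refine (h1.sub h2).congr_fun fun k => ?_
  ring

theorem secondFactorialMoment_eq (hd : RegularDegrees d D) :
    secondFactorialMoment D = secondMoment D - firstMoment D :=
  hd.hasSum_secondFactorialMoment.tsum_eq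

theorem firstMoment_nonneg (D : PMF ℕ) : 0 ≤ firstMoment D :=
  tsum_nonneg fun k => by positivity

theorem secondFactorialMoment_nonneg (D : PMF ℕ) : 0 ≤ secondFactorialMoment D := by
  refine tsum_nonneg fun k => mul_nonneg ?_ ENNReal.toReal_nonneg
  rcases k with _ | k
  · simp
  · push_cast
    have : (0 : ℝ) ≤ k := by positivity
    nlinarith

/-- Here `D` is concentrated at `0`, and the exclusion of degrees of limiting probability zero
removes every positive degree. This settles the degenerate case, where dividing by `E[D]` is
meaningless. -/
theorem eventually_eq_zero (hd : RegularDegrees d D) (h0 : firstMoment D = 0) :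
    ∀ᶠ n in atTop, ∀ v, d n v = 0 := by
  have h1 : ∀ k : ℕ, (k : ℝ) * (D k).toReal = 0 := by
    have h2 : HasSum (fun k : ℕ => (k : ℝ) * (D k).toReal) (firstMoment D) :=
      hd.summable_firstMoment.hasSum
    rw [h0] at h2
    have := (hasSum_zero_iff_of_nonneg (fun k : ℕ =>
      (by positivity : 0 ≤ (k : ℝ) * (D k).toReal))).1 h2
    exact fun k => congrFun this k
  filter_upwards [hd.no_rare_degrees] with n hn v
  by_contra hv
  have h2 : D (d n v) = 0 := by
    rcases mul_eq_zero.1 (h1 (d n v)) with h | h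
    · exact absurd (by exact_mod_cast h) hv
    · rcases (ENNReal.toReal_eq_zero_iff _).1 h with h | h
      · exact h
      · exact absurd h (D.apply_ne_top _)
  have h3 := hn _ h2
  rw [degreeCount, Finset.card_eq_zero, Finset.eq_empty_iff_forall_notMem] at h3
  exact h3 v (by simp)

theorem tendsto_sum_mul_pred (hd : RegularDegrees d D) :
    Tendsto (fun n => ((∑ v, d n v * (d n v - 1) : ℕ) : ℝ) / n) atTop
      (𝓝 (secondMoment D - firstMoment D)) := by
  refine (hd.tendsto_secondMoment.sub hd.tendsto_firstMoment).congr fun n => ?_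
  rw [← sub_div, ← Finset.sum_sub_distrib]
  push_cast
  congr 1
  refine Finset.sum_congr rfl fun v _ => ?_
  rcases d n v with _ | k
  · simp
  · rw [Nat.add_sub_cancel]
    push_cast
    ring

theorem tendsto_sum_sub_div (hd : RegularDegrees d D) (h0 : 0 < firstMoment D) (j : ℕ) :
    Tendsto (fun n => ((∑ v, d n v - j : ℕ) : ℝ) / n) atTop (𝓝 (firstMoment D)) ∧
      Tendsto (fun n => ∑ v, d n v) atTop atTop := by
  have h1 : Tendsto (fun n => (∑ v, (d n v : ℝ))) atTop atTop := by
    have := hd.tendsto_firstMoment.pos_mul_atTop h0 tendsto_natCast_atTop_atTop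
    refine this.congr' ?_
    filter_upwards [eventually_gt_atTop 0] with n hn
    have : (n : ℝ) ≠ 0 := by positivity
    field_simp
  have h2 : Tendsto (fun n => ∑ v, d n v) atTop atTop := by
    rw [← tendsto_natCast_atTop_iff (R := ℝ)]
    exact h1.congr fun n => by push_cast; rfl
  refine ⟨?_, h2⟩
  have h3 : Tendsto (fun n : ℕ => (j : ℝ) / n) atTop (𝓝 0) :=
    tendsto_const_div_atTop_nhds_zero_nat _
  have h4 := hd.tendsto_firstMoment.sub h3
  rw [sub_zero] at h4
  refine h4.congr' ?_
  filter_upwards [h2.eventually_ge_atTop j] with n hn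
  rw [Nat.cast_sub hn, ← sub_div]
  push_cast
  rfl

/-- There are `∑ d (d - 1) ~ n E[D (D - 1)]` transits and `~ n E[D]` half-edges. Any `q` strictly
between `ν` and `1` absorbs the error terms. -/
theorem exists_eventually_subcritical (hd : RegularDegrees d D) (hν : nu D < 1) :
    ∃ q : ℝ, 0 ≤ q ∧ q < 1 ∧ ∀ᶠ n in atTop,
      Subcritical (Sigma.fst : HalfEdge (d n) → Fin n) q Finset.univ := by
  have hcard : ∀ n, (transits (Sigma.fst : HalfEdge (d n) → Fin n) Finset.univ).card =
      ∑ v, d n v * (d n v - 1) := fun n => by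
    have := card_transits_filter (d n) (fun _ => True)
    simpa using this
  rcases (firstMoment_nonneg D).eq_or_lt with h0 | h0
  · refine ⟨0, le_rfl, zero_lt_one, ?_⟩
    filter_upwards [hd.eventually_eq_zero h0.symm] with n hn
    rw [Subcritical, hcard]
    simp [hn]
  · have hnn : 0 ≤ nu D := div_nonneg (secondFactorialMoment_nonneg D) h0.le
    obtain ⟨q, hq1, hq2⟩ := exists_between hν
    refine ⟨q, hnn.trans hq1.le, hq2, ?_⟩
    have hlt : secondMoment D - firstMoment D < q * firstMoment D := by
      rw [← hd.secondFactorialMoment_eq]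
      exact (div_lt_iff₀ h0).1 hq1
    have h1 := ((hd.tendsto_sum_sub_div h0 1).1.const_mul q)
    have h2 := hd.tendsto_sum_mul_pred.eventually_lt h1 hlt
    filter_upwards [h2, eventually_gt_atTop 0] with n hn hn0
    rw [Subcritical, hcard, Finset.card_univ, card_halfEdge]
    have hn0' : (0 : ℝ) < n := by exact_mod_cast hn0
    rw [← mul_div_assoc, div_lt_div_iff_of_pos_right hn0'] at hn
    exact hn.le

/-- Uniform integrability of the squared degrees: the total of `d (d - 1)` converges after division
by `n`, and so does each bounded part, hence the part from large degrees is close to a tail of the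
series for `D`. -/
theorem exists_eventually_tail_le (hd : RegularDegrees d D) {ε : ℝ} (hε : 0 < ε) :
    ∃ Δ : ℕ, ∀ᶠ n in atTop, (((transits (Sigma.fst : HalfEdge (d n) → Fin n) Finset.univ).filter
      fun t => Δ < halfEdgeCount (Sigma.fst : HalfEdge (d n) → Fin n) t.1.1).card : ℝ) * matchingCount (∑ v, d n v - 2) ≤
      ε * matchingCount (∑ v, d n v) := by
  have hcard : ∀ (n Δ : ℕ), ((transits (Sigma.fst : HalfEdge (d n) → Fin n) Finset.univ).filter
      fun t => Δ < halfEdgeCount (Sigma.fst : HalfEdge (d n) → Fin n) t.1.1).card =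
      ∑ v with Δ < d n v, d n v * (d n v - 1) := fun n Δ => by
    simp only [halfEdgeCount_fst]
    exact card_transits_filter (d n) (fun v => Δ < d n v)
  simp only [hcard]
  rcases (firstMoment_nonneg D).eq_or_lt with h0 | h0
  · refine ⟨0, ?_⟩
    filter_upwards [hd.eventually_eq_zero h0.symm] with n hn
    simp [hn]
    positivity
  · have h1 := hd.hasSum_secondFactorialMoment.tendsto_sum_nat
    have h2 : ∀ᶠ m in atTop, secondMoment D - firstMoment D - ε * firstMoment D <
        ∑ k ∈ Finset.range m, (k : ℝ) * ((k : ℝ) - 1) * (D k).toReal :=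
      h1.eventually_const_lt (by nlinarith)
    obtain ⟨m, hm⟩ := h2.exists
    refine ⟨m, ?_⟩
    -- The partial sum covers degrees below `m` and the tail those above; degree `m` itself is
    -- discarded, which the inequality allows.
    have hsplit : ∀ n, ((∑ v with m < d n v, d n v * (d n v - 1) : ℕ) : ℝ) / n ≤
        ((∑ v, d n v * (d n v - 1) : ℕ) : ℝ) / n -
          ∑ k ∈ Finset.range m, (k : ℝ) * ((k : ℝ) - 1) * ((degreeCount (d n) k : ℝ) / n) := by
      intro n
      have h3 : ∑ k ∈ Finset.range m, k * (k - 1) * degreeCount (d n) k =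
          ∑ v with d n v ∈ Finset.range m, d n v * (d n v - 1) := by
        rw [← Finset.sum_fiberwise_of_maps_to (s := Finset.univ.filter fun v => d n v ∈ Finset.range m)
          (t := Finset.range m) (g := d n) (fun v hv => (Finset.mem_filter.1 hv).2)]
        refine Finset.sum_congr rfl fun k hk => ?_
        have : ((Finset.univ.filter fun v => d n v ∈ Finset.range m).filter fun v => d n v = k) =
            Finset.univ.filter fun v => d n v = k := by
          ext v
          simp only [Finset.mem_filter, Finset.mem_univ, true_and, and_iff_right_iff_imp]
          rintro rfl
          exact hk
        rw [this, degreeCount, mul_comm, ← smul_eq_mul, ← Finset.sum_const]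
        refine Finset.sum_congr rfl fun v hv => ?_
        rw [(Finset.mem_filter.1 hv).2]
      have h4 : ∑ k ∈ Finset.range m, k * (k - 1) * degreeCount (d n) k +
          ∑ v with m < d n v, d n v * (d n v - 1) ≤ ∑ v, d n v * (d n v - 1) := by
        rw [h3, ← Finset.sum_union]
        · exact Finset.sum_le_sum_of_subset (Finset.subset_univ _)
        · rw [Finset.disjoint_left]
          intro v hv hv'
          simp only [Finset.mem_filter, Finset.mem_range] at hv hv'
          omega
      have h5 : ∑ k ∈ Finset.range m, (k : ℝ) * ((k : ℝ) - 1) * ((degreeCount (d n) k : ℝ) / n) =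
          ((∑ k ∈ Finset.range m, k * (k - 1) * degreeCount (d n) k : ℕ) : ℝ) / n := by
        rw [Nat.cast_sum, Finset.sum_div]
        refine Finset.sum_congr rfl fun k _ => ?_
        rcases k with _ | k
        · simp
        · rw [Nat.add_sub_cancel]
          push_cast
          ring
      rw [h5, ← sub_div]
      refine div_le_div_of_nonneg_right ?_ (by positivity)
      rw [le_sub_iff_add_le, add_comm]
      exact_mod_cast h4
    have h6 : Tendsto (fun n => ((∑ v, d n v * (d n v - 1) : ℕ) : ℝ) / n -
          ∑ k ∈ Finset.range m, (k : ℝ) * ((k : ℝ) - 1) * ((degreeCount (d n) k : ℝ) / n)) atTop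
        (𝓝 (secondMoment D - firstMoment D -
          ∑ k ∈ Finset.range m, (k : ℝ) * ((k : ℝ) - 1) * (D k).toReal)) :=
      hd.tendsto_sum_mul_pred.sub (tendsto_finsetSum _ fun k _ => (hd.tendsto_law k).const_mul _)
    have h7 := (hd.tendsto_sum_sub_div h0 1)
    have h8 := h6.eventually_lt (h7.1.const_mul ε) (by linarith)
    filter_upwards [h8, eventually_gt_atTop 0, h7.2.eventually_ge_atTop 2] with n hn hn0 hN
    have hn0' : (0 : ℝ) < n := by exact_mod_cast hn0
    have h9 := (hsplit n).trans hn.le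
    rw [← mul_div_assoc, div_le_div_iff_of_pos_right hn0'] at h9
    rw [matchingCount_of_two_le hN]
    push_cast at h9 ⊢
    rw [← mul_assoc]
    exact mul_le_mul_of_nonneg_right h9 (by positivity)

theorem matchingCount_pos (hd : RegularDegrees d D) (n : ℕ) :
    (0 : ℝ) < matchingCount (∑ v, d n v) := by
  exact_mod_cast matchingCount_pos_of_even (even_sum_of_feasible _ (hd.feasible n))

/-- The ratio of successive matching counts is the reciprocal of `N - 2k - 1`, where `N ~ n E[D]` is
the number of half-edges. -/
theorem tendsto_matchingCount_ratio (hd : RegularDegrees d D) (h0 : 0 < firstMoment D) (k : ℕ) :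
    Tendsto (fun n : ℕ => (n : ℝ) ^ k * (matchingCount (∑ v, d n v - 2 * k) : ℝ) /
      matchingCount (∑ v, d n v)) atTop (𝓝 ((firstMoment D)⁻¹ ^ k)) := by
  induction k with
  | zero =>
    refine tendsto_const_nhds.congr fun n => ?_
    simp [(hd.matchingCount_pos n).ne']
  | succ k ih =>
    have h1 := hd.tendsto_sum_sub_div h0 (2 * k + 1)
    have h2 := ih.mul (h1.1.inv₀ h0.ne')
    rw [pow_succ]
    refine h2.congr' ?_
    filter_upwards [h1.2.eventually_ge_atTop (2 * k + 2)] with n hn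
    have h3 := matchingCount_of_two_le (n := ∑ v, d n v - 2 * k) (by omega)
    rw [show ∑ v, d n v - 2 * k - 1 = ∑ v, d n v - (2 * k + 1) by omega,
      show ∑ v, d n v - 2 * k - 2 = ∑ v, d n v - 2 * (k + 1) by omega] at h3
    rw [h3, inv_div]
    have h4 : ((∑ v, d n v - (2 * k + 1) : ℕ) : ℝ) ≠ 0 := by
      rw [Nat.cast_ne_zero]; omega
    have h5 := (hd.matchingCount_pos n).ne'
    rw [Nat.cast_mul]
    field_simp
    ring

theorem tendsto_card_embeddingsOfDegrees (hd : RegularDegrees d D) {k : ℕ} (δ : Fin k → ℕ) :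
    Tendsto (fun n => ((embeddingsOfDegrees (d n) δ).card : ℝ) / (n : ℝ) ^ k) atTop
      (𝓝 (∏ i, (D (δ i)).toReal)) := by
  have h1 : Tendsto (fun n => ∏ i, ((degreeCount (d n) (δ i) : ℝ) / n)) atTop
      (𝓝 (∏ i, (D (δ i)).toReal)) := tendsto_finsetProd _ fun i _ => hd.tendsto_law _
  have h2 : Tendsto (fun n : ℕ => 1 - ((k : ℝ) / n)) atTop (𝓝 1) := by
    simpa using (tendsto_const_nhds (x := (1 : ℝ))).sub
      (tendsto_const_div_atTop_nhds_zero_nat (k : ℝ))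
  have h3 : Tendsto (fun n => ∏ i, ((degreeCount (d n) (δ i) : ℝ) / n) +
      (1 - ((k : ℝ) / n)) ^ k - 1) atTop (𝓝 (∏ i, (D (δ i)).toReal)) := by
    have := (h1.add (h2.pow k)).sub_const 1
    simpa using this
  have hp : ∀ n, ∏ i, ((degreeCount (d n) (δ i) : ℝ) / n) =
      ((∏ i, degreeCount (d n) (δ i) : ℕ) : ℝ) / (n : ℝ) ^ k := fun n => by
    rw [Finset.prod_div_distrib]
    simp
  refine tendsto_of_tendsto_of_tendsto_of_le_of_le' h3 h1 ?_ ?_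
  · filter_upwards [eventually_ge_atTop k, eventually_gt_atTop 0] with n hn hn0
    have hn0' : (0 : ℝ) < n := by exact_mod_cast hn0
    have h4 : (1 - (k : ℝ) / n) ^ k ≤ (n.descFactorial k : ℝ) / (n : ℝ) ^ k := by
      rw [show 1 - (k : ℝ) / n = ((n : ℝ) - k) / n by field_simp, div_pow]
      refine div_le_div_of_nonneg_right ?_ (by positivity)
      have h5 : (n - k) ^ k ≤ n.descFactorial k :=
        (Nat.pow_le_pow_left (by omega) k).trans (Nat.pow_sub_le_descFactorial n k)
      rw [← Nat.cast_sub hn]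
      exact_mod_cast h5
    have h6 : ((∏ i, degreeCount (d n) (δ i) : ℕ) : ℝ) + (n.descFactorial k : ℝ) ≤
        ((embeddingsOfDegrees (d n) δ).card : ℝ) + (n : ℝ) ^ k := by
      exact_mod_cast prod_degreeCount_le (d n) δ
    have h7 := div_le_div_of_nonneg_right h6 (by positivity : 0 ≤ (n : ℝ) ^ k)
    rw [add_div, add_div, div_self (by positivity : (n : ℝ) ^ k ≠ 0)] at h7
    rw [hp]
    linarith
  · filter_upwards with n
    rw [hp]
    refine div_le_div_of_nonneg_right ?_ (by positivity)
    exact_mod_cast card_embeddingsOfDegrees_le (d n) δ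

/-- The number of embeddings is of order at most `n ^ k`, and prescribing `k` pairs costs `n ^
(-k)`. If `E[D] = 0`, only the empty embedding survives for large `n`. -/
theorem exists_tendsto_embeddings_mul (hd : RegularDegrees d D) {k : ℕ} (δ : Fin k → ℕ)
    (hδ : ∑ i, δ i = 2 * k) :
    ∃ l, Tendsto (fun n => ((embeddingsOfDegrees (d n) δ).card *
      matchingCount (∑ v, d n v - 2 * k) : ℝ) / matchingCount (∑ v, d n v)) atTop (𝓝 l) := by
  rcases (firstMoment_nonneg D).eq_or_lt with h0 | h0
  · rcases Nat.eq_zero_or_pos k with rfl | hk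
    · refine ⟨1, tendsto_const_nhds.congr fun n => ?_⟩
      have : (embeddingsOfDegrees (d n) δ).card = 1 := by
        rw [embeddingsOfDegrees, Finset.filter_true_of_mem fun φ _ => Subsingleton.elim _ _]
        simp
      simp [this, (hd.matchingCount_pos n).ne']
    · refine ⟨0, tendsto_const_nhds.congr' ?_⟩
      filter_upwards [hd.eventually_eq_zero h0.symm] with n hn
      have : (embeddingsOfDegrees (d n) δ).card = 0 := by
        rw [Finset.card_eq_zero, Finset.eq_empty_iff_forall_notMem]
        intro φ hφ
        have h1 := (Finset.mem_filter.1 hφ).2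
        rw [← h1] at hδ
        simp [hn] at hδ
        omega
      simp [this]
  · refine ⟨_, ((hd.tendsto_card_embeddingsOfDegrees δ).mul
      (hd.tendsto_matchingCount_ratio h0 k)).congr' ?_⟩
    filter_upwards [eventually_gt_atTop 0] with n hn
    have : (n : ℝ) ≠ 0 := by positivity
    have h5 := (hd.matchingCount_pos n).ne'
    field_simp

open Classical in
theorem exists_tendsto_sum_closedRange (hd : RegularDegrees d D) {k : ℕ}
    {h : Multigraph (Fin k) → ℝ} (hh : ∀ G, h G ≠ 0 → G.edgeCount = k) :
    ∃ l, Tendsto (fun n => (∑ M ∈ perfectMatchings (Finset.univ : Finset (HalfEdge (d n))),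
      ∑ φ : Fin k ↪ Fin n, (if (matchingGraph Sigma.fst M).ClosedRange φ then
        h ((matchingGraph Sigma.fst M).pullback φ) else 0)) / matchingCount (∑ v, d n v))
      atTop (𝓝 l) := by
  have h1 : ∀ δ : Fin k → ℕ, ∃ l, ∑ i, δ i = 2 * k →
      Tendsto (fun n => ((embeddingsOfDegrees (d n) δ).card *
      matchingCount (∑ v, d n v - 2 * k) : ℝ) / matchingCount (∑ v, d n v)) atTop (𝓝 l) := by
    intro δ
    by_cases hδ : ∑ i, δ i = 2 * k
    · obtain ⟨l, hl⟩ := hd.exists_tendsto_embeddings_mul δ hδ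
      exact ⟨l, fun _ => hl⟩
    · exact ⟨0, fun h => absurd h hδ⟩
  choose l hl using h1
  refine ⟨∑ δ ∈ (Fintype.piFinset fun _ : Fin k => Finset.range (2 * k + 1)) with
    ∑ i, δ i = 2 * k, matchingSum h δ * l δ, ?_⟩
  simp only [sum_closedRange_eq _ hh, Finset.sum_div, mul_div_assoc]
  refine tendsto_finsetSum _ fun δ hδ => Tendsto.const_mul _ ?_
  simpa only [mul_div_assoc] using hl δ (Finset.mem_filter.1 hδ).2

end RegularDegrees

/-! ### Tightness of the fragment and convergence of its law -/

namespace RegularDegrees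

open ConfigurationModel

variable {d : (n : ℕ) → Fin n → ℕ} {D : PMF ℕ}

open Classical in
-- First `Δ` is chosen to make cycles at large degrees rare, then `K` is chosen depending on `Δ` for
-- the bound by Markov's inequality; each contributes `ε / 2`.
theorem exists_eventually_prob_large_le (hd : RegularDegrees d D) (hν : nu D < 1) {ε : ℝ}
    (hε : 0 < ε) : ∃ K : ℕ, ∀ᶠ n in atTop,
      (((perfectMatchings (Finset.univ : Finset (HalfEdge (d n)))).filter fun M =>
        K < (matchingGraph Sigma.fst M).fragVerts.ncard).card : ℝ) ≤
      ε * matchingCount (∑ v, d n v) := by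
  obtain ⟨q, q0, q1, hq⟩ := hd.exists_eventually_subcritical hν
  have hq' : 0 < (1 - q)⁻¹ := inv_pos.2 (by linarith)
  obtain ⟨Δ, hΔ⟩ := hd.exists_eventually_tail_le (ε := ε / 2 / (1 - q)⁻¹) (by positivity)
  obtain ⟨K, hK⟩ := exists_nat_gt (((1 - q)⁻¹ + Δ * (1 - q)⁻¹ ^ 2) / (ε / 2))
  have hK0 : (0 : ℝ) < K := lt_of_le_of_lt (by positivity) hK
  refine ⟨K, ?_⟩
  filter_upwards [hq, hΔ] with n hn hnΔ
  have h1 := card_lt_ncard_fragVerts_le q0 q1 hn Δ K (by exact_mod_cast hK0)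
  rw [card_halfEdge] at h1
  refine h1.trans ?_
  have h2 := mul_le_mul_of_nonneg_left hnΔ hq'.le
  have h3 : ((1 - q)⁻¹ + Δ * (1 - q)⁻¹ ^ 2) / K ≤ ε / 2 := by
    rw [div_le_iff₀ hK0]
    rw [div_lt_iff₀ (by positivity)] at hK
    linarith
  have h4 := mul_le_mul_of_nonneg_right h3 (hd.matchingCount_pos n).le
  have h5 : (1 - q)⁻¹ * (ε / 2 / (1 - q)⁻¹ * (matchingCount (∑ v, d n v) : ℝ)) =
      ε / 2 * matchingCount (∑ v, d n v) := by
    rw [← mul_assoc, mul_div_cancel₀ _ hq'.ne']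
  rw [h5] at h2
  linarith

open Classical in
-- The approximants are the truncated expectations, each of which converges. The error is bounded by
-- tightness together with the bound on `E[9 ^ X]`.
theorem exists_tendsto_approx_fragProb (hd : RegularDegrees d D) (hν : nu D < 1)
    (H : UnlabelledFragment) {ε : ℝ} (hε : 0 < ε) :
    ∃ (a : ℕ → ℝ) (l : ℝ), Tendsto a atTop (𝓝 l) ∧
      ∀ᶠ n in atTop, |a n - fragProb (d n) H| ≤ ε := by
  obtain ⟨q, q0, q1, hq⟩ := hd.exists_eventually_subcritical hν
  set C := Real.exp (8 * (1 - q)⁻¹) with hC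
  have hC0 : 0 < C := Real.exp_pos _
  -- Then `η C = ε / 2`, and the probability `η (ε / 2)` allowed to large fragments gives `ε / 2`
  -- after multiplication by `η⁻¹`.
  set η := ε / (2 * C) with hη
  have hη0 : 0 < η := by positivity
  obtain ⟨K, hK⟩ := hd.exists_eventually_prob_large_le hν (ε := η * (ε / 2)) (by positivity)
  let Y : (n : ℕ) → Finset (Sym2 (HalfEdge (d n))) → ℕ → ℝ := fun n M k =>
    ∑ φ : Fin k ↪ Fin n, (if (matchingGraph Sigma.fst M).ClosedRange φ then
      Multigraph.signedWeight H ((matchingGraph Sigma.fst M).pullback φ) else 0)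
  have hlim : ∀ k, ∃ l, Tendsto (fun n =>
      (∑ M ∈ perfectMatchings (Finset.univ : Finset (HalfEdge (d n))), Y n M k) /
        matchingCount (∑ v, d n v)) atTop (𝓝 l) := fun k =>
    hd.exists_tendsto_sum_closedRange fun G hG => by
      rw [Multigraph.edgeCount_eq_of_signedWeight_ne_zero hG, Nat.card_eq_fintype_card,
        Fintype.card_fin]
  choose l hl using hlim
  refine ⟨fun n => ∑ k ∈ Finset.range (K + 1), ((k.factorial : ℝ))⁻¹ *
      ((∑ M ∈ perfectMatchings (Finset.univ : Finset (HalfEdge (d n))), Y n M k) /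
        matchingCount (∑ v, d n v)),
    ∑ k ∈ Finset.range (K + 1), ((k.factorial : ℝ))⁻¹ * l k,
    tendsto_finsetSum _ fun k _ => (hl k).const_mul _, ?_⟩
  filter_upwards [hq, hK] with n hn hnK
  have hpos := hd.matchingCount_pos n
  have h1 : ∑ k ∈ Finset.range (K + 1), ((k.factorial : ℝ))⁻¹ *
      ((∑ M ∈ perfectMatchings (Finset.univ : Finset (HalfEdge (d n))), Y n M k) /
        matchingCount (∑ v, d n v)) - fragProb (d n) H =
      (∑ M ∈ perfectMatchings (Finset.univ : Finset (HalfEdge (d n))),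
        (∑ k ∈ Finset.range (K + 1), ((k.factorial : ℝ))⁻¹ * Y n M k -
          if (matchingGraph Sigma.fst M).frag.IsCopyOf H then 1 else 0)) /
        matchingCount (∑ v, d n v) := by
    rw [fragProb, prob_eq, Finset.sum_sub_distrib, sub_div]
    congr 1
    rw [Finset.sum_comm, Finset.sum_div]
    refine Finset.sum_congr rfl fun k _ => ?_
    rw [← Finset.mul_sum, mul_div_assoc]
  rw [h1, abs_div, abs_of_pos hpos, div_le_iff₀ hpos]
  refine (Finset.abs_sum_le_sum_abs _ _).trans ?_
  have h2 : ∀ M ∈ perfectMatchings (Finset.univ : Finset (HalfEdge (d n))),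
      |∑ k ∈ Finset.range (K + 1), ((k.factorial : ℝ))⁻¹ * Y n M k -
          if (matchingGraph Sigma.fst M).frag.IsCopyOf H then 1 else 0| ≤
      η⁻¹ * (if K < (matchingGraph Sigma.fst M).fragVerts.ncard then 1 else 0) +
      η * 9 ^ (matchingGraph Sigma.fst M).unicyclicComponents.card := by
    intro M _
    refine (Multigraph.abs_sum_signedWeight_truncated_le _ H K).trans ?_
    split_ifs
    · have h9 : (9 : ℝ) ^ (matchingGraph Sigma.fst M).unicyclicComponents.card =
          (3 ^ (matchingGraph Sigma.fst M).unicyclicComponents.card) ^ 2 := by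
        rw [← pow_mul, mul_comm, pow_mul]
        norm_num
      rw [h9]
      set x : ℝ := 3 ^ (matchingGraph Sigma.fst M).unicyclicComponents.card
      -- Expanding the square gives `2x ≤ η⁻¹ + η x ^ 2`, which separates the rare event from the
      -- number of components.
      have h3 : 0 ≤ η⁻¹ * (1 - η * x) ^ 2 := by positivity
      have h4 : η⁻¹ * (1 - η * x) ^ 2 = η⁻¹ * 1 + η * x ^ 2 - 2 * x := by
        field_simp
        ring
      linarith
    · positivity
  refine (Finset.sum_le_sum h2).trans ?_
  rw [Finset.sum_add_distrib, ← Finset.mul_sum, ← Finset.mul_sum]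
  have h5 := sum_nine_pow_le q0 q1 hn
  rw [card_halfEdge] at h5
  have h6 := mul_le_mul_of_nonneg_left h5 hη0.le
  rw [Finset.card_filter] at hnK
  push_cast at hnK
  have h7 := mul_le_mul_of_nonneg_left hnK (inv_nonneg.2 hη0.le)
  have h8 : η⁻¹ * (η * (ε / 2) * (matchingCount (∑ v, d n v) : ℝ)) =
      ε / 2 * matchingCount (∑ v, d n v) := by
    field_simp
  have h9 : η * (C * (matchingCount (∑ v, d n v) : ℝ)) = ε / 2 * matchingCount (∑ v, d n v) := by
    rw [hη]
    field_simp
  rw [h8] at h7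
  rw [h9] at h6
  linarith

/-- A sequence uniformly close, up to any `ε`, to convergent sequences is Cauchy. The comparison of
two terms has four errors of size at most `ε / 5`. -/
theorem exists_tendsto_fragProb (hd : RegularDegrees d D) (hν : nu D < 1)
    (H : UnlabelledFragment) : ∃ p, Tendsto (fun n => fragProb (d n) H) atTop (𝓝 p) := by
  refine cauchySeq_tendsto_of_complete (Metric.cauchySeq_iff'.2 fun ε hε => ?_)
  obtain ⟨a, l, hal, ha⟩ := hd.exists_tendsto_approx_fragProb hν H (ε := ε / 5) (by positivity)
  have h1 := (Metric.tendsto_atTop.1 hal) (ε / 5) (by positivity)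
  obtain ⟨N₁, hN₁⟩ := h1
  obtain ⟨N₂, hN₂⟩ := eventually_atTop.1 ha
  refine ⟨max N₁ N₂, fun n hn => ?_⟩
  have e1 := hN₁ n ((le_max_left _ _).trans hn)
  have e2 := hN₁ _ (le_max_left N₁ N₂)
  have e3 := hN₂ n ((le_max_right _ _).trans hn)
  have e4 := hN₂ _ (le_max_right N₁ N₂)
  rw [Real.dist_eq, abs_lt] at *
  rw [abs_le] at e3 e4
  constructor <;> linarith [e1.1, e1.2, e2.1, e2.2, e3.1, e3.2, e4.1, e4.2]

end RegularDegrees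

/-! ### Finiteness of small fragments and total mass one -/

namespace UnlabelledFragment

/-- The fragments with at most `K` vertices. -/
def ofOrderLE (K : ℕ) : Set UnlabelledFragment :=
  {H | ∃ F : FiniteFragment, F.order ≤ K ∧ Quotient.mk FiniteFragment.isoSetoid F = H}

/-- A fragment on `k` vertices has `k` edges, so all its multiplicities are at most `k`. -/
theorem finite_ofOrderLE (K : ℕ) : (ofOrderLE K).Finite := by
  have h1 : ∀ k : ℕ, {G : Multigraph (Fin k) | G.edgeCount = k}.Finite := by
    intro k
    have hinj : Function.Injective (Multigraph.mult : Multigraph (Fin k) → _) :=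
      fun G G' h => Multigraph.ext h
    refine Set.Finite.of_finite_image (f := Multigraph.mult) ?_ hinj.injOn
    refine (Set.Finite.pi' (t := fun _ : Sym2 (Fin k) => Set.Iic k) fun _ => Set.finite_Iic k).subset ?_
    rintro _ ⟨G, hG, rfl⟩ e
    have hG' : G.edgeCount = k := hG
    rw [Multigraph.edgeCount, finsum_eq_sum_of_fintype] at hG'
    refine Set.mem_Iic.2 (le_of_le_of_eq ?_ hG')
    exact Finset.single_le_sum (f := G.mult) (fun _ _ => Nat.zero_le _) (Finset.mem_univ e)
  have h2 : {p : Σ k : ℕ, Multigraph (Fin k) | p.1 ≤ K ∧ p.2.edgeCount = p.1}.Finite := by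
    refine ((Set.finite_Iic K).biUnion fun k _ => (h1 k).image (Sigma.mk k)).subset ?_
    rintro ⟨k, G⟩ ⟨hk, hG⟩
    exact Set.mem_biUnion (Set.mem_Iic.2 hk) ⟨G, hG, rfl⟩
  have h3 : {F : FiniteFragment | F.order ≤ K}.Finite := by
    refine Set.Finite.of_finite_image (f := fun F : FiniteFragment =>
      (⟨F.order, F.graph⟩ : Σ k : ℕ, Multigraph (Fin k))) (h2.subset ?_) ?_
    · rintro _ ⟨F, hF, rfl⟩
      refine ⟨hF, ?_⟩
      have := F.isFragment.edgeCount_eq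
      rwa [Nat.card_eq_fintype_card, Fintype.card_fin] at this
    · rintro ⟨k, G, hG⟩ _ ⟨k', G', hG'⟩ _ h
      simp only [Sigma.mk.injEq] at h
      obtain ⟨rfl, h⟩ := h
      rw [heq_eq_eq] at h
      subst h
      rfl
  refine (h3.image (Quotient.mk FiniteFragment.isoSetoid)).subset ?_
  rintro H ⟨F, hF, rfl⟩
  exact ⟨F, hF, rfl⟩

end UnlabelledFragment

theorem Multigraph.exists_frag_isCopyOf {n : ℕ} (G : Multigraph (Fin n)) {K : ℕ}
    (hK : G.fragVerts.ncard ≤ K) : ∃ H ∈ UnlabelledFragment.ofOrderLE K, G.frag.IsCopyOf H := by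
  let e : Fin (Nat.card G.fragVerts) ≃ G.fragVerts := (Finite.equivFin _).symm
  have hiso : G.frag.Isomorphic (G.frag.pullback e) :=
    (Multigraph.isomorphic_iff_pullback.2 ⟨e, rfl⟩ :
      (G.frag.pullback e).Isomorphic G.frag).symm
  have hc := G.frag.closedRange_of_surjective e.surjective
  let F : FiniteFragment := ⟨_, G.frag.pullback e, fun C =>
    (Multigraph.unicyclicComponent_componentMap e.injective hc C).1 (G.isFragment_frag _)⟩
  exact ⟨Quotient.mk FiniteFragment.isoSetoid F, ⟨F, hK, rfl⟩, F, rfl, hiso⟩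

theorem mainTheorem11 (d : (n : ℕ) → Fin n → ℕ) (D : PMF ℕ) (hd : RegularDegrees d D)
    (hν : nu D < 1) :
    ∃ p : UnlabelledFragment → ℝ,
      (∀ H : UnlabelledFragment,
        Tendsto (fun n => ConfigurationModel.fragProb (d n) H) atTop (𝓝 (p H))) ∧
      HasSum p 1 := by
  classical
  choose p hp using fun H => hd.exists_tendsto_fragProb hν H
  refine ⟨p, hp, ?_⟩
  have hprob : ∀ n H, ConfigurationModel.fragProb (d n) H =
      (∑ M ∈ perfectMatchings (Finset.univ : Finset (ConfigurationModel.HalfEdge (d n))),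
        if (matchingGraph Sigma.fst M).frag.IsCopyOf H then (1 : ℝ) else 0) /
        matchingCount (∑ v, d n v) := fun n H => ConfigurationModel.prob_eq _ _
  have hcard : ∀ n, ((perfectMatchings
      (Finset.univ : Finset (ConfigurationModel.HalfEdge (d n)))).card : ℝ) =
      matchingCount (∑ v, d n v) := fun n => by
    rw [card_perfectMatchings, Finset.card_univ, ConfigurationModel.card_halfEdge]
  have hp0 : ∀ H, 0 ≤ p H := fun H => ge_of_tendsto' (hp H) fun n => by
    rw [hprob]
    exact div_nonneg (Finset.sum_nonneg fun _ _ => by split_ifs <;> norm_num) (by positivity)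
  -- Each matching has a fragment in at most one isomorphism class; the finite sum of probabilities
  -- is thus at most one before the limit.
  have hle : ∀ s : Finset UnlabelledFragment, ∑ H ∈ s, p H ≤ 1 := by
    intro s
    refine le_of_tendsto' (tendsto_finsetSum s fun H _ => hp H) fun n => ?_
    simp only [hprob]
    rw [← Finset.sum_div, Finset.sum_comm, div_le_one (hd.matchingCount_pos n), ← hcard,
      Finset.card_eq_sum_ones, Nat.cast_sum]
    refine Finset.sum_le_sum fun M _ => ?_
    rw [← Finset.sum_filter, Finset.sum_const, nsmul_eq_mul, mul_one, Nat.cast_le,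
      Finset.card_le_one]
    intro H hH H' hH'
    exact (Finset.mem_filter.1 hH).2.unique (Finset.mem_filter.1 hH').2
  -- No mass escapes: outside an event of probability at most `ε` the fragment belongs to the finite
  -- set of classes with at most `K` vertices, and limits commute with a finite sum.
  have hge : ∀ ε > 0, ∃ s : Finset UnlabelledFragment, 1 - ε ≤ ∑ H ∈ s, p H := by
    intro ε hε
    obtain ⟨K, hK⟩ := hd.exists_eventually_prob_large_le hν hε
    refine ⟨(UnlabelledFragment.finite_ofOrderLE K).toFinset,
      ge_of_tendsto (tendsto_finsetSum _ fun H _ => hp H) ?_⟩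
    filter_upwards [hK] with n hn
    simp only [hprob]
    rw [← Finset.sum_div, Finset.sum_comm, le_div_iff₀ (hd.matchingCount_pos n), sub_mul, one_mul,
      sub_le_iff_le_add]
    refine le_trans ?_ (add_le_add_right hn _)
    rw [← hcard, Finset.card_filter, Nat.cast_sum, ← Finset.sum_add_distrib,
      Finset.card_eq_sum_ones, Nat.cast_sum]
    refine Finset.sum_le_sum fun M _ => ?_
    by_cases hM : K < (matchingGraph Sigma.fst M).fragVerts.ncard
    · rw [if_pos hM]
      have : (0 : ℝ) ≤ ∑ H ∈ (UnlabelledFragment.finite_ofOrderLE K).toFinset,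
          (if (matchingGraph Sigma.fst M).frag.IsCopyOf H then (1 : ℝ) else 0) :=
        Finset.sum_nonneg fun _ _ => by split_ifs <;> norm_num
      push_cast
      linarith
    · rw [if_neg hM]
      obtain ⟨H, hH, hcopy⟩ := Multigraph.exists_frag_isCopyOf _ (not_lt.1 hM)
      have := Finset.single_le_sum (f := fun H =>
        if (matchingGraph Sigma.fst M).frag.IsCopyOf H then (1 : ℝ) else 0)
        (fun _ _ => by split_ifs <;> norm_num)
        ((UnlabelledFragment.finite_ofOrderLE K).mem_toFinset.2 hH)
      simp only [hcopy, if_true] at this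
      push_cast
      linarith
  refine hasSum_of_isLUB_of_nonneg 1 hp0 ⟨?_, ?_⟩
  · rintro _ ⟨s, rfl⟩
    exact hle s
  · intro b hb
    refine le_of_forall_pos_le_add fun ε hε => ?_
    obtain ⟨s, hs⟩ := hge ε hε
    have := hb ⟨s, rfl⟩
    dsimp only at this
    linarith
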